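/- Setting. Let $\mathcal Y$ be a measurable space, let $\Omega=\mathcal Y^{\mathbb Z}$ with the left shift $\theta$, and let $P$ be a shift-invariant probability measure on $\Omega$, i.e. the law of a stationary process $(\xi_n)_{n\in\mathbb Z}$. Measurability in $\omega$ is meant with respect to the $P$-completion. Put $$\phi(n)=\sup\{|P(B|A)-P(B)|:\ k\in\mathbb Z,\ A\in\sigma(\xi_l,\,l\le k),\ B\in\sigma(\xi_l,\,l\ge k+n),\ P(A)>0\}$$ and assume $\sum_{n\ge1}\phi(n)<\infty$. Let $\mathcal X$ be a compact metric space and let $\mathcal E_\omega\subset\mathcal X$ ($\omega\in\Omega$) be compact sets such that $\mathcal E=\{(\omega,x):x\in\mathcal E_\omega\}$ is measurable. Let $H^\omega$ be a complex Banach space of functions $\mathcal E_\omega\to\mathbb C$ containing the constants, with $\|g\|\ge\sup|g|$ and $\|\mathbf 1\|=1$. Let $\mu_\omega$ be a random probability measure on $\mathcal E_\omega$, let $\mathcal A_z^\omega:H^\omega\to H^{\theta\omega}$ ($z\in\mathbb C$) be continuous linear operators, $\mathcal A_z^{\omega,n}=\mathcal A_z^{\theta^{n-1}\omega}\circ\cdots\circ\mathcal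 A_z^{\omega}$, and let $S_n^\omega:\mathcal E_\omega\to\mathbb R$ ($n\ge1$) be Borel functions such that, $P$-a.s., for all $n\ge 1$: $S_n^\omega\in L^k(\mu_\omega)$ for all $k\ge1$, $\mu_\omega(S_n^\omega)=0$, and for all $z\in\mathbb C$ the function $e^{zS_n^\omega}$ is $\mu_\omega$-integrable with $\mu_\omega(e^{zS_n^\omega})=\mu_{\theta^n\omega}(\mathcal A_z^{\omega,n}\mathbf 1)$. Assume that there are constants $\rho,C>0$, $\delta\in(0,1)$ such that $P$-a.s., for every $|z|<\rho$, there are $\lambda_\omega(z)\in\mathbb C\setminus\{0\}$, $h_\omega(z)\in H^\omega$ and $\nu_\omega(z)\in(H^\omega)^*$ with $\nu_\omega(z)\mathbf 1=1$ and, for all $g\in H^\omega$ and $n\ge1$, $$\Big\|\Big(\prod_{j=0}^{n-1}\lambda_{\theta^j\omega}(z)\Big)^{-1}\mathcal A_z^{\omega,n}g-\nu_\omega(z)(g)\,h_{\theta^n\omega}(z)\Big\|\le C\|g\|\delta^n ;$$ that the triplet is measurable in $\omega$, analytic in $z$, and bounded uniformly in $|z|<\rho$ and $P$-a.e. $\omega$;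 and that $\nu_\omega(0)=\mu_\omega$, $h_\omega(0)=\mathbf 1$, $\lambda_\omega(0)=1$. Finally assume that $\mathcal A_z^\omega$ depends, measurably, only on the $0$-th coordinate $\omega_0$. That is, $P$-a.s., $\mathcal E_\omega=\mathcal E(\omega_0)$ for a measurable family of sets indexed by $\mathcal Y$, and the values of $\mathcal A_z^\omega g$ on $\mathcal E_{\theta\omega}$ are determined by $z$, $\omega_0$ and $g$; and for all $z\in\mathbb C$, $n\ge1$ there is a measurable $G_{z,n}:\mathcal Y^n\times\mathcal X\to\mathbb C$ with $(\mathcal A_z^{\omega,n}\mathbf 1)(x)=G_{z,n}(\omega_0,\dots,\omega_{n-1},x)$ for $P$-a.e. $\omega$ and all $x\in\mathcal E_{\theta^n\omega}$. Statement. There are real constants $\gamma_k$, $k\ge2$, and random variables $R_{\omega,k}$ such that $P$-almost surely, for all integers $k\ge2$ and $n\ge2$, $$\Big|n^{-[k/2]}\int_{\mathcal E_\omega}(S_n^\omega)^k\,d\mu_\omega-\gamma_k\Big|\le R_{\omega,k}\,n^{-1/2}\ln n .$$ With $\sigma^2=\gamma_2$, the limits satisfy $\gamma_k=\frac{k!}{2^{k/2}(k/2)!}\,\sigma^{k}$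 for even $k\ge2$ and $\gamma_k=\frac{k!}{3!\,2^{(k-3)/2}((k-3)/2)!}\,\sigma^{k-3}\gamma_3$ for odd $k\ge3$. Moreover, if $\sigma^2>0$, there is a random variable $q_\omega$ such that $P$-almost surely, for all $n\ge2$, $$\sup_{s\in\mathbb R}\Big|\mu_\omega\{x\in\mathcal E_\omega:S_n^\omega(x)\le s\sqrt n\}-\frac1{\sqrt{2\pi\sigma^2}}\int_{-\infty}^s e^{-t^2/(2\sigma^2)}\,dt\Big|\le q_\omega\,n^{-1/2}\ln n .$$ -/

import Mathlib

open MeasureTheory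

namespace RandomRPF

/-- A Banach space `H` (complete norm supplied by instances) of complex valued functions on a set
`E ⊆ X`. A function on `E` is identified with its extension by `0` to `X`. The space contains the
constant functions, its norm dominates the supremum norm, and the constant `1` has norm `1`. -/
structure FunctionSpace {X : Type*} (H : Type*) [NormedAddCommGroup H] [NormedSpace ℂ H]
    (E : Set X) where
  /-- the function represented by an element of `H` -/
  toFun : H →ₗ[ℂ] (X → ℂ)
  injective : Function.Injective toFun
  eq_zero_of_notMem : ∀ g : H, ∀ x ∉ E, toFun g x = 0
  norm_apply_le : ∀ (g : H) (x : X), ‖toFun g x‖ ≤ ‖g‖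
  /-- the constant function `1` on `E` -/
  one : H
  one_apply : ∀ x ∈ E, toFun one x = 1
  norm_one : ‖one‖ = 1

/-- Joint measurability in `(ω, x)`, where the first factor carries the `P`-completion of its
σ-algebra: up to a `P`-null set of `ω` the function is a product measurable one. -/
def JointlyMeasurable {Ω X : Type*} [MeasurableSpace Ω] [MeasurableSpace X] (P : Measure Ω)
    (f : Ω → X → ℂ) : Prop :=
  ∃ f' : Ω × X → ℂ, Measurable f' ∧ ∀ᵐ ω ∂P, ∀ x, f ω x = f' (ω, x)

section Operators

variable {Ω : Type*} {θ : Ω → Ω} {H : Ω → Type*} [∀ ω, NormedAddCommGroup (H ω)]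
  [∀ ω, NormedSpace ℂ (H ω)]

/-- The iterates `A_z^{ω,n} = A_z^{θ^{n-1}ω} ∘ ⋯ ∘ A_z^{θω} ∘ A_z^ω`. -/
noncomputable def iter (A : ℂ → ∀ ω, H ω →L[ℂ] H (θ ω)) (z : ℂ) :
    ∀ (n : ℕ) (ω : Ω), H ω →L[ℂ] H (θ^[n] ω)
  | 0, ω => ContinuousLinearMap.id ℂ (H ω)
  | n + 1, ω => (iter A z n (θ ω)).comp (A z ω)

end Operators

/-- The standing set-up: random compact fibers `E_ω`, Banach spaces `H_ω` of functions on them,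
random probability measures `μ_ω` on `E_ω`, operators `A_z^ω : H_ω → H_{θω}` and centered Borel
functions `S_n^ω` (`n ≥ 1`) on `E_ω`, with all moments, whose moment generating functions are
`μ_ω(e^{z S_n^ω}) = μ_{θ^n ω}(A_z^{ω,n} 1)`. -/
structure IsOperatorModel {Ω X : Type*} [MeasurableSpace Ω] [MetricSpace X] [MeasurableSpace X]
    (P : Measure Ω) (θ : Ω → Ω) (E : Ω → Set X) (H : Ω → Type*)
    [∀ ω, NormedAddCommGroup (H ω)] [∀ ω, NormedSpace ℂ (H ω)]
    (F : ∀ ω, FunctionSpace (H ω) (E ω)) (A : ℂ → ∀ ω, H ω →L[ℂ] H (θ ω))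
    (μ : Ω → Measure X) (S : ℕ → Ω → X → ℝ) : Prop where
  isCompact_fiber : ∀ ω, IsCompact (E ω)
  measurable_fiber : ∃ E' : Set (Ω × X), MeasurableSet E' ∧
    ∀ᵐ ω ∂P, ∀ x, x ∈ E ω ↔ (ω, x) ∈ E'
  isProbabilityMeasure : ∀ ω, IsProbabilityMeasure (μ ω)
  fiber_compl : ∀ ω, μ ω (E ω)ᶜ = 0
  aemeasurable_measure : AEMeasurable μ P
  measurable_sum : ∀ n ≥ 1, ∀ ω, Measurable fun x : E ω => S n ω x
  memLp_sum : ∀ᵐ ω ∂P, ∀ n ≥ 1, ∀ k : ℕ, 1 ≤ k → MemLp (S n ω) k (μ ω)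
  centered : ∀ᵐ ω ∂P, ∀ n ≥ 1, ∫ x, S n ω x ∂(μ ω) = 0
  mgf_eq : ∀ᵐ ω ∂P, ∀ z : ℂ, ∀ n ≥ 1,
    Integrable (fun x => Complex.exp (z * (S n ω x : ℂ))) (μ ω) ∧
    Integrable ((F (θ^[n] ω)).toFun (iter A z n ω (F ω).one)) (μ (θ^[n] ω)) ∧
    ∫ x, Complex.exp (z * (S n ω x : ℂ)) ∂(μ ω)
      = ∫ x, (F (θ^[n] ω)).toFun (iter A z n ω (F ω).one) x ∂(μ (θ^[n] ω))

/-- The complex random Ruelle-Perron-Frobenius assumption: on a deterministic disc `|z| < ρ` there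
are measurable in `ω`, analytic in `z` and uniformly bounded triplets `λ_ω(z) ≠ 0`,
`h_ω(z) ∈ H_ω`, `ν_ω(z) ∈ (H_ω)^*` with `ν_ω(z) 1 = 1`,
`‖λ_{ω,n}(z)⁻¹ A_z^{ω,n} g - ν_ω(z)(g) h_{θ^n ω}(z)‖ ≤ C ‖g‖ δ^n`, where
`λ_{ω,n}(z) = ∏_{j<n} λ_{θ^j ω}(z)`, and `ν_ω(0) = μ_ω`, `h_ω(0) = 1`, `λ_ω(0) = 1`. -/
def RPFAssumption {Ω X : Type*} [MeasurableSpace Ω] [MeasurableSpace X]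
    (P : Measure Ω) (θ : Ω → Ω) (E : Ω → Set X) (H : Ω → Type*)
    [∀ ω, NormedAddCommGroup (H ω)] [∀ ω, NormedSpace ℂ (H ω)]
    (F : ∀ ω, FunctionSpace (H ω) (E ω)) (A : ℂ → ∀ ω, H ω →L[ℂ] H (θ ω))
    (μ : Ω → Measure X) : Prop :=
  ∃ (ρ C δ : ℝ) (lam : Ω → ℂ → ℂ) (h : ∀ ω, ℂ → H ω) (ν : ∀ ω, ℂ → (H ω →L[ℂ] ℂ)),
    0 < ρ ∧ 0 < C ∧ 0 < δ ∧ δ < 1 ∧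
    -- convergence
    (∀ᵐ ω ∂P, ∀ z ∈ Metric.ball (0 : ℂ) ρ, lam ω z ≠ 0 ∧ ν ω z (F ω).one = 1 ∧
      ∀ (g : H ω) (n : ℕ), 1 ≤ n →
        ‖(∏ j ∈ Finset.range n, lam (θ^[j] ω) z)⁻¹ • iter A z n ω g
            - ν ω z g • h (θ^[n] ω) z‖ ≤ C * ‖g‖ * δ ^ n) ∧
    -- measurability in `ω`
    (∀ z ∈ Metric.ball (0 : ℂ) ρ,
      AEMeasurable (fun ω => lam ω z) P ∧
      JointlyMeasurable P (fun ω => (F ω).toFun (h ω z)) ∧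
      ∀ g : ∀ ω, H ω, JointlyMeasurable P (fun ω => (F ω).toFun (g ω)) →
        AEMeasurable (fun ω => ν ω z (g ω)) P) ∧
    -- analyticity in `z`
    (∀ᵐ ω ∂P, AnalyticOnNhd ℂ (lam ω) (Metric.ball 0 ρ) ∧
      AnalyticOnNhd ℂ (h ω) (Metric.ball 0 ρ) ∧
      AnalyticOnNhd ℂ (ν ω) (Metric.ball 0 ρ)) ∧
    -- uniform boundedness
    (∃ M : ℝ, ∀ᵐ ω ∂P, ∀ z ∈ Metric.ball (0 : ℂ) ρ,
      ‖lam ω z‖ ≤ M ∧ ‖h ω z‖ ≤ M ∧ ‖ν ω z‖ ≤ M) ∧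
    -- normalization at `z = 0`
    (∀ᵐ ω ∂P, lam ω 0 = 1 ∧ h ω 0 = (F ω).one ∧
      ∀ g : H ω, Integrable ((F ω).toFun g) (μ ω) ∧ ν ω 0 g = ∫ x, (F ω).toFun g x ∂(μ ω))

section Shift

variable {Y : Type*}

/-- The left shift on two-sided sequences. -/
def shift (ω : ℤ → Y) : ℤ → Y := fun j => ω (j + 1)

/-- The σ-algebra generated by the coordinates `ω_l`, `l ≤ s`. -/
abbrev pastSigma [MeasurableSpace Y] (s : ℤ) : MeasurableSpace (ℤ → Y) :=
  ⨆ l : Set.Iic s, MeasurableSpace.comap (fun ω : ℤ → Y => ω l) inferInstance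

/-- The σ-algebra generated by the coordinates `ω_l`, `l ≥ s`. -/
abbrev futureSigma [MeasurableSpace Y] (s : ℤ) : MeasurableSpace (ℤ → Y) :=
  ⨆ l : Set.Ici s, MeasurableSpace.comap (fun ω : ℤ → Y => ω l) inferInstance

/-- The φ-mixing coefficients of the coordinate process: `φ(n)` is the supremum of
`|P(B | A) - P(B)|` over all `k`, all events `A` of positive probability determined by the
coordinates `≤ k` and all events `B` determined by the coordinates `≥ k + n`. -/
noncomputable def phiMixing [MeasurableSpace Y] (P : Measure (ℤ → Y)) (n : ℕ) : ℝ :=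
  sSup {r : ℝ | ∃ (k : ℤ) (A B : Set (ℤ → Y)), MeasurableSet[pastSigma k] A ∧
    MeasurableSet[futureSigma (k + n)] B ∧ 0 < P.real A ∧
    r = |P.real (A ∩ B) / P.real A - P.real B|}

/-- `A_z^ω` depends, measurably, only on the coordinate `ω_0`: almost surely the domain `E_ω` and
the action `g ↦ A_z^ω g` are functions of `ω_0`, the resulting family of fibers is measurable, and
`(A_z^{ω,n} 1)(x)` is a measurable function of `(ω_0, …, ω_{n-1}, x)`, for each `z` and `n ≥ 1`. -/
structure DependsOnZerothCoordinate {X : Type*} [MeasurableSpace Y] [MeasurableSpace X]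
    (P : Measure (ℤ → Y)) (E : (ℤ → Y) → Set X) (H : (ℤ → Y) → Type*)
    [∀ ω, NormedAddCommGroup (H ω)] [∀ ω, NormedSpace ℂ (H ω)]
    (F : ∀ ω, FunctionSpace (H ω) (E ω)) (A : ℂ → ∀ ω, H ω →L[ℂ] H (shift ω)) : Prop where
  fiber : ∃ E₀ : Y → Set X, MeasurableSet {p : Y × X | p.2 ∈ E₀ p.1} ∧
    ∀ᵐ ω ∂P, E ω = E₀ (ω 0)
  operator : ∃ A₀ : ℂ → Y → (X → ℂ) → (X → ℂ), ∀ᵐ ω ∂P, ∀ (z : ℂ) (g : H ω),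
    ∀ x ∈ E (shift ω), (F (shift ω)).toFun (A z ω g) x = A₀ z (ω 0) ((F ω).toFun g) x
  measurable : ∀ (z : ℂ) (n : ℕ), 1 ≤ n → ∃ G : (Fin n → Y) × X → ℂ, Measurable G ∧
    ∀ᵐ ω ∂P, ∀ x ∈ E (shift^[n] ω),
      (F (shift^[n] ω)).toFun (iter A z n ω (F ω).one) x = G (fun i : Fin n => ω (i : ℤ), x)

end Shift

end RandomRPF

/-!
# Limit theorems for random complex transfer operators over a φ-mixing base

By the model equation and the complex Ruelle-Perron-Frobenius assumption, the moment generating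
function of `S_n^ω` is, on a disc that depends neither on `ω` nor on `n`, the product
`∏_{j<n} λ_{θ^j ω}(z)` times an analytic factor that is bounded uniformly in `n` and `ω` and is `1`
at `z = 0`. On a smaller disc it is therefore `exp L_n^ω`, where `L_n^ω` is the Birkhoff sum of
`log λ_ω` up to a bounded analytic summand (`exists_log_mgf`). So the cumulants of `S_n^ω` are
Birkhoff sums up to bounded errors, and all of them are `O(n)`. Both assertions of the theorem
follow from this, once the second and third cumulants are known to be `a n` and `b n` up to
`O(√n log n)`; then `γ_2 = a` and `γ_3 = b`.

That law of large numbers with rate rests on two facts.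

* The function `ω ↦ log λ_ω(z)`, and with it the derivatives in `z` at `0`, is approximated at an
  exponential rate by functions of `ω_0, …, ω_m`. Indeed `λ_ω(z)` is the limit of the quotients
  `(A_z^{ω,m} 1)(x) / (A_z^{θω,m-1} 1)(x)`, which depend on `ω_0, …, ω_{m-1}` and on a point `x` of
  the fibre over `θ^m ω`. The point cannot be chosen measurably without a selection theorem;
  instead the quotient is integrated in `x` with respect to a probability kernel that lives on the
  fibre over `ω_m` and is obtained by disintegrating `μ_ω` along `ω_0` (`exists_log_approx`,
  `exists_markovKernel_ae_mem`). The derivatives are reached through difference quotients whose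
  step shrinks exponentially, but slowly (`exists_isExpApproximable_iteratedDeriv`).
* For such a function `f` and `X_j = f ∘ θ^j`, summability of `φ` makes `E[X_j | ℱ_k] - E f`
  summable in `j ≥ k`, while the approximation makes `E[X_j | ℱ_k] - X_j` summable in `k ≥ j`.
  Hence the martingales `k ↦ E[∑_{j<n} X_j | ℱ_k]` have increments bounded uniformly in `n`, and
  Azuma's inequality with the Borel-Cantelli lemma gives the deviation bound `O(√n log n)`
  (`exists_measurable_sum_deviation_bound`).

The moments are recovered from the cumulants by the recursion that expresses `G' = L' G` for
`G = exp L`. Since the first cumulant vanishes and the others are `O(n)`, the moments of order `2 j`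
and `2 j + 1` are of order `n ^ j`, and their leading coefficients only involve the second and, in
odd order, once the third cumulant (`exists_norm_moment_sub_limit_le`).

For the rate in the central limit theorem, the expansion of `L_n^ω` compares the characteristic
functions of `S_n^ω / √n` and of the normal law at frequencies up to `c √n`. Higher frequencies are
removed by convolving both laws with a normal law of variance of order `log n / n`, which costs
`O(log n / √n)` in the distribution functions (`abs_measureReal_Iic_sub_le`,
`exists_kolmogorov_bound`).
-/

namespace RandomRPF

/-! ### Bounded analytic functions on a disc -/

section Analytic

variable {f : ℂ → ℂ} {r B : ℝ}

lemma norm_iteratedDeriv_zero_le (hr : 0 < r) (hf : DifferentiableOn ℂ f (Metric.ball 0 r))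
    (hB : ∀ z ∈ Metric.ball (0 : ℂ) r, ‖f z‖ ≤ B) (k : ℕ) :
    ‖iteratedDeriv k f 0‖ ≤ k.factorial * B * (2 / r) ^ k := by
  have hsub : Metric.closedBall (0 : ℂ) (r / 2) ⊆ Metric.ball 0 r :=
    Metric.closedBall_subset_ball (by linarith)
  have h := Complex.norm_iteratedDeriv_le_of_forall_mem_sphere_norm_le k (c := 0) (R := r / 2)
    (C := B) (by positivity) ((hf.mono hsub).diffContOnCl_ball subset_rfl)
    (fun z hz => hB z (hsub (Metric.sphere_subset_closedBall hz)))
  rwa [div_eq_mul_inv, ← inv_pow, inv_div] at h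

/-- Taylor's formula with a remainder that depends only on the radius of the disc and on the bound
of the function on it. -/
lemma norm_sub_taylor_le (hr : 0 < r) (hf : DifferentiableOn ℂ f (Metric.ball 0 r))
    (hB : ∀ z ∈ Metric.ball (0 : ℂ) r, ‖f z‖ ≤ B) (N : ℕ) {z : ℂ} (hz : ‖z‖ ≤ r / 4) :
    ‖f z - ∑ k ∈ Finset.range N, (k.factorial : ℂ)⁻¹ * (z ^ k * iteratedDeriv k f 0)‖
      ≤ 2 * B * (2 * ‖z‖ / r) ^ N := by
  have hB0 : 0 ≤ B := (norm_nonneg _).trans (hB 0 (by simpa using hr))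
  have hz' : z ∈ Metric.ball (0 : ℂ) r := by
    rw [mem_ball_zero_iff]; linarith
  have hs := Complex.hasSum_taylorSeries_on_ball hf hz'
  simp only [sub_zero, smul_eq_mul] at hs
  have hs' := (hasSum_nat_add_iff' N).2 hs
  have hq : 2 * ‖z‖ / r ≤ 1 / 2 := by
    rw [div_le_iff₀ hr]; linarith
  have hq0 : 0 ≤ 2 * ‖z‖ / r := by positivity
  have hg := (hasSum_geometric_of_lt_one hq0 (by linarith)).mul_left (B * (2 * ‖z‖ / r) ^ N)
  have hb := tsum_of_norm_bounded (f := fun n => ((n + N).factorial : ℂ)⁻¹ *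
      (z ^ (n + N) * iteratedDeriv (n + N) f 0)) hg (fun n => ?_)
  · rw [hs'.tsum_eq] at hb
    refine hb.trans ?_
    have : (1 - 2 * ‖z‖ / r)⁻¹ ≤ 2 := by
      rw [inv_le_comm₀ (by linarith) (by norm_num)]; linarith
    calc B * (2 * ‖z‖ / r) ^ N * (1 - 2 * ‖z‖ / r)⁻¹
        ≤ B * (2 * ‖z‖ / r) ^ N * 2 := by gcongr
      _ = _ := by ring
  · have hc := norm_iteratedDeriv_zero_le hr hf hB (n + N)
    have hfac : (0 : ℝ) < (n + N).factorial := by positivity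
    rw [norm_mul, norm_mul, norm_inv, norm_pow, Complex.norm_natCast]
    calc ((n + N).factorial : ℝ)⁻¹ * (‖z‖ ^ (n + N) * ‖iteratedDeriv (n + N) f 0‖)
        ≤ ((n + N).factorial : ℝ)⁻¹ *
          (‖z‖ ^ (n + N) * ((n + N).factorial * B * (2 / r) ^ (n + N))) := by gcongr
      _ = B * (‖z‖ * (2 / r)) ^ (n + N) := by
          rw [mul_pow]; field_simp
      _ = B * (2 * ‖z‖ / r) ^ (n + N) := by ring
      _ = _ := by rw [pow_add]; ring

/-- A bounded analytic function is Lipschitz at the centre of a disc, with a constant that depends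
only on the bound and the radius. -/
lemma norm_sub_apply_zero_le {V : Type*} [NormedAddCommGroup V] [NormedSpace ℂ V] {f : ℂ → V}
    {r B : ℝ} (hf : DifferentiableOn ℂ f (Metric.ball 0 r))
    (hB : ∀ z ∈ Metric.ball (0 : ℂ) r, ‖f z‖ ≤ B) {z : ℂ} (hz : z ∈ Metric.ball (0 : ℂ) r) :
    ‖f z - f 0‖ ≤ 2 * B / r * ‖z‖ := by
  have hr : 0 < r := Metric.pos_of_mem_ball hz
  have h := Complex.dist_le_div_mul_dist_of_mapsTo_ball (R₂ := 2 * B) hf (fun w hw => ?_) hz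
  · simpa [dist_eq_norm] using h
  · rw [mem_closedBall_iff_norm]
    linarith [norm_sub_le (f w) (f 0), hB w hw, hB 0 (by simpa using hr)]

lemma differentiableOn_log_comp {g : ℂ → ℂ} {s : Set ℂ} (hg : DifferentiableOn ℂ g s)
    (h1 : ∀ z ∈ s, ‖g z - 1‖ ≤ 1 / 2) :
    DifferentiableOn ℂ (fun z => Complex.log (g z)) s := by
  refine hg.clog fun z hz => ?_
  left
  have := (Complex.abs_re_le_norm _).trans (h1 z hz)
  rw [Complex.sub_re, Complex.one_re, abs_le] at this
  linarith

lemma norm_log_sub_log_le {u v : ℂ} (hu : ‖u - 1‖ ≤ 1 / 2) (hv : ‖v - 1‖ ≤ 1 / 2) :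
    ‖Complex.log u - Complex.log v‖ ≤ 2 * ‖u - v‖ := by
  have hre : ∀ x ∈ Metric.closedBall (1 : ℂ) (1 / 2), x ∈ Complex.slitPlane ∧ 1 / 2 ≤ ‖x‖ := by
    intro x hx
    rw [mem_closedBall_iff_norm] at hx
    have h1 := (Complex.abs_re_le_norm _).trans hx
    rw [Complex.sub_re, Complex.one_re, abs_le] at h1
    exact ⟨Or.inl (by linarith), by linarith [Complex.re_le_norm x]⟩
  refine Convex.norm_image_sub_le_of_norm_hasDerivWithin_le (s := Metric.closedBall (1 : ℂ) (1 / 2))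
    (f' := fun x => x⁻¹) (fun x hx => (Complex.hasDerivAt_log (hre x hx).1).hasDerivWithinAt)
    (fun x hx => ?_) (convex_closedBall _ _) (by rwa [mem_closedBall_iff_norm])
    (by rwa [mem_closedBall_iff_norm])
  rw [norm_inv, inv_le_comm₀ (by linarith [(hre x hx).2]) (by norm_num)]
  linarith [(hre x hx).2]

lemma norm_log_le_one {u : ℂ} (hu : ‖u - 1‖ ≤ 1 / 2) : ‖Complex.log u‖ ≤ 1 := by
  have := norm_log_sub_log_le hu (v := 1) (by norm_num)
  rw [Complex.log_one, sub_zero] at this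
  linarith

lemma exp_log_of_norm_sub_one_le {u : ℂ} (hu : ‖u - 1‖ ≤ 1 / 2) :
    Complex.exp (Complex.log u) = u := by
  refine Complex.exp_log ?_
  rintro rfl
  norm_num at hu

/-- The second derivative at the centre as a central difference quotient. -/
lemma norm_second_difference_le (hr : 0 < r) (hf : DifferentiableOn ℂ f (Metric.ball 0 r))
    (hB : ∀ z ∈ Metric.ball (0 : ℂ) r, ‖f z‖ ≤ B) (h0 : f 0 = 0) {t : ℝ} (ht0 : 0 < t)
    (ht : t ≤ r / 8) :
    ‖(f t + f (-t)) / (t : ℂ) ^ 2 - iteratedDeriv 2 f 0‖ ≤ 4 * B * (2 / r) ^ 4 * t ^ 2 := by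
  have h1 := norm_sub_taylor_le hr hf hB 4 (z := (t : ℂ))
    (by rw [Complex.norm_of_nonneg ht0.le]; linarith)
  have h2 := norm_sub_taylor_le hr hf hB 4 (z := -(t : ℂ))
    (by rw [norm_neg, Complex.norm_of_nonneg ht0.le]; linarith)
  rw [norm_neg] at h2
  simp only [Finset.sum_range_succ, Finset.sum_range_zero, Nat.factorial, Complex.norm_of_nonneg
    ht0.le, iteratedDeriv_zero, h0] at h1 h2
  have h3 := (norm_add_le _ _).trans (add_le_add h1 h2)
  have htc : (t : ℂ) ≠ 0 := by exact_mod_cast ht0.ne'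
  have e : (f t + f (-t)) / (t : ℂ) ^ 2 - iteratedDeriv 2 f 0
      = (f t + f (-t) - iteratedDeriv 2 f 0 * t ^ 2) / (t : ℂ) ^ 2 := by
    field_simp
  rw [e, norm_div, norm_pow, Complex.norm_of_nonneg ht0.le, div_le_iff₀ (by positivity)]
  refine le_trans (le_of_eq ?_) (h3.trans (le_of_eq ?_))
  · congr 1; push_cast; ring
  · ring

/-- The third derivative at the centre as a difference quotient. -/
lemma norm_third_difference_le (hr : 0 < r) (hf : DifferentiableOn ℂ f (Metric.ball 0 r))
    (hB : ∀ z ∈ Metric.ball (0 : ℂ) r, ‖f z‖ ≤ B) (h0 : f 0 = 0) {t : ℝ} (ht0 : 0 < t)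
    (ht : t ≤ r / 8) :
    ‖(f (2 * t) - 2 * f t - f (-(2 * t)) + 2 * f (-t)) / (2 * (t : ℂ) ^ 3)
      - iteratedDeriv 3 f 0‖ ≤ 36 * B * (2 / r) ^ 4 * t := by
  have hB0 : 0 ≤ B := (norm_nonneg _).trans (hB 0 (by simpa using hr))
  have n2 : ‖(2 * t : ℂ)‖ = 2 * t := by
    rw [norm_mul, Complex.norm_of_nonneg ht0.le]; norm_num
  have h1 := norm_sub_taylor_le hr hf hB 4 (z := (t : ℂ))
    (by rw [Complex.norm_of_nonneg ht0.le]; linarith)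
  have h2 := norm_sub_taylor_le hr hf hB 4 (z := -(t : ℂ))
    (by rw [norm_neg, Complex.norm_of_nonneg ht0.le]; linarith)
  have h3 := norm_sub_taylor_le hr hf hB 4 (z := (2 * t : ℂ))
    (by rw [n2]; linarith)
  have h4 := norm_sub_taylor_le hr hf hB 4 (z := -(2 * t : ℂ))
    (by rw [norm_neg, n2]; linarith)
  rw [norm_neg] at h2 h4
  rw [n2] at h3 h4
  simp only [Finset.sum_range_succ, Finset.sum_range_zero, Nat.factorial, Complex.norm_of_nonneg
    ht0.le, iteratedDeriv_zero, h0] at h1 h2 h3 h4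
  have c2 : ∀ a : ℂ, ‖2 * a‖ = 2 * ‖a‖ := fun a => by rw [norm_mul]; norm_num
  have h5 := (norm_sub_le _ _).trans (add_le_add h3 h4)
  have h6 := (norm_sub_le _ _).trans (add_le_add h2 h1)
  have h7 := (norm_add_le _ _).trans (add_le_add h5
    ((c2 _).le.trans (mul_le_mul_of_nonneg_left h6 (by norm_num : (0 : ℝ) ≤ 2))))
  have htc : (t : ℂ) ≠ 0 := by exact_mod_cast ht0.ne'
  have e : (f (2 * t) - 2 * f t - f (-(2 * t)) + 2 * f (-t)) / (2 * (t : ℂ) ^ 3)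
      - iteratedDeriv 3 f 0 = (f (2 * t) - 2 * f t - f (-(2 * t)) + 2 * f (-t)
        - iteratedDeriv 3 f 0 * (2 * t ^ 3)) / (2 * (t : ℂ) ^ 3) := by
    field_simp
  rw [e, norm_div, norm_mul, norm_pow, Complex.norm_of_nonneg ht0.le, Complex.norm_ofNat,
    div_le_iff₀ (by positivity)]
  refine le_trans (le_of_eq ?_) (h7.trans (le_of_eq ?_))
  · congr 1; push_cast; ring
  · ring

end Analytic

/-! ### A concentration bound for weakly dependent sequences -/

section Concentration

variable {Ω : Type*} {m0 : MeasurableSpace Ω} {P : Measure Ω} [IsProbabilityMeasure P]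

/-- Convexity of the exponential: on `[-c, c]` it lies below its chord. -/
lemma exp_mul_le_cosh_add_sinh {c t D : ℝ} (hc : 0 < c) (hD : |D| ≤ c) :
    Real.exp (t * D) ≤ Real.cosh (t * c) + D * (Real.sinh (t * c) / c) := by
  obtain ⟨h1, h2⟩ := abs_le.1 hD
  have h := (convexOn_exp.2 (Set.mem_univ (t * c)) (Set.mem_univ (-(t * c)))) (a := (1 + D / c) / 2)
    (b := (1 - D / c) / 2)
    (by have : -1 ≤ D / c := by rw [le_div_iff₀ hc]; linarith
        linarith)
    (by have : D / c ≤ 1 := by rw [div_le_iff₀ hc]; linarith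
        linarith) (by ring)
  simp only [smul_eq_mul] at h
  have e : (1 + D / c) / 2 * (t * c) + (1 - D / c) / 2 * -(t * c) = t * D := by
    field_simp; ring
  rw [e] at h
  refine h.trans (le_of_eq ?_)
  rw [Real.cosh_eq, Real.sinh_eq]
  field_simp
  ring

/-- The exponential moments of a martingale with bounded increments (Azuma's inequality). -/
lemma integral_exp_martingale_le {ℱ : Filtration ℕ m0} {M : ℕ → Ω → ℝ} (hM : Martingale M ℱ P)
    {c : ℝ} (hc : 0 < c) (hinc : ∀ k, ∀ᵐ ω ∂P, |M (k + 1) ω - M k ω| ≤ c) (t : ℝ) (n : ℕ) :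
    Integrable (fun ω => Real.exp (t * (M n ω - M 0 ω))) P ∧
      ∫ ω, Real.exp (t * (M n ω - M 0 ω)) ∂P ≤ Real.cosh (t * c) ^ n := by
  have hbd : ∀ n : ℕ, ∀ᵐ ω ∂P, |M n ω - M 0 ω| ≤ n * c := by
    intro n
    filter_upwards [ae_all_iff.2 hinc] with ω hω
    induction n with
    | zero => simp
    | succ n ih =>
      calc |M (n + 1) ω - M 0 ω| ≤ |M (n + 1) ω - M n ω| + |M n ω - M 0 ω| := abs_sub_le _ _ _
        _ ≤ c + n * c := add_le_add (hω n) ih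
        _ = _ := by push_cast; ring
  have hmeasF : ∀ n, StronglyMeasurable[ℱ n] fun ω => Real.exp (t * (M n ω - M 0 ω)) := by
    intro n
    have h1 := (hM.1 n).sub ((hM.1 0).mono (ℱ.mono (Nat.zero_le n)))
    exact Real.continuous_exp.comp_stronglyMeasurable (h1.const_mul t)
  have hexpbd : ∀ n : ℕ, ∀ᵐ ω ∂P, ‖Real.exp (t * (M n ω - M 0 ω))‖
      ≤ Real.exp (|t| * (n * c)) := by
    intro n
    filter_upwards [hbd n] with ω hω
    rw [Real.norm_of_nonneg (Real.exp_pos _).le, Real.exp_le_exp]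
    calc t * (M n ω - M 0 ω) ≤ |t * (M n ω - M 0 ω)| := le_abs_self _
      _ = |t| * |M n ω - M 0 ω| := abs_mul _ _
      _ ≤ _ := by gcongr
  have hint : ∀ n, Integrable (fun ω => Real.exp (t * (M n ω - M 0 ω))) P := fun n =>
    Integrable.of_bound ((hmeasF n).mono (ℱ.le n)).aestronglyMeasurable _ (hexpbd n)
  refine ⟨hint n, ?_⟩
  induction n with
  | zero => simp
  | succ n ih =>
    set W : Ω → ℝ := fun ω => Real.exp (t * (M n ω - M 0 ω)) with hW
    set D : Ω → ℝ := M (n + 1) - M n with hDdef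
    have hDint : Integrable D P := (hM.integrable _).sub (hM.integrable _)
    have hWD : Integrable (W * D) P := by
      refine hDint.bdd_mul ((hmeasF n).mono (ℱ.le n)).aestronglyMeasurable (hexpbd n)
    -- the increment is conditionally centred, so the linear term of the convexity bound vanishes
    have hzero : ∫ ω, (W * D) ω ∂P = 0 := by
      rw [← integral_condExp (ℱ.le n)]
      have h1 := condExp_mul_of_stronglyMeasurable_left (hmeasF n) hWD hDint
      have h2 : P[D | ℱ n] =ᵐ[P] 0 := by
        have h3 := condExp_sub (hM.integrable (n + 1)) (hM.integrable n) (ℱ n)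
        have h4 := hM.condExp_ae_eq (Nat.le_succ n)
        have h5 := hM.condExp_ae_eq (le_refl n)
        filter_upwards [h3, h4, h5] with ω e3 e4 e5
        rw [hDdef, e3, Pi.sub_apply, e4, e5, sub_self]; rfl
      rw [integral_congr_ae h1, ← integral_zero Ω ℝ (μ := P)]
      refine integral_congr_ae ?_
      filter_upwards [h2] with ω e2
      simp [e2]
    calc ∫ ω, Real.exp (t * (M (n + 1) ω - M 0 ω)) ∂P
        ≤ ∫ ω, (Real.cosh (t * c) * W ω + (Real.sinh (t * c) / c) * (W * D) ω) ∂P := by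
          refine integral_mono_ae (hint _) (((hint n).const_mul _).add (hWD.const_mul _)) ?_
          filter_upwards [hinc n] with ω hω
          have h := mul_le_mul_of_nonneg_left (exp_mul_le_cosh_add_sinh (t := t) hc hω)
            (Real.exp_pos (t * (M n ω - M 0 ω))).le
          rw [← Real.exp_add] at h
          simp only [hW, hDdef, Pi.mul_apply, Pi.sub_apply]
          refine le_trans (le_of_eq ?_) (h.trans (le_of_eq ?_))
          · congr 1; ring
          · ring
      _ = Real.cosh (t * c) * ∫ ω, W ω ∂P := by
          rw [integral_add ((hint n).const_mul _) (hWD.const_mul _), integral_const_mul,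
            integral_const_mul, hzero, mul_zero, add_zero]
      _ ≤ Real.cosh (t * c) * Real.cosh (t * c) ^ n := by
          gcongr
      _ = _ := by ring

/-- Azuma's inequality at the deviation `2 c √n log n`, where it is summable in `n`. -/
lemma measureReal_martingale_deviation_le {ℱ : Filtration ℕ m0} {M : ℕ → Ω → ℝ}
    (hM : Martingale M ℱ P) {c : ℝ} (hc : 0 < c)
    (hinc : ∀ k, ∀ᵐ ω ∂P, |M (k + 1) ω - M k ω| ≤ c) {n : ℕ} (hn : 3 ≤ n) :
    P.real {ω | 2 * c * (Real.sqrt n * Real.log n) ≤ |M n ω - M 0 ω|} ≤ 2 * ((n : ℝ) ^ 2)⁻¹ := by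
  have hn0 : (0 : ℝ) < n := by positivity
  have hlog : 1 ≤ Real.log n := by
    rw [Real.le_log_iff_exp_le hn0]
    have : (3 : ℝ) ≤ n := by exact_mod_cast hn
    linarith [Real.exp_one_lt_three]
  set s := 2 * c * (Real.sqrt n * Real.log n) with hs
  set t := 2 * Real.log n / (c * Real.sqrt n) with ht
  have hsq : 0 < Real.sqrt n := Real.sqrt_pos.2 hn0
  have ht0 : 0 ≤ t := by positivity
  have key : ∀ u : ℝ, |u| = t →
      ∫ ω, Real.exp (u * (M n ω - M 0 ω)) ∂P ≤ Real.exp (2 * Real.log n ^ 2) := by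
    intro u hu
    refine (integral_exp_martingale_le hM hc hinc u n).2.trans ?_
    calc Real.cosh (u * c) ^ n ≤ Real.exp ((u * c) ^ 2 / 2) ^ n := by
          gcongr
          exact Real.cosh_le_exp_half_sq _
      _ = Real.exp (2 * Real.log n ^ 2) := by
          rw [← Real.exp_nat_mul]
          congr 1
          have : (u * c) ^ 2 = t ^ 2 * c ^ 2 := by rw [mul_pow, ← hu, sq_abs]
          rw [this, ht, div_pow, mul_pow, mul_pow, Real.sq_sqrt hn0.le]
          field_simp
  have hfin : Real.exp (-t * s) * Real.exp (2 * Real.log n ^ 2) ≤ ((n : ℝ) ^ 2)⁻¹ := by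
    have e : t * s = 4 * Real.log n ^ 2 := by
      rw [ht, hs]; field_simp; norm_num
    rw [← Real.exp_add, ← Real.exp_log hn0, ← Real.exp_nat_mul, ← Real.exp_neg, Real.exp_le_exp,
      Real.log_exp, neg_mul, e]
    push_cast
    nlinarith
  have h1 := ProbabilityTheory.measure_ge_le_exp_mul_mgf (μ := P) (X := fun ω => M n ω - M 0 ω)
    s ht0 (integral_exp_martingale_le hM hc hinc t n).1
  have h2 := ProbabilityTheory.measure_le_le_exp_mul_mgf (μ := P) (X := fun ω => M n ω - M 0 ω)
    (-s) (neg_nonpos.2 ht0) (integral_exp_martingale_le hM hc hinc (-t) n).1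
  unfold ProbabilityTheory.mgf at h1 h2
  have h1' : P.real {ω | s ≤ M n ω - M 0 ω} ≤ ((n : ℝ) ^ 2)⁻¹ :=
    h1.trans ((mul_le_mul_of_nonneg_left (key t (abs_of_nonneg ht0)) (Real.exp_pos _).le).trans
      hfin)
  have h2' : P.real {ω | M n ω - M 0 ω ≤ -s} ≤ ((n : ℝ) ^ 2)⁻¹ := by
    refine h2.trans ((mul_le_mul_of_nonneg_left
      (key (-t) (by rw [abs_neg, abs_of_nonneg ht0])) (Real.exp_pos _).le).trans
      (le_trans (le_of_eq ?_) hfin))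
    congr 2; ring
  have hsub : {ω | s ≤ |M n ω - M 0 ω|} ⊆ {ω | s ≤ M n ω - M 0 ω} ∪ {ω | M n ω - M 0 ω ≤ -s} := by
    intro ω hω
    rcases le_abs.1 (show s ≤ |M n ω - M 0 ω| from hω) with h | h
    · exact Or.inl h
    · exact Or.inr (show M n ω - M 0 ω ≤ -s by linarith)
  calc P.real {ω | s ≤ |M n ω - M 0 ω|} ≤ _ := measureReal_mono hsub
    _ ≤ _ := measureReal_union_le _ _
    _ ≤ _ := by linarith

lemma sum_comp_le_tsum {ι : Type*} {u : ℕ → ℝ} (hu : Summable u) (h0 : ∀ i, 0 ≤ u i)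
    (s : Finset ι) {φ : ι → ℕ} (hφ : Set.InjOn φ s) : ∑ j ∈ s, u (φ j) ≤ ∑' i, u i := by
  classical
  rw [← Finset.sum_image (f := u) hφ]
  exact hu.sum_le_tsum _ fun i _ => h0 i

/-- If the conditional expectations `E[X_j | ℱ_k]` are summably close to the mean `m` for `j ≥ k`
and summably close to `X_j` for `j ≤ k`, then `∑_{j<n} X_j - n m` is `O(√n log n)` almost surely.
The martingale `k ↦ ∑_{j<n} E[X_j | ℱ_k]` has increments bounded uniformly in `n`; at time `0` it is
near `n m` and at time `n` near the sum. -/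
theorem exists_measurable_sum_deviation_bound (ℱ : Filtration ℕ m0) {X : ℕ → Ω → ℝ}
    (hX : ∀ j, Integrable (X j) P) {a b : ℕ → ℝ} (ha : Summable a) (hb : Summable b)
    (ha0 : ∀ i, 0 ≤ a i) (hb0 : ∀ i, 0 ≤ b i) {m : ℝ}
    (h1 : ∀ j k, k ≤ j → ∀ᵐ ω ∂P, |(P[X j | ℱ k]) ω - m| ≤ a (j - k))
    (h2 : ∀ j k, j ≤ k → ∀ᵐ ω ∂P, |(P[X j | ℱ k]) ω - X j ω| ≤ b (k - j)) :
    ∃ T : Ω → ℝ, Measurable T ∧ ∀ᵐ ω ∂P, ∀ n : ℕ, 2 ≤ n →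
      |∑ j ∈ Finset.range n, X j ω - n * m| ≤ T ω * (Real.sqrt n * Real.log n) := by
  set u : ℕ → ℝ := fun i => a i + a (i - 1) + (b i + b (i + 1)) with hu
  have ha1 : Summable fun i => a (i - 1) := by
    rw [← summable_nat_add_iff 1]; simpa using ha
  have hus : Summable u := (ha.add ha1).add (hb.add ((summable_nat_add_iff 1).2 hb))
  have hu0 : ∀ i, 0 ≤ u i := fun i =>
    add_nonneg (add_nonneg (ha0 _) (ha0 _)) (add_nonneg (hb0 _) (hb0 _))
  set c : ℝ := 2 * (∑' i, u i) + 1 with hcdef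
  have hc : 0 < c := by have : 0 ≤ ∑' i, u i := tsum_nonneg hu0; positivity
  set M : ℕ → ℕ → Ω → ℝ := fun n k => P[∑ j ∈ Finset.range n, X j | ℱ k] with hMdef
  have hMsum : ∀ n k, M n k =ᵐ[P] fun ω => ∑ j ∈ Finset.range n, (P[X j | ℱ k]) ω := by
    intro n k
    refine (condExp_finsetSum (fun i _ => hX i) _).trans ?_
    exact Filter.Eventually.of_forall fun ω => by simp
  have hmart : ∀ n, Martingale (M n) ℱ P := fun n => martingale_condExp _ ℱ P
  have hinc : ∀ n k, ∀ᵐ ω ∂P, |M n (k + 1) ω - M n k ω| ≤ c := by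
    intro n k
    have g1 : ∀ᵐ ω ∂P, ∀ j, k ≤ j → |(P[X j | ℱ k]) ω - m| ≤ a (j - k) :=
      ae_all_iff.2 fun j => by
        by_cases h : k ≤ j
        · filter_upwards [h1 j k h] with ω hω _ using hω
        · exact Filter.Eventually.of_forall fun ω h' => absurd h' h
    have g2 : ∀ᵐ ω ∂P, ∀ j, k + 1 ≤ j → |(P[X j | ℱ (k + 1)]) ω - m| ≤ a (j - (k + 1)) :=
      ae_all_iff.2 fun j => by
        by_cases h : k + 1 ≤ j
        · filter_upwards [h1 j (k + 1) h] with ω hω _ using hω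
        · exact Filter.Eventually.of_forall fun ω h' => absurd h' h
    have g3 : ∀ᵐ ω ∂P, ∀ j, j ≤ k → |(P[X j | ℱ k]) ω - X j ω| ≤ b (k - j) :=
      ae_all_iff.2 fun j => by
        by_cases h : j ≤ k
        · filter_upwards [h2 j k h] with ω hω _ using hω
        · exact Filter.Eventually.of_forall fun ω h' => absurd h' h
    have g4 : ∀ᵐ ω ∂P, ∀ j, j ≤ k + 1 → |(P[X j | ℱ (k + 1)]) ω - X j ω| ≤ b (k + 1 - j) :=
      ae_all_iff.2 fun j => by
        by_cases h : j ≤ k + 1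
        · filter_upwards [h2 j (k + 1) h] with ω hω _ using hω
        · exact Filter.Eventually.of_forall fun ω h' => absurd h' h
    filter_upwards [hMsum n k, hMsum n (k + 1), g1, g2, g3, g4] with ω e1 e2 g1 g2 g3 g4
    rw [e1, e2, ← Finset.sum_sub_distrib]
    have hterm : ∀ j, |(P[X j | ℱ (k + 1)]) ω - (P[X j | ℱ k]) ω| ≤ u (k - j + (j - k)) := by
      intro j
      rcases le_or_gt j k with h | h
      · have i3 := g3 j h
        have i4 := g4 j (by omega)
        rw [show k + 1 - j = k - j + 1 by omega] at i4
        rw [show k - j + (j - k) = k - j by omega]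
        calc _ ≤ |(P[X j | ℱ (k + 1)]) ω - X j ω| + |X j ω - (P[X j | ℱ k]) ω| := abs_sub_le _ _ _
          _ ≤ b (k - j + 1) + b (k - j) := by rw [abs_sub_comm (X j ω)]; exact add_le_add i4 i3
          _ ≤ _ := by simp only [hu]; linarith [ha0 (k - j), ha0 (k - j - 1)]
      · have i1 := g1 j h.le
        have i2 := g2 j h
        rw [show j - (k + 1) = j - k - 1 by omega] at i2
        rw [show k - j + (j - k) = j - k by omega]
        calc _ ≤ |(P[X j | ℱ (k + 1)]) ω - m| + |m - (P[X j | ℱ k]) ω| := abs_sub_le _ _ _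
          _ ≤ a (j - k - 1) + a (j - k) := by rw [abs_sub_comm m]; exact add_le_add i2 i1
          _ ≤ _ := by simp only [hu]; linarith [hb0 (j - k), hb0 (j - k + 1)]
    refine (Finset.abs_sum_le_sum_abs _ _).trans ((Finset.sum_le_sum fun j _ => hterm j).trans ?_)
    rw [← Finset.sum_filter_add_sum_filter_not _ (fun j => j ≤ k)]
    have s1 := sum_comp_le_tsum hus hu0 ((Finset.range n).filter fun j => j ≤ k)
      (φ := fun j => k - j + (j - k)) (fun x hx y hy h => by
        simp only [Finset.coe_filter, Set.mem_ofPred_eq] at hx hy h; omega)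
    have s2 := sum_comp_le_tsum hus hu0 ((Finset.range n).filter fun j => ¬ j ≤ k)
      (φ := fun j => k - j + (j - k)) (fun x hx y hy h => by
        simp only [Finset.coe_filter, Set.mem_ofPred_eq] at hx hy h; omega)
    rw [hcdef]
    linarith
  have hstart : ∀ n, ∀ᵐ ω ∂P, |M n 0 ω - n * m| ≤ ∑' i, a i := by
    intro n
    filter_upwards [hMsum n 0, ae_all_iff.2 fun j => h1 j 0 (Nat.zero_le j)] with ω e g
    have : M n 0 ω - n * m = ∑ j ∈ Finset.range n, ((P[X j | ℱ 0]) ω - m) := by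
      rw [e, Finset.sum_sub_distrib]; simp
    rw [this]
    refine (Finset.abs_sum_le_sum_abs _ _).trans ((Finset.sum_le_sum fun j _ => g j).trans ?_)
    exact sum_comp_le_tsum ha ha0 _ (fun x _ y _ h => by simpa using h)
  have hend : ∀ n, ∀ᵐ ω ∂P, |M n n ω - ∑ j ∈ Finset.range n, X j ω| ≤ ∑' i, b i := by
    intro n
    have g : ∀ᵐ ω ∂P, ∀ j, j ≤ n → |(P[X j | ℱ n]) ω - X j ω| ≤ b (n - j) :=
      ae_all_iff.2 fun j => by
        by_cases h : j ≤ n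
        · filter_upwards [h2 j n h] with ω hω _ using hω
        · exact Filter.Eventually.of_forall fun ω h' => absurd h' h
    filter_upwards [hMsum n n, g] with ω e g
    rw [e, ← Finset.sum_sub_distrib]
    refine (Finset.abs_sum_le_sum_abs _ _).trans
      ((Finset.sum_le_sum fun j hj => g j (Finset.mem_range.1 hj).le).trans ?_)
    exact sum_comp_le_tsum hb hb0 _ (fun x hx y hy h => by
      simp only [Finset.coe_range, Set.mem_Iio] at hx hy h; omega)
  -- Borel-Cantelli
  have hBC : ∀ᵐ ω ∂P, ∀ᶠ n : ℕ in Filter.atTop,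
      ω ∉ {ω | 3 ≤ n ∧ 2 * c * (Real.sqrt n * Real.log n) ≤ |M n n ω - M n 0 ω|} := by
    refine ae_eventually_notMem (ne_of_lt ?_)
    have hsum : Summable fun n : ℕ => 2 * ((n : ℝ) ^ 2)⁻¹ :=
      (Real.summable_nat_pow_inv.2 (by norm_num)).mul_left 2
    have hle : ∀ n : ℕ, P {ω | 3 ≤ n ∧ 2 * c * (Real.sqrt n * Real.log n) ≤ |M n n ω - M n 0 ω|}
        ≤ ENNReal.ofReal (2 * ((n : ℝ) ^ 2)⁻¹) := by
      intro n
      rw [← ofReal_measureReal]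
      refine ENNReal.ofReal_le_ofReal ?_
      by_cases hn : 3 ≤ n
      · refine le_trans (measureReal_mono ?_)
          (measureReal_martingale_deviation_le (hmart n) hc (hinc n) hn)
        exact fun ω hω => hω.2
      · simp [hn]
    refine (ENNReal.tsum_le_tsum hle).trans_lt ?_
    rw [← ENNReal.ofReal_tsum_of_nonneg (fun n => by positivity) hsum]
    exact ENNReal.ofReal_lt_top
  set d : ℕ → Ω → ℝ := fun n ω =>
    |∑ j ∈ Finset.range n, (hX j).aestronglyMeasurable.mk (X j) ω - n * m|
      / (Real.sqrt n * Real.log n) with hd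
  have hdm : ∀ n, Measurable (d n) := by
    intro n
    have : Measurable fun ω =>
        ∑ j ∈ Finset.range n, (hX j).aestronglyMeasurable.mk (X j) ω :=
      Finset.measurable_fun_sum _ fun j _ =>
        (hX j).aestronglyMeasurable.stronglyMeasurable_mk.measurable
    exact ((measurable_norm.comp (this.sub_const _))).div_const _
  refine ⟨fun ω => ⨆ n, d n ω, Measurable.iSup hdm, ?_⟩
  filter_upwards [hBC, ae_all_iff.2 hstart, ae_all_iff.2 hend,
    ae_all_iff.2 fun j => (hX j).aestronglyMeasurable.ae_eq_mk] with ω hω hs he hmk n hn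
  have hbdd : BddAbove (Set.range fun n => d n ω) := by
    refine Filter.IsBoundedUnder.bddAbove_range
      ⟨2 * c + ∑' i, a i + ∑' i, b i, Filter.eventually_map.2 ?_⟩
    filter_upwards [hω, Filter.eventually_ge_atTop 3] with k hk hk3
    have hk' : |M k k ω - M k 0 ω| < 2 * c * (Real.sqrt k * Real.log k) := by
      by_contra h
      exact hk ⟨hk3, not_lt.1 h⟩
    have hk0 : (3 : ℝ) ≤ k := by exact_mod_cast hk3
    have hl : 1 ≤ Real.log k := by
      rw [Real.le_log_iff_exp_le (by linarith)]
      linarith [Real.exp_one_lt_three]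
    have hs1 : 1 ≤ Real.sqrt k := Real.one_le_sqrt.2 (by linarith)
    have hw : 1 ≤ Real.sqrt k * Real.log k := one_le_mul_of_one_le_of_one_le hs1 hl
    simp only [hd, ← hmk]
    rw [div_le_iff₀ (by linarith)]
    have ha' : 0 ≤ ∑' i, a i := tsum_nonneg ha0
    have hb' : 0 ≤ ∑' i, b i := tsum_nonneg hb0
    have t1 := abs_sub_le (∑ j ∈ Finset.range k, X j ω) (M k k ω) (k * m)
    have t2 := abs_sub_le (M k k ω) (M k 0 ω) (k * m)
    have t3 := he k
    rw [abs_sub_comm] at t3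
    nlinarith [hs k]
  have hle := le_ciSup hbdd n
  have hn0 : (2 : ℝ) ≤ n := by exact_mod_cast hn
  have hpos : 0 < Real.sqrt n * Real.log n :=
    mul_pos (Real.sqrt_pos.2 (by linarith)) (Real.log_pos (by linarith))
  rw [← div_le_iff₀ hpos]
  simpa only [hd, ← hmk] using hle

end Concentration

/-! ### Birkhoff sums under φ-mixing -/

section Mixing

lemma phiMixing_nonneg {Y : Type*} [MeasurableSpace Y] (P : Measure (ℤ → Y)) (n : ℕ) :
    0 ≤ phiMixing P n := by
  refine Real.sSup_nonneg ?_
  rintro r ⟨k, A, B, -, -, -, rfl⟩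
  exact abs_nonneg _

lemma shift_iterate_apply {Y : Type*} (j : ℕ) (ω : ℤ → Y) (i : ℤ) :
    shift^[j] ω i = ω (i + j) := by
  induction j generalizing ω with
  | zero => simp
  | succ j ih =>
    rw [Function.iterate_succ_apply, ih, shift]
    push_cast
    congr 1
    ring

variable {Y : Type*} [MeasurableSpace Y] {P : Measure (ℤ → Y)} [IsProbabilityMeasure P]

lemma pastSigma_le (s : ℤ) : pastSigma (Y := Y) s ≤ MeasurableSpace.pi :=
  iSup_le fun l => (measurable_pi_apply (l : ℤ)).comap_le

lemma futureSigma_le (s : ℤ) : futureSigma (Y := Y) s ≤ MeasurableSpace.pi :=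
  iSup_le fun l => (measurable_pi_apply (l : ℤ)).comap_le

lemma pastSigma_mono {s t : ℤ} (h : s ≤ t) : pastSigma (Y := Y) s ≤ pastSigma t :=
  iSup_le fun l => le_iSup (fun l : Set.Iic t =>
    MeasurableSpace.comap (fun ω : ℤ → Y => ω l) inferInstance) ⟨l, le_trans l.2 h⟩

/-- The filtration of the pasts `σ(ω_l, l ≤ k)`, `k ∈ ℕ`. -/
def pastFiltration (Y : Type*) [MeasurableSpace Y] :
    Filtration ℕ (MeasurableSpace.pi : MeasurableSpace (ℤ → Y)) where
  seq k := pastSigma (k : ℤ)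
  mono' _ _ h := pastSigma_mono (by exact_mod_cast h)
  le' k := pastSigma_le k

lemma measurable_coord_past {s l : ℤ} (h : l ≤ s) :
    Measurable[pastSigma s] fun ω : ℤ → Y => ω l :=
  measurable_iff_comap_le.2 (le_iSup (fun l : Set.Iic s =>
    MeasurableSpace.comap (fun ω : ℤ → Y => ω l) inferInstance) ⟨l, h⟩)

lemma measurable_coord_future {s l : ℤ} (h : s ≤ l) :
    Measurable[futureSigma s] fun ω : ℤ → Y => ω l :=
  measurable_iff_comap_le.2 (le_iSup (fun l : Set.Ici s =>
    MeasurableSpace.comap (fun ω : ℤ → Y => ω l) inferInstance) ⟨l, h⟩)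

/-- The defining property of `φ(n)`, including events `A` of probability zero. -/
lemma abs_measureReal_inter_sub_le {k : ℤ} {n : ℕ} {A B : Set (ℤ → Y)}
    (hA : MeasurableSet[pastSigma k] A) (hB : MeasurableSet[futureSigma (k + n)] B) :
    |P.real (A ∩ B) - P.real A * P.real B| ≤ phiMixing P n * P.real A := by
  rcases (measureReal_nonneg (μ := P) (s := A)).eq_or_lt with h0 | hpos
  · have : P.real (A ∩ B) = 0 :=
      le_antisymm ((measureReal_mono Set.inter_subset_left).trans h0.symm.le) measureReal_nonneg
    simp [this, ← h0]
  · have hle : |P.real (A ∩ B) / P.real A - P.real B| ≤ phiMixing P n := by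
      refine le_csSup ⟨1, ?_⟩ ⟨k, A, B, hA, hB, hpos, rfl⟩
      rintro r ⟨k, A, B, -, -, hA, rfl⟩
      have h1 : P.real (A ∩ B) / P.real A ≤ 1 :=
        (div_le_one hA).2 (measureReal_mono Set.inter_subset_left)
      have h2 : 0 ≤ P.real (A ∩ B) / P.real A := by positivity
      have h3 : P.real B ≤ 1 := measureReal_le_one
      have h4 : 0 ≤ P.real B := measureReal_nonneg
      rw [abs_le]; constructor <;> linarith
    calc |P.real (A ∩ B) - P.real A * P.real B|
        = |P.real (A ∩ B) / P.real A - P.real B| * P.real A := by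
          conv_rhs => rw [← abs_of_pos hpos, ← abs_mul, abs_of_pos hpos]
          congr 1
          field_simp
      _ ≤ _ := by gcongr

/-- φ-mixing decouples a bounded function of the future from an event of the past. -/
lemma abs_setIntegral_sub_le {k : ℤ} {n : ℕ} {A : Set (ℤ → Y)} {f : (ℤ → Y) → ℝ} {K : ℝ}
    (hA : MeasurableSet[pastSigma k] A) (hf : Measurable[futureSigma (k + n)] f)
    (hK : ∀ ω, |f ω| ≤ K) :
    |∫ ω in A, f ω ∂P - P.real A * ∫ ω, f ω ∂P| ≤ 2 * K * phiMixing P n * P.real A := by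
  obtain ⟨ω₀⟩ : Nonempty (ℤ → Y) := nonempty_of_isProbabilityMeasure P
  have hK0 : 0 ≤ K := (abs_nonneg _).trans (hK ω₀)
  have hf' : Measurable f := hf.mono (futureSigma_le _) le_rfl
  have hfint : Integrable f P :=
    Integrable.of_bound hf'.aestronglyMeasurable K (Filter.Eventually.of_forall hK)
  -- layer cake formula for `f + K`, which takes values in `[0, 2 K]`; it reduces the claim to
  -- events of the future
  have hcake : ∀ ν : Measure (ℤ → Y), IsFiniteMeasure ν → Integrable f ν →
      ∫ ω, f ω ∂ν + ν.real Set.univ * K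
        = ∫ t in Set.Ioc 0 (2 * K), ν.real {ω | t ≤ f ω + K} := by
    intro ν _ hν
    have h := (hν.add (integrable_const K)).integral_eq_integral_Ioc_meas_le (M := 2 * K)
      (Filter.Eventually.of_forall fun ω => by
        simp only [Pi.zero_apply, Pi.add_apply]; linarith [(abs_le.1 (hK ω)).1])
      (Filter.Eventually.of_forall fun ω => by
        simp only [Pi.add_apply]; linarith [(abs_le.1 (hK ω)).2])
    rw [integral_add' hν (integrable_const K), integral_const, smul_eq_mul] at h
    exact h
  have h1 := hcake P inferInstance hfint
  have h2 := hcake (P.restrict A) inferInstance hfint.restrict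
  have hanti : ∀ ν : Measure (ℤ → Y), IsFiniteMeasure ν → IntegrableOn
      (fun t : ℝ => ν.real {ω | t ≤ f ω + K}) (Set.Ioc 0 (2 * K)) := by
    intro ν _
    have ha : Antitone fun t : ℝ => ν.real {ω | t ≤ f ω + K} := fun s t hst =>
      measureReal_mono fun ω hω => le_trans hst hω
    exact (ha.antitoneOn _).integrableOn_isCompact isCompact_Icc |>.mono_set Set.Ioc_subset_Icc_self
  have hmA : MeasurableSet A := pastSigma_le k A hA
  have key : ∫ ω in A, f ω ∂P - P.real A * ∫ ω, f ω ∂P = ∫ t in Set.Ioc 0 (2 * K),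
      ((P.restrict A).real {ω | t ≤ f ω + K} - P.real A * P.real {ω | t ≤ f ω + K}) := by
    rw [integral_sub (hanti _ inferInstance) ((hanti P inferInstance).const_mul _),
      integral_const_mul, ← h1, ← h2]
    simp only [measureReal_restrict_apply_univ, probReal_univ]
    ring
  rw [key]
  have hb := norm_setIntegral_le_of_norm_le_const (μ := (volume : Measure ℝ))
    (s := Set.Ioc 0 (2 * K)) (C := phiMixing P n * P.real A)
    (f := fun t => (P.restrict A).real {ω | t ≤ f ω + K} - P.real A * P.real {ω | t ≤ f ω + K})
    (by rw [Real.volume_Ioc]; exact ENNReal.ofReal_lt_top) (fun t _ => ?_)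
  · rw [Real.norm_eq_abs] at hb
    refine hb.trans (le_of_eq ?_)
    rw [Real.volume_real_Ioc_of_le (by positivity)]
    ring
  · have hset : MeasurableSet[futureSigma (k + n)] {ω | t ≤ f ω + K} :=
      measurableSet_le measurable_const (hf.add_const K)
    rw [measureReal_restrict_apply (futureSigma_le _ _ hset), Set.inter_comm]
    exact abs_measureReal_inter_sub_le hA hset

lemma condExp_past_sub_integral_le {k : ℤ} {n : ℕ} {f : (ℤ → Y) → ℝ} {K : ℝ}
    (hf : Measurable[futureSigma (k + n)] f) (hK : ∀ ω, |f ω| ≤ K) :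
    ∀ᵐ ω ∂P, (P[f | pastSigma k]) ω - ∫ ω, f ω ∂P ≤ 2 * K * phiMixing P n := by
  have hf' : Measurable f := hf.mono (futureSigma_le _) le_rfl
  have hfint : Integrable f P :=
    Integrable.of_bound hf'.aestronglyMeasurable K (Filter.Eventually.of_forall hK)
  set c := 2 * K * phiMixing P n
  set m := ∫ ω, f ω ∂P
  set Z := P[f | pastSigma k]
  -- the set where the bound fails belongs to the past, so the decoupling applies to it
  set A := {ω | c + m < Z ω}
  have hA : MeasurableSet[pastSigma k] A :=
    measurableSet_lt measurable_const stronglyMeasurable_condExp.measurable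
  have hAm : MeasurableSet A := pastSigma_le k A hA
  have hZint : Integrable (fun ω => Z ω - (c + m)) (P.restrict A) :=
    (integrable_condExp.sub (integrable_const _)).restrict
  have h1 : ∫ ω in A, (Z ω - (c + m)) ∂P ≤ 0 := by
    rw [integral_sub integrable_condExp.restrict (integrable_const _),
      setIntegral_condExp (pastSigma_le k) hfint hA, setIntegral_const, smul_eq_mul]
    have := (abs_le.1 (abs_setIntegral_sub_le (P := P) hA hf hK)).2
    linarith
  have hnn : 0 ≤ᵐ[P.restrict A] fun ω => Z ω - (c + m) := by
    filter_upwards [ae_restrict_mem hAm] with ω hω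
    exact sub_nonneg.2 (le_of_lt hω)
  have h2 := (integral_eq_zero_iff_of_nonneg_ae hnn hZint).1
    (le_antisymm h1 (integral_nonneg_of_ae hnn))
  rw [Filter.EventuallyEq, ae_restrict_iff' hAm] at h2
  filter_upwards [h2] with ω hω
  by_contra hcon
  have hmem : ω ∈ A := by
    change c + m < Z ω
    linarith [not_le.1 hcon]
  have h3 := hω hmem
  have h4 : c + m < Z ω := hmem
  simp only [Pi.zero_apply] at h3
  linarith

/-- The conditional expectation, given the past up to time `k`, of a bounded function of the future
from time `k + n` on is `2 K φ(n)`-close to its mean. -/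
lemma abs_condExp_past_sub_integral_le {k : ℤ} {n : ℕ} {f : (ℤ → Y) → ℝ} {K : ℝ}
    (hf : Measurable[futureSigma (k + n)] f) (hK : ∀ ω, |f ω| ≤ K) :
    ∀ᵐ ω ∂P, |(P[f | pastSigma k]) ω - ∫ ω, f ω ∂P| ≤ 2 * K * phiMixing P n := by
  have hneg := condExp_past_sub_integral_le (P := P) (f := -f) (K := K) (n := n) (k := k) hf.neg
    (fun ω => by simpa using hK ω)
  filter_upwards [condExp_past_sub_integral_le (P := P) hf hK, hneg,
    condExp_neg (μ := P) f (pastSigma k)] with ω h1 h2 h3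
  rw [h3] at h2
  simp only [Pi.neg_apply, integral_neg] at h2
  rw [abs_le]
  constructor <;> linarith

lemma abs_condExp_sub_condExp_le {Ω : Type*} {m m0 : MeasurableSpace Ω} {P : Measure Ω}
    [IsProbabilityMeasure P] (hm : m ≤ m0) {f g : Ω → ℝ} {ε : ℝ} (hf : Integrable f P)
    (hg : Integrable g P) (h : ∀ᵐ ω ∂P, |f ω - g ω| ≤ ε) :
    ∀ᵐ ω ∂P, |(P[f | m]) ω - (P[g | m]) ω| ≤ ε := by
  have hc := condExp_const (μ := P) hm ε
  have h1 := condExp_mono (m := m) (hf.sub hg) (integrable_const ε)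
    (h.mono fun ω hω => (abs_le.1 hω).2)
  have h2 := condExp_mono (m := m) (hg.sub hf) (integrable_const ε)
    (h.mono fun ω hω => by
      have := (abs_le.1 hω).1
      simp only [Pi.sub_apply]; linarith)
  rw [hc] at h1 h2
  filter_upwards [h1, h2, condExp_sub hf hg m, condExp_sub hg hf m] with ω h1 h2 e1 e2
  rw [e1] at h1
  rw [e2] at h2
  simp only [Pi.sub_apply] at h1 h2
  rw [abs_le]
  constructor <;> linarith

/-- `f` is, for each `m`, almost surely within `K η ^ m` of a measurable function, bounded by `K`,
of the coordinates `ω_0, …, ω_m`. -/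
def IsExpApproximable (P : Measure (ℤ → Y)) (f : (ℤ → Y) → ℝ) (K η : ℝ) : Prop :=
  ∀ m : ℕ, ∃ g : (Fin (m + 1) → Y) → ℝ, Measurable g ∧ (∀ y, |g y| ≤ K) ∧
    ∀ᵐ ω ∂P, |f ω - g fun i => ω (i : ℤ)| ≤ K * η ^ m

omit [IsProbabilityMeasure P] in
lemma IsExpApproximable.aemeasurable {f : (ℤ → Y) → ℝ} {K η : ℝ} (hη0 : 0 ≤ η) (hη1 : η < 1)
    (hf : IsExpApproximable P f K η) : AEMeasurable f P := by
  choose g hg _ hfg using hf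
  refine aemeasurable_of_tendsto_metrizable_ae Filter.atTop
    (f := fun m ω => g m fun i => ω (i : ℤ)) (fun m => ?_) ?_
  · exact ((hg m).comp (measurable_pi_lambda _ fun i => measurable_pi_apply _)).aemeasurable
  · filter_upwards [ae_all_iff.2 hfg] with ω hω
    rw [tendsto_iff_dist_tendsto_zero]
    refine squeeze_zero (fun _ => dist_nonneg) (fun m => ?_)
      (by simpa using (tendsto_pow_atTop_nhds_zero_of_lt_one hη0 hη1).const_mul K)
    rw [dist_comm]
    exact hω m

lemma IsExpApproximable.integrable {f : (ℤ → Y) → ℝ} {K η : ℝ} (hη0 : 0 ≤ η) (hη1 : η < 1)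
    (hf : IsExpApproximable P f K η) : Integrable f P := by
  obtain ⟨g, -, hgK, hfg⟩ := hf 0
  refine Integrable.of_bound (hf.aemeasurable hη0 hη1).aestronglyMeasurable (2 * K) ?_
  filter_upwards [hfg] with ω hω
  rw [Real.norm_eq_abs]
  have := abs_sub_abs_le_abs_sub (f ω) (g fun i => ω (i : ℤ))
  simp only [pow_zero, mul_one] at hω
  linarith [hgK fun i => ω (i : ℤ)]

/-- The law of large numbers with rate `log n / √n` for the Birkhoff sums of an exponentially
approximable function over a stationary process with summable φ-mixing coefficients. -/
theorem IsExpApproximable.exists_measurable_birkhoff_bound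
    (hstat : MeasurePreserving shift P P) (hphi : Summable fun n : ℕ => phiMixing P (n + 1))
    {f : (ℤ → Y) → ℝ} {K η : ℝ} (hη0 : 0 ≤ η) (hη1 : η < 1) (hf : IsExpApproximable P f K η) :
    ∃ T : (ℤ → Y) → ℝ, Measurable T ∧ ∀ᵐ ω ∂P, ∀ n : ℕ, 2 ≤ n →
      |∑ j ∈ Finset.range n, f (shift^[j] ω) - n * ∫ ω, f ω ∂P|
        ≤ T ω * (Real.sqrt n * Real.log n) := by
  obtain ⟨ω₀⟩ : Nonempty (ℤ → Y) := nonempty_of_isProbabilityMeasure P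
  have hfint := hf.integrable hη0 hη1
  choose g hg hgK hfg using hf
  have hK0 : 0 ≤ K := (abs_nonneg _).trans (hgK 0 fun i => ω₀ i)
  have hpres : ∀ j : ℕ, MeasurePreserving (shift^[j]) P P := fun j => hstat.iterate j
  have hXint : ∀ j : ℕ, Integrable (fun ω => f (shift^[j] ω)) P := fun j =>
    (hpres j).integrable_comp_of_integrable hfint
  have hXmean : ∀ j : ℕ, ∫ ω, f (shift^[j] ω) ∂P = ∫ ω, f ω ∂P := by
    intro j
    have h := integral_map (hpres j).measurable.aemeasurable (μ := P) (f := f)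
      (by rw [(hpres j).map_eq]; exact hfint.aestronglyMeasurable)
    rw [← h, (hpres j).map_eq]
  -- the approximation of `f ∘ θ^j` by a function of the coordinates `j, …, j + m`
  set G : ℕ → ℕ → (ℤ → Y) → ℝ := fun m j ω => g m fun i => ω ((i : ℤ) + j) with hG
  have hGpast : ∀ m j : ℕ, ∀ s : ℤ, (m : ℤ) + j ≤ s → Measurable[pastSigma s] (G m j) := by
    intro m j s hs
    refine (hg m).comp (@measurable_pi_lambda _ _ _ (pastSigma s) _ _ fun i => ?_)
    exact measurable_coord_past (by have := i.2; omega)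
  have hGfut : ∀ m j : ℕ, ∀ s : ℤ, s ≤ j → Measurable[futureSigma s] (G m j) := by
    intro m j s hs
    refine (hg m).comp (@measurable_pi_lambda _ _ _ (futureSigma s) _ _ fun i => ?_)
    exact measurable_coord_future (by omega)
  have hGint : ∀ m j : ℕ, Integrable (G m j) P := fun m j =>
    Integrable.of_bound ((hGpast m j (m + j) le_rfl).mono (pastSigma_le _)
      le_rfl).aestronglyMeasurable K (Filter.Eventually.of_forall fun ω => hgK m _)
  have hfG : ∀ m j : ℕ, ∀ᵐ ω ∂P, |f (shift^[j] ω) - G m j ω| ≤ K * η ^ m := by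
    intro m j
    filter_upwards [(hpres j).quasiMeasurePreserving.ae (hfg m)] with ω hω
    simpa only [shift_iterate_apply] using hω
  have hgeo : Summable fun n : ℕ => 2 * K * η ^ n :=
    (summable_geometric_of_lt_one hη0 hη1).mul_left _
  refine exists_measurable_sum_deviation_bound (pastFiltration Y) hXint
    (a := fun n => 2 * K * phiMixing P n + 2 * K * η ^ n) (b := fun n => 2 * K * η ^ n)
    ((((summable_nat_add_iff 1).1 hphi).mul_left _).add hgeo) hgeo
    (fun n => by have := phiMixing_nonneg P n; positivity) (fun n => by positivity) ?_ ?_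
  -- at distance `j - k` in the future: approximate with `m = j - k` and use mixing
  · intro j k hkj
    have hmean : |∫ ω, G (j - k) j ω ∂P - ∫ ω, f ω ∂P| ≤ K * η ^ (j - k) := by
      rw [← hXmean j, ← integral_sub (hGint _ _) (hXint j)]
      have h := norm_integral_le_of_norm_le_const (μ := P)
        (f := fun ω => G (j - k) j ω - f (shift^[j] ω)) (C := K * η ^ (j - k)) (by
          filter_upwards [hfG (j - k) j] with ω hω
          rwa [Real.norm_eq_abs, abs_sub_comm])
      rwa [probReal_univ, mul_one] at h
    filter_upwards [abs_condExp_sub_condExp_le (pastSigma_le (k : ℤ)) (hXint j) (hGint (j - k) j)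
      (hfG (j - k) j), abs_condExp_past_sub_integral_le (P := P) (k := k) (n := j - k)
      (hGfut (j - k) j _ (by omega)) (fun ω => hgK _ _)] with ω h1 h2
    calc _ ≤ _ := abs_sub_le _ ((P[G (j - k) j | pastSigma (k : ℤ)]) ω) _
      _ ≤ _ := add_le_add h1 (abs_sub_le _ (∫ ω, G (j - k) j ω ∂P) _)
      _ ≤ _ := add_le_add le_rfl (add_le_add h2 hmean)
      _ = _ := by ring
  -- at distance `k - j` in the past: the approximation with `m = k - j` is known at time `k`
  · intro j k hjk
    have hself := condExp_of_stronglyMeasurable (μ := P) (pastSigma_le (k : ℤ))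
      (hGpast (k - j) j k (by omega)).stronglyMeasurable (hGint (k - j) j)
    filter_upwards [abs_condExp_sub_condExp_le (pastSigma_le (k : ℤ)) (hXint j) (hGint (k - j) j)
      (hfG (k - j) j), hfG (k - j) j] with ω h1 h2
    rw [hself] at h1
    calc _ ≤ _ := abs_sub_le _ (G (k - j) j ω) _
      _ ≤ _ := add_le_add h1 (le_of_eq_of_le (abs_sub_comm _ _) h2)
      _ = _ := by ring

end Mixing

/-! ### Finite range approximation of the eigenvalues -/

section Kernel

open ProbabilityTheory

/-- A random probability measure carried by the fibre `E₀ (π ω)` can be averaged over the fibres of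
`π` to a Markov kernel from `Y` to `X` carried by the same sets: disintegrate the law of
`(π ω, x)`, where `x` is drawn from `μ ω`. -/
lemma exists_markovKernel_ae_mem {Ω Y X : Type*} [MeasurableSpace Ω] [MeasurableSpace Y]
    [MeasurableSpace X] [StandardBorelSpace X] {P : Measure Ω} [IsProbabilityMeasure P]
    {π : Ω → Y} (hπ : Measurable π) {μ : Ω → Measure X} (hμ : AEMeasurable μ P)
    (hprob : ∀ ω, IsProbabilityMeasure (μ ω)) {E₀ : Y → Set X}
    (hE₀ : MeasurableSet {p : Y × X | p.2 ∈ E₀ p.1})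
    (hmem : ∀ᵐ ω ∂P, ∀ᵐ x ∂(μ ω), x ∈ E₀ (π ω)) :
    ∃ κ : Kernel Y X, IsMarkovKernel κ ∧ ∀ᵐ ω ∂P, ∀ᵐ x ∂(κ (π ω)), x ∈ E₀ (π ω) := by
  classical
  obtain ⟨ω₀⟩ : Nonempty Ω := nonempty_of_isProbabilityMeasure P
  obtain ⟨x₀⟩ : Nonempty X := nonempty_of_isProbabilityMeasure (μ ω₀)
  have : Nonempty X := ⟨x₀⟩
  -- a measurable version of `μ`, made a probability measure for every `ω`
  set s : Set Ω := {ω | hμ.mk μ ω Set.univ = 1} with hs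
  have hsm : MeasurableSet s :=
    measurableSet_eq_fun ((Measure.measurable_coe MeasurableSet.univ).comp hμ.measurable_mk)
      measurable_const
  let k : Kernel Ω X :=
    { toFun := fun ω => if ω ∈ s then hμ.mk μ ω else Measure.dirac x₀
      measurable' := Measurable.ite hsm hμ.measurable_mk measurable_const }
  have hkdef : ∀ ω, k ω = if ω ∈ s then hμ.mk μ ω else Measure.dirac x₀ := fun ω => rfl
  have : IsMarkovKernel k := ⟨fun ω => by
    rw [hkdef]
    split_ifs with h
    · exact ⟨h⟩
    · infer_instance⟩
  have hk : ∀ᵐ ω ∂P, k ω = μ ω := by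
    filter_upwards [hμ.ae_eq_mk] with ω hω
    have h1 : ω ∈ s := by
      change hμ.mk μ ω Set.univ = 1
      rw [← hω]
      exact (hprob ω).measure_univ
    rw [hkdef, if_pos h1, hω]
  have hmap : Measurable (Prod.map π (id : X → X)) := hπ.prodMap measurable_id
  set Q : Measure (Y × X) := (P.compProd k).map (Prod.map π id) with hQ
  have : IsProbabilityMeasure Q := Measure.isProbabilityMeasure_map hmap.aemeasurable
  have hQE : ∀ᵐ p ∂Q, p.2 ∈ E₀ p.1 := by
    rw [hQ, ae_map_iff hmap.aemeasurable hE₀]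
    refine Measure.ae_compProd_of_ae_ae (hmap hE₀) ?_
    filter_upwards [hk, hmem] with ω h1 h2
    rw [h1]
    exact h2
  have hfst : Q.fst = P.map π := by
    rw [hQ, Measure.fst, Measure.map_map measurable_fst hmap]
    have : Prod.fst ∘ Prod.map π (id : X → X) = π ∘ Prod.fst := rfl
    rw [this, ← Measure.map_map hπ measurable_fst]
    congr 1
    exact Measure.fst_compProd P k
  refine ⟨Q.condKernel, inferInstance, ?_⟩
  rw [← Q.disintegrate Q.condKernel] at hQE
  have h := Measure.ae_ae_of_ae_compProd hQE
  rw [hfst] at h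
  exact ae_of_ae_map hπ.aemeasurable h

end Kernel

/-- The part of the complex Ruelle-Perron-Frobenius assumption that controls the moment generating
functions, on a disc on which the eigenvalues and the eigenfunctions are uniformly close to `1`. -/
lemma exists_uniform_disc {Ω X : Type*} [MeasurableSpace Ω] [MeasurableSpace X]
    {P : Measure Ω} [IsProbabilityMeasure P] {θ : Ω → Ω} {E : Ω → Set X} {H : Ω → Type*}
    [∀ ω, NormedAddCommGroup (H ω)] [∀ ω, NormedSpace ℂ (H ω)]
    {F : ∀ ω, FunctionSpace (H ω) (E ω)} {A : ℂ → ∀ ω, H ω →L[ℂ] H (θ ω)}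
    {μ : Ω → Measure X} (hRPF : RPFAssumption P θ E H F A μ) :
    ∃ (r C δ : ℝ) (lam : Ω → ℂ → ℂ) (h : ∀ ω, ℂ → H ω), 0 < r ∧ 0 < C ∧ 0 < δ ∧ δ < 1 ∧
      ∀ᵐ ω ∂P, DifferentiableOn ℂ (lam ω) (Metric.ball 0 r) ∧ lam ω 0 = 1 ∧
        ∀ z ∈ Metric.ball (0 : ℂ) r, ‖lam ω z - 1‖ ≤ 1 / 4 ∧ ‖h ω z - (F ω).one‖ ≤ 1 / 4 ∧
          ∀ n : ℕ, 1 ≤ n →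
            ‖(∏ j ∈ Finset.range n, lam (θ^[j] ω) z)⁻¹ • iter A z n ω (F ω).one
              - h (θ^[n] ω) z‖ ≤ C * δ ^ n := by
  obtain ⟨ρ, C, δ, lam, h, ν, hρ, hC, hδ0, hδ1, hconv, -, han, ⟨M, hM⟩, hnorm⟩ := hRPF
  have hM1 : 1 ≤ M := by
    obtain ⟨ω, h1, h2⟩ := (hM.and hnorm).exists
    have := (h1 0 (by simpa using hρ)).1
    rwa [h2.1, norm_one] at this
  have hMp : 0 < M := by linarith
  refine ⟨min ρ (ρ / (8 * M)), C, δ, lam, h, by positivity, hC, hδ0, hδ1, ?_⟩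
  filter_upwards [hconv, han, hM, hnorm] with ω hconv han hM hnorm
  have hsub : Metric.ball (0 : ℂ) (min ρ (ρ / (8 * M))) ⊆ Metric.ball 0 ρ :=
    Metric.ball_subset_ball (min_le_left _ _)
  refine ⟨han.1.differentiableOn.mono hsub, hnorm.1, fun z hz => ?_⟩
  have hz' : 2 * M / ρ * ‖z‖ ≤ 1 / 4 := by
    have : ‖z‖ ≤ ρ / (8 * M) := (mem_ball_zero_iff.1 hz).le.trans (min_le_right _ _)
    calc 2 * M / ρ * ‖z‖ ≤ 2 * M / ρ * (ρ / (8 * M)) := by gcongr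
      _ = 1 / 4 := by field_simp; norm_num
  refine ⟨?_, ?_, fun n hn => ?_⟩
  · have := norm_sub_apply_zero_le han.1.differentiableOn (fun w hw => (hM w hw).1) (hsub hz)
    rw [hnorm.1] at this
    exact this.trans hz'
  · have := norm_sub_apply_zero_le han.2.1.differentiableOn (fun w hw => (hM w hw).2.1) (hsub hz)
    rw [hnorm.2.1] at this
    exact this.trans hz'
  · obtain ⟨-, h1, h2⟩ := hconv z (hsub hz)
    have := h2 (F ω).one n hn
    rwa [h1, one_smul, (F ω).norm_one, mul_one] at this

/-- If `a / (Λ l)` and `b / Λ` are both `e`-close to the same number near `1`, then `a / b` is close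
to `l`. -/
lemma norm_div_sub_le_of_near {a b l Λ h : ℂ} {e : ℝ} (hl0 : l ≠ 0) (hΛ : Λ ≠ 0)
    (hl : ‖l‖ ≤ 2) (ha : ‖(Λ * l)⁻¹ * a - h‖ ≤ e) (hb : ‖Λ⁻¹ * b - h‖ ≤ e)
    (hh : ‖h - 1‖ ≤ 1 / 4) (he : e ≤ 1 / 4) : ‖l - a / b‖ ≤ 8 * e := by
  set a' := (Λ * l)⁻¹ * a with ha'
  set b' := Λ⁻¹ * b with hb'
  have h1 : ‖b' - 1‖ ≤ 1 / 2 := by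
    calc ‖b' - 1‖ = ‖(b' - h) + (h - 1)‖ := by ring_nf
      _ ≤ _ := norm_add_le _ _
      _ ≤ 1 / 2 := by linarith
  have h2 : 1 / 2 ≤ ‖b'‖ := by
    have := norm_sub_norm_le (1 : ℂ) b'
    rw [norm_one, norm_sub_rev] at this
    linarith
  have hb0 : b' ≠ 0 := by
    intro h; rw [h, norm_zero] at h2; norm_num at h2
  have h3 : ‖b' - a'‖ ≤ 2 * e := by
    calc ‖b' - a'‖ = ‖(b' - h) - (a' - h)‖ := by ring_nf
      _ ≤ _ := norm_sub_le _ _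
      _ ≤ _ := by linarith
  have e1 : a = Λ * l * a' := by rw [ha']; field_simp
  have e2 : b = Λ * b' := by rw [hb']; field_simp
  have e3 : l - a / b = l * (b' - a') / b' := by
    rw [e1, e2]; field_simp
  rw [e3, norm_div, norm_mul, div_le_iff₀ (by linarith)]
  have h4 : 0 ≤ 2 * e := (norm_nonneg _).trans h3
  calc ‖l‖ * ‖b' - a'‖ ≤ 2 * (2 * e) := by gcongr
    _ = 8 * e * (1 / 2) := by ring
    _ ≤ 8 * e * ‖b'‖ := by gcongr; linarith

/-- The function of an element of a function space is norm continuous at each point. -/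
lemma norm_toFun_sub_le {X H : Type*} [NormedAddCommGroup H] [NormedSpace ℂ H] {E : Set X}
    (F : FunctionSpace H E) (g g' : H) (x : X) :
    ‖F.toFun g x - F.toFun g' x‖ ≤ ‖g - g'‖ := by
  have := F.norm_apply_le (g - g') x
  rwa [map_sub] at this

section Approx

variable {Y X : Type*} [MeasurableSpace Y] [MeasurableSpace X] {P : Measure (ℤ → Y)}

open ProbabilityTheory in
/-- The logarithm of the eigenvalue `λ_ω(z)` is exponentially well approximated by functions of
finitely many coordinates: `λ_ω(z)` is the limit of `(A_z^{ω,m} 1)(x) / (A_z^{θω,m-1} 1)(x)`,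
uniformly in the point `x` of the fibre over `θ^m ω`, and `x` is integrated out with respect to a
kernel that only depends on `ω_m`. -/
lemma exists_log_approx [IsProbabilityMeasure P] (hstat : MeasurePreserving shift P P)
    {E : (ℤ → Y) → Set X} {H : (ℤ → Y) → Type*} [∀ ω, NormedAddCommGroup (H ω)]
    [∀ ω, NormedSpace ℂ (H ω)] {F : ∀ ω, FunctionSpace (H ω) (E ω)}
    {A : ℂ → ∀ ω, H ω →L[ℂ] H (shift ω)} (hzero : DependsOnZerothCoordinate P E H F A)
    {κ : Kernel Y X} [IsMarkovKernel κ] (hκ : ∀ᵐ ω ∂P, ∀ᵐ x ∂(κ (ω 0)), x ∈ E ω)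
    {r C δ : ℝ} {lam : (ℤ → Y) → ℂ → ℂ} {h : ∀ ω, ℂ → H ω} (hC : 0 < C) (hδ0 : 0 < δ)
    (hδ1 : δ < 1)
    (hgood : ∀ᵐ ω ∂P, ∀ z ∈ Metric.ball (0 : ℂ) r, ‖lam ω z - 1‖ ≤ 1 / 4 ∧
      ‖h ω z - (F ω).one‖ ≤ 1 / 4 ∧ ∀ n : ℕ, 1 ≤ n →
        ‖(∏ j ∈ Finset.range n, lam (shift^[j] ω) z)⁻¹ • iter A z n ω (F ω).one
          - h (shift^[n] ω) z‖ ≤ C * δ ^ n)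
    {z : ℂ} (hz : z ∈ Metric.ball (0 : ℂ) r) (m : ℕ) :
    ∃ g : (Fin (m + 1) → Y) → ℂ, Measurable g ∧ ∀ᵐ ω ∂P,
      ‖Complex.log (lam ω z) - g fun i => ω (i : ℤ)‖ ≤ 2 * ((8 * C + 1) / δ) * δ ^ m := by
  classical
  by_cases hm : 2 ≤ m ∧ 8 * (C * δ ^ (m - 1)) ≤ 1 / 4
  swap
  · -- for small `m` the right hand side is at least `1 / 2` and the constant `0` is good enough
    refine ⟨fun _ => 0, measurable_const, ?_⟩
    filter_upwards [hgood] with ω hω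
    have h1 : ‖lam ω z - 1‖ ≤ 1 / 4 := (hω z hz).1
    have h2 := norm_log_sub_log_le (u := lam ω z) (v := 1) (by linarith) (by norm_num)
    rw [Complex.log_one] at h2
    refine (h2.trans (mul_le_mul_of_nonneg_left h1 (by norm_num))).trans ?_
    rw [mul_assoc]
    refine mul_le_mul_of_nonneg_left ?_ (by norm_num)
    by_cases hm2 : 2 ≤ m
    · have h3 : 1 / 4 < 8 * (C * δ ^ (m - 1)) := by
        by_contra hcon
        exact hm ⟨hm2, not_lt.1 hcon⟩
      have h4 : (8 * C + 1) / δ * δ ^ m = 8 * (C * δ ^ (m - 1)) + δ ^ (m - 1) := by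
        obtain ⟨k, rfl⟩ : ∃ k, m = k + 1 := ⟨m - 1, by omega⟩
        rw [Nat.add_sub_cancel, pow_succ]; field_simp
      have h5 : 0 < δ ^ (m - 1) := by positivity
      linarith
    · have h3 : δ ≤ δ ^ m := by
        calc δ = δ ^ 1 := (pow_one δ).symm
          _ ≤ δ ^ m := pow_le_pow_of_le_one hδ0.le hδ1.le (by omega)
      calc (1 / 4 : ℝ) ≤ 8 * C + 1 := by linarith
        _ = (8 * C + 1) / δ * δ := by field_simp
        _ ≤ _ := by gcongr
  obtain ⟨hm2, hme⟩ := hm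
  obtain ⟨k, rfl⟩ : ∃ k, m = k + 1 := ⟨m - 1, by omega⟩
  rw [Nat.add_sub_cancel] at hme
  obtain ⟨G₁, hG₁m, hG₁⟩ := hzero.measurable z (k + 1) (by omega)
  obtain ⟨G₂, hG₂m, hG₂⟩ := hzero.measurable z k (by omega)
  let q : (Fin (k + 2) → Y) → X → ℂ := fun y x =>
    G₁ (fun i : Fin (k + 1) => y i.castSucc, x) / G₂ (fun i : Fin k => y i.castSucc.succ, x)
  have hqm : Measurable fun p : (Fin (k + 2) → Y) × X => q p.1 p.2 := by
    refine Measurable.div (hG₁m.comp (Measurable.prodMk (measurable_pi_lambda _ fun i => ?_)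
      measurable_snd)) (hG₂m.comp (Measurable.prodMk (measurable_pi_lambda _ fun i => ?_)
      measurable_snd))
    · exact (measurable_pi_apply _).comp measurable_fst
    · exact (measurable_pi_apply _).comp measurable_fst
  let κ' : Kernel (Fin (k + 2) → Y) X :=
    κ.comap (fun y => y (Fin.last (k + 1))) (measurable_pi_apply _)
  let g₀ : (Fin (k + 2) → Y) → ℂ := fun y => ∫ x, q y x ∂(κ' y)
  have hg₀ : Measurable g₀ :=
    (StronglyMeasurable.integral_kernel_prod_right (κ := κ') (f := q)
      hqm.stronglyMeasurable).measurable
  -- away from `1` the value of `g₀` is irrelevant, and the logarithm is not Lipschitz there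
  let g₁ : (Fin (k + 2) → Y) → ℂ := fun y => if ‖g₀ y - 1‖ ≤ 1 / 2 then g₀ y else 1
  have hg₁ : Measurable g₁ :=
    Measurable.ite (measurableSet_le (hg₀.sub_const 1).norm measurable_const) hg₀ measurable_const
  refine ⟨fun y => Complex.log (g₁ y), Complex.measurable_log.comp hg₁, ?_⟩
  have hpres : ∀ j : ℕ, MeasurePreserving (shift^[j]) P P := fun j => hstat.iterate j
  filter_upwards [hgood, hstat.quasiMeasurePreserving.ae hgood,
    (hpres (k + 1)).quasiMeasurePreserving.ae hgood,
    (hpres (k + 1)).quasiMeasurePreserving.ae hκ, hG₁,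
    hstat.quasiMeasurePreserving.ae hG₂] with ω g1 g2 g3 hκω e1 e2
  obtain ⟨l1, -, c1⟩ := g1 z hz
  obtain ⟨-, -, c2⟩ := g2 z hz
  obtain ⟨-, h3, -⟩ := g3 z hz
  have c1' := c1 (k + 1) (by omega)
  have c2' := c2 k (by omega)
  set y : Fin (k + 2) → Y := fun i => ω (i : ℤ) with hy
  have hlast : κ' y = κ ((shift^[k + 1] ω) 0) := by
    rw [shift_iterate_apply]
    simp [κ', Kernel.comap_apply, hy]
  set Λ := ∏ j ∈ Finset.range k, lam (shift^[j] (shift ω)) z with hΛ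
  have hprod : ∏ j ∈ Finset.range (k + 1), lam (shift^[j] ω) z = Λ * lam ω z := by
    rw [Finset.prod_range_succ']
    rfl
  have hl0 : lam ω z ≠ 0 := by
    intro h0; rw [h0] at l1; norm_num at l1
  have hΛ0 : Λ ≠ 0 := by
    intro h0
    rw [h0, inv_zero, zero_smul, zero_sub, norm_neg] at c2'
    have h4 := norm_sub_norm_le (F (shift^[k + 1] ω)).one (h (shift^[k + 1] ω) z)
    rw [norm_sub_rev, (F (shift^[k + 1] ω)).norm_one] at h4
    have c3 : ‖h (shift^[k + 1] ω) z‖ ≤ C * δ ^ k := c2'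
    linarith
  have hl2 : ‖lam ω z‖ ≤ 2 := by
    have := norm_sub_norm_le (lam ω z) 1
    rw [norm_one] at this
    linarith
  have hδk : δ ^ (k + 1) ≤ δ ^ k := pow_le_pow_of_le_one hδ0.le hδ1.le (Nat.le_succ k)
  have hratio : ∀ x ∈ E (shift^[k + 1] ω), ‖lam ω z - q y x‖ ≤ 8 * (C * δ ^ k) := by
    intro x hx
    have ea : q y x = (F (shift^[k + 1] ω)).toFun (iter A z (k + 1) ω (F ω).one) x /
        (F (shift^[k] (shift ω))).toFun (iter A z k (shift ω) (F (shift ω)).one) x := by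
      rw [e1 x hx, e2 x hx]
      congr 2
    rw [ea]
    refine norm_div_sub_le_of_near (h := (F (shift^[k + 1] ω)).toFun (h (shift^[k + 1] ω) z) x)
      hl0 hΛ0 hl2 ?_ ?_ ?_ (by linarith)
    · have := (norm_toFun_sub_le (F (shift^[k + 1] ω)) _ _ x).trans c1'
      rw [map_smul, Pi.smul_apply, smul_eq_mul, hprod] at this
      exact this.trans (by gcongr)
    · have := (norm_toFun_sub_le (F (shift^[k] (shift ω))) _ _ x).trans c2'
      rw [map_smul, Pi.smul_apply, smul_eq_mul] at this
      exact this
    · have := (norm_toFun_sub_le (F (shift^[k + 1] ω)) _ _ x).trans h3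
      rwa [(F _).one_apply x hx] at this
  have hae : ∀ᵐ x ∂(κ' y), ‖q y x - lam ω z‖ ≤ 8 * (C * δ ^ k) := by
    rw [hlast]
    filter_upwards [hκω] with x hx
    rw [norm_sub_rev]
    exact hratio x hx
  have hqint : Integrable (q y) (κ' y) := by
    have hmy : Measurable fun x => q y x := hqm.comp (measurable_prodMk_left (x := y))
    refine Integrable.of_bound hmy.aestronglyMeasurable (‖lam ω z‖ + 8 * (C * δ ^ k)) ?_
    filter_upwards [hae] with x hx
    have := norm_sub_norm_le (q y x) (lam ω z)
    linarith
  have hg₀ω : ‖g₀ y - lam ω z‖ ≤ 8 * (C * δ ^ k) := by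
    have e3 : g₀ y - lam ω z = ∫ x, (q y x - lam ω z) ∂(κ' y) := by
      rw [integral_sub hqint (integrable_const _), integral_const, probReal_univ, one_smul]
    rw [e3]
    refine (norm_integral_le_of_norm_le_const hae).trans (le_of_eq ?_)
    rw [probReal_univ, mul_one]
  have hg₀1 : ‖g₀ y - 1‖ ≤ 1 / 2 := by
    calc ‖g₀ y - 1‖ = ‖(g₀ y - lam ω z) + (lam ω z - 1)‖ := by ring_nf
      _ ≤ _ := norm_add_le _ _
      _ ≤ 1 / 2 := by linarith
  have hg₁y : g₁ y = g₀ y := if_pos hg₀1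
  rw [hg₁y]
  refine (norm_log_sub_log_le (by linarith) hg₀1).trans ?_
  rw [norm_sub_rev, mul_assoc]
  refine mul_le_mul_of_nonneg_left (hg₀ω.trans ?_) (by norm_num)
  have e4 : (8 * C + 1) / δ * δ ^ (k + 1) = 8 * (C * δ ^ k) + δ ^ k := by
    rw [pow_succ]; field_simp
  rw [e4]
  linarith [pow_pos hδ0 k]

end Approx

section Derivatives

variable {Y : Type*} [MeasurableSpace Y] {P : Measure (ℤ → Y)}

lemma abs_clamp_le {K x : ℝ} (hK : 0 ≤ K) : |max (-K) (min K x)| ≤ K :=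
  abs_le.2 ⟨le_max_left _ _, max_le (by linarith) (min_le_left _ _)⟩

lemma abs_sub_clamp_le {K x y : ℝ} (hx : |x| ≤ K) : |x - max (-K) (min K y)| ≤ |x - y| := by
  obtain ⟨h1, h2⟩ := abs_le.1 hx
  rcases le_total y K with h | h
  · rw [min_eq_right h]
    rcases le_total (-K) y with h' | h'
    · rw [max_eq_right h']
    · rw [max_eq_left h', abs_of_nonneg (by linarith), abs_of_nonneg (by linarith)]; linarith
  · rw [min_eq_left h, max_eq_right (by linarith), abs_of_nonpos (by linarith),
      abs_of_nonpos (by linarith)]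
    linarith

lemma isExpApproximable_of_ae_bounded {f : (ℤ → Y) → ℝ} {K η : ℝ} (hK : 0 ≤ K)
    (hfK : ∀ᵐ ω ∂P, |f ω| ≤ K)
    (hf : ∀ m : ℕ, ∃ g : (Fin (m + 1) → Y) → ℝ, Measurable g ∧
      ∀ᵐ ω ∂P, |f ω - g fun i => ω (i : ℤ)| ≤ K * η ^ m) : IsExpApproximable P f K η := by
  intro m
  obtain ⟨g, hg, hfg⟩ := hf m
  refine ⟨fun y => max (-K) (min K (g y)), measurable_const.max (measurable_const.min hg),
    fun y => abs_clamp_le hK, ?_⟩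
  filter_upwards [hfK, hfg] with ω h1 h2
  exact (abs_sub_clamp_le h1).trans h2

variable {ℓ : (ℤ → Y) → ℂ → ℂ} {r K δ : ℝ}

/-- The second and third derivatives at `0` of a bounded random analytic function inherit
exponential approximability from its values: use difference quotients of step `s η ^ m`, where
`η ^ 4 = δ`, so that the truncation error and the quotient of `δ ^ m` by the cube of the step are
both `O(η ^ m)`. -/
lemma exists_isExpApproximable_iteratedDeriv (hr : 0 < r) (hδ0 : 0 < δ) (hδ1 : δ < 1) (hK : 0 ≤ K)
    (hℓ : ∀ᵐ ω ∂P, DifferentiableOn ℂ (ℓ ω) (Metric.ball 0 r) ∧ ℓ ω 0 = 0 ∧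
      ∀ z ∈ Metric.ball (0 : ℂ) r, ‖ℓ ω z‖ ≤ 1)
    (happ : ∀ z ∈ Metric.ball (0 : ℂ) r, ∀ m : ℕ, ∃ g : (Fin (m + 1) → Y) → ℂ, Measurable g ∧
      ∀ᵐ ω ∂P, ‖ℓ ω z - g fun i => ω (i : ℤ)‖ ≤ K * δ ^ m) :
    ∃ K' η : ℝ, 0 ≤ η ∧ η < 1 ∧
      IsExpApproximable P (fun ω => (iteratedDeriv 2 (ℓ ω) 0).re) K' η ∧
      IsExpApproximable P (fun ω => (iteratedDeriv 3 (ℓ ω) 0).re) K' η := by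
  set η : ℝ := δ ^ (1 / 4 : ℝ) with hη
  have hη0 : 0 < η := Real.rpow_pos_of_pos hδ0 _
  have hη1 : η < 1 := Real.rpow_lt_one hδ0.le hδ1 (by norm_num)
  have hη4 : η ^ 4 = δ := by
    rw [hη, ← Real.rpow_natCast, ← Real.rpow_mul hδ0.le]; norm_num
  set s : ℝ := min (r / 8) 1 with hs
  have hs0 : 0 < s := lt_min (by positivity) one_pos
  have hs1 : s ≤ 1 := min_le_right _ _
  set B : ℝ := 36 * 1 * (2 / r) ^ 4 with hB
  have hB0 : 0 ≤ B := by positivity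
  set K' : ℝ := B + 3 * K / s ^ 3 + 2 * K / s ^ 2 + 6 * (2 / r) ^ 3 + 2 * (2 / r) ^ 2 with hK'
  have hKs : 0 ≤ 3 * K / s ^ 3 := by positivity
  have hKs2 : 0 ≤ 2 * K / s ^ 2 := by positivity
  have hr3 : 0 ≤ 6 * (2 / r) ^ 3 := by positivity
  have hr2 : 0 ≤ 2 * (2 / r) ^ 2 := by positivity
  have hK'0 : 0 ≤ K' := by linarith
  have hball : ∀ m : ℕ, 0 < s * η ^ m ∧ s * η ^ m ≤ r / 8 ∧ s * η ^ m ≤ η ^ m := by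
    intro m
    have h1 : η ^ m ≤ 1 := pow_le_one₀ hη0.le hη1.le
    have h2 : 0 < η ^ m := by positivity
    refine ⟨by positivity, ?_, ?_⟩
    · calc s * η ^ m ≤ s * 1 := by gcongr
        _ ≤ r / 8 := by rw [mul_one]; exact min_le_left _ _
    · calc s * η ^ m ≤ 1 * η ^ m := by gcongr
        _ = _ := one_mul _
  have hmem : ∀ {t : ℝ}, 0 < t → t ≤ r / 8 → (t : ℂ) ∈ Metric.ball (0 : ℂ) r ∧
      -(t : ℂ) ∈ Metric.ball (0 : ℂ) r ∧ (2 * t : ℂ) ∈ Metric.ball (0 : ℂ) r ∧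
      -(2 * t : ℂ) ∈ Metric.ball (0 : ℂ) r := by
    intro t ht0 ht
    have n2 : ‖(2 * t : ℂ)‖ = 2 * t := by
      rw [norm_mul, Complex.norm_of_nonneg ht0.le, Complex.norm_ofNat]
    simp only [mem_ball_zero_iff, norm_neg, n2, Complex.norm_of_nonneg ht0.le]
    refine ⟨?_, ?_, ?_, ?_⟩ <;> linarith
  refine ⟨K', η, hη0.le, hη1, isExpApproximable_of_ae_bounded hK'0 ?_ fun m => ?_,
    isExpApproximable_of_ae_bounded hK'0 ?_ fun m => ?_⟩
  · filter_upwards [hℓ] with ω hω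
    refine (Complex.abs_re_le_norm _).trans
      ((norm_iteratedDeriv_zero_le hr hω.1 hω.2.2 2).trans ?_)
    norm_num [Nat.factorial] at hr2 ⊢
    linarith
  · obtain ⟨ht0, ht, htη⟩ := hball m
    set t : ℝ := s * η ^ m with htdef
    obtain ⟨m1, m2, -, -⟩ := hmem ht0 ht
    obtain ⟨g₁, hg₁, e₁⟩ := happ _ m1 m
    obtain ⟨g₂, hg₂, e₂⟩ := happ _ m2 m
    refine ⟨fun y => ((g₁ y + g₂ y) / (t : ℂ) ^ 2).re,
      Complex.measurable_re.comp ((hg₁.add hg₂).div_const _), ?_⟩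
    filter_upwards [hℓ, e₁, e₂] with ω hω e₁ e₂
    set a₁ := g₁ fun i => ω (i : ℤ)
    set a₂ := g₂ fun i => ω (i : ℤ)
    have h1 := norm_second_difference_le hr hω.1 hω.2.2 hω.2.1 ht0 ht
    have h2 : ‖(ℓ ω t + ℓ ω (-t)) / (t : ℂ) ^ 2 - (a₁ + a₂) / (t : ℂ) ^ 2‖
        ≤ 2 * (K * δ ^ m) / t ^ 2 := by
      rw [← sub_div, norm_div, norm_pow, Complex.norm_of_nonneg ht0.le]
      gcongr
      calc _ = ‖(ℓ ω t - a₁) + (ℓ ω (-t) - a₂)‖ := by congr 1; ring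
        _ ≤ _ := norm_add_le _ _
        _ ≤ _ := by linarith
    rw [← Complex.sub_re]
    refine (Complex.abs_re_le_norm _).trans ?_
    have h3 := norm_sub_le_norm_sub_add_norm_sub (iteratedDeriv 2 (ℓ ω) 0)
      ((ℓ ω t + ℓ ω (-t)) / (t : ℂ) ^ 2) ((a₁ + a₂) / (t : ℂ) ^ 2)
    rw [norm_sub_rev] at h1
    have h4 : 2 * (K * δ ^ m) / t ^ 2 ≤ 2 * K / s ^ 2 * η ^ m := by
      have e : 2 * (K * δ ^ m) / t ^ 2 = 2 * K / s ^ 2 * (η ^ m) ^ 2 := by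
        rw [← hη4, htdef]
        have : η ^ m ≠ 0 := by positivity
        rw [← pow_mul, mul_comm 4 m, pow_mul]
        field_simp
      rw [e]
      gcongr
      exact pow_le_of_le_one (by positivity) (pow_le_one₀ hη0.le hη1.le) two_ne_zero
    have h5 : 4 * 1 * (2 / r) ^ 4 * t ^ 2 ≤ B * η ^ m := by
      have : t ^ 2 ≤ t := pow_le_of_le_one ht0.le
        (htη.trans (pow_le_one₀ hη0.le hη1.le)) two_ne_zero
      rw [hB]
      gcongr
      · norm_num
      · exact this.trans htη
    have h6 : 0 ≤ (3 * K / s ^ 3 + 6 * (2 / r) ^ 3 + 2 * (2 / r) ^ 2) * η ^ m := by positivity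
    calc _ ≤ _ := h3
      _ ≤ _ := add_le_add (h1.trans h5) (h2.trans h4)
      _ ≤ K' * η ^ m := by rw [hK']; linarith
  · filter_upwards [hℓ] with ω hω
    refine (Complex.abs_re_le_norm _).trans
      ((norm_iteratedDeriv_zero_le hr hω.1 hω.2.2 3).trans ?_)
    norm_num [Nat.factorial] at hr3 ⊢
    linarith
  · obtain ⟨ht0, ht, htη⟩ := hball m
    set t : ℝ := s * η ^ m with htdef
    obtain ⟨m1, m2, m3, m4⟩ := hmem ht0 ht
    obtain ⟨g₁, hg₁, e₁⟩ := happ _ m1 m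
    obtain ⟨g₂, hg₂, e₂⟩ := happ _ m2 m
    obtain ⟨g₃, hg₃, e₃⟩ := happ _ m3 m
    obtain ⟨g₄, hg₄, e₄⟩ := happ _ m4 m
    refine ⟨fun y => ((g₃ y - 2 * g₁ y - g₄ y + 2 * g₂ y) / (2 * (t : ℂ) ^ 3)).re,
      Complex.measurable_re.comp ((((hg₃.sub (hg₁.const_mul 2)).sub hg₄).add
        (hg₂.const_mul 2)).div_const _), ?_⟩
    filter_upwards [hℓ, e₁, e₂, e₃, e₄] with ω hω e₁ e₂ e₃ e₄
    set a₁ := g₁ fun i => ω (i : ℤ)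
    set a₂ := g₂ fun i => ω (i : ℤ)
    set a₃ := g₃ fun i => ω (i : ℤ)
    set a₄ := g₄ fun i => ω (i : ℤ)
    have h1 := norm_third_difference_le hr hω.1 hω.2.2 hω.2.1 ht0 ht
    have h2 : ‖(ℓ ω (2 * t) - 2 * ℓ ω t - ℓ ω (-(2 * t)) + 2 * ℓ ω (-t)) / (2 * (t : ℂ) ^ 3)
        - (a₃ - 2 * a₁ - a₄ + 2 * a₂) / (2 * (t : ℂ) ^ 3)‖ ≤ 6 * (K * δ ^ m) / (2 * t ^ 3) := by
      rw [← sub_div, norm_div, norm_mul, Complex.norm_ofNat, norm_pow,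
        Complex.norm_of_nonneg ht0.le]
      gcongr
      have c2 : ∀ a : ℂ, ‖2 * a‖ = 2 * ‖a‖ := fun a => by rw [norm_mul, Complex.norm_ofNat]
      calc _ = ‖(ℓ ω (2 * t) - a₃) - 2 * (ℓ ω t - a₁) - (ℓ ω (-(2 * t)) - a₄)
              + 2 * (ℓ ω (-t) - a₂)‖ := by congr 1; ring
        _ ≤ ‖ℓ ω (2 * t) - a₃‖ + 2 * ‖ℓ ω t - a₁‖ + ‖ℓ ω (-(2 * t)) - a₄‖
              + 2 * ‖ℓ ω (-t) - a₂‖ := by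
            rw [← c2, ← c2]
            exact (norm_add_le _ _).trans (add_le_add ((norm_sub_le _ _).trans
              (add_le_add (norm_sub_le _ _) le_rfl)) le_rfl)
        _ ≤ _ := by linarith
    rw [← Complex.sub_re]
    refine (Complex.abs_re_le_norm _).trans ?_
    have h3 := norm_sub_le_norm_sub_add_norm_sub (iteratedDeriv 3 (ℓ ω) 0)
      ((ℓ ω (2 * t) - 2 * ℓ ω t - ℓ ω (-(2 * t)) + 2 * ℓ ω (-t)) / (2 * (t : ℂ) ^ 3))
      ((a₃ - 2 * a₁ - a₄ + 2 * a₂) / (2 * (t : ℂ) ^ 3))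
    rw [norm_sub_rev] at h1
    have h4 : 6 * (K * δ ^ m) / (2 * t ^ 3) = 3 * K / s ^ 3 * η ^ m := by
      rw [← hη4, htdef]
      have : η ^ m ≠ 0 := by positivity
      rw [← pow_mul, mul_comm 4 m, pow_mul]
      field_simp
      ring
    have h5 : 36 * 1 * (2 / r) ^ 4 * t ≤ B * η ^ m := by
      rw [hB]; gcongr
    have h6 : 0 ≤ (2 * K / s ^ 2 + 6 * (2 / r) ^ 3 + 2 * (2 / r) ^ 2) * η ^ m := by positivity
    calc _ ≤ _ := h3
      _ ≤ _ := add_le_add (h1.trans h5) (h2.trans h4.le)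
      _ ≤ K' * η ^ m := by rw [hK']; linarith

end Derivatives

/-! ### The logarithm of the moment generating function -/

section LogMGF

lemma contDiffAt_zero_of_differentiableOn_ball {f : ℂ → ℂ} {r : ℝ} (hr : 0 < r)
    (hf : DifferentiableOn ℂ f (Metric.ball 0 r)) {n : WithTop ℕ∞} : ContDiffAt ℂ n f 0 :=
  (hf.analyticAt (Metric.ball_mem_nhds _ hr)).contDiffAt

/-- If `G` is, up to a bounded analytic factor, a product of functions near `1`, then its logarithm
is, up to a bounded analytic summand, the sum of their logarithms. -/
lemma exists_log_of_norm_div_prod_le {G : ℂ → ℂ} {l : ℕ → ℂ → ℂ} {n : ℕ} {r D : ℝ} (hr : 0 < r)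
    (hD : 0 < D) (hG : DifferentiableOn ℂ G (Metric.ball 0 r)) (hG0 : G 0 = 1)
    (hl : ∀ j, DifferentiableOn ℂ (l j) (Metric.ball 0 r)) (hl0 : ∀ j, l j 0 = 1)
    (hl1 : ∀ j, ∀ z ∈ Metric.ball (0 : ℂ) r, ‖l j z - 1‖ ≤ 1 / 4)
    (hGD : ∀ z ∈ Metric.ball (0 : ℂ) r, ‖(∏ j ∈ Finset.range n, l j z)⁻¹ * G z‖ ≤ D) :
    ∃ L : ℂ → ℂ, DifferentiableOn ℂ L (Metric.ball 0 (min r (r / (4 * D)))) ∧ L 0 = 0 ∧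
      (∀ z ∈ Metric.ball (0 : ℂ) (min r (r / (4 * D))),
        ‖L z‖ ≤ n + 1 ∧ G z = Complex.exp (L z)) ∧
      ∀ k : ℕ, ‖iteratedDeriv k L 0
          - ∑ j ∈ Finset.range n, iteratedDeriv k (fun z => Complex.log (l j z)) 0‖
        ≤ k.factorial * (2 / min r (r / (4 * D))) ^ k := by
  set r' := min r (r / (4 * D)) with hr'
  have hr'0 : 0 < r' := by positivity
  have hsub : Metric.ball (0 : ℂ) r' ⊆ Metric.ball 0 r := Metric.ball_subset_ball (min_le_left _ _)
  have hne : ∀ z ∈ Metric.ball (0 : ℂ) r, ∏ j ∈ Finset.range n, l j z ≠ 0 := by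
    intro z hz
    refine Finset.prod_ne_zero_iff.2 fun j _ h0 => ?_
    have := hl1 j z hz
    rw [h0] at this
    norm_num at this
  set g : ℂ → ℂ := fun z => (∏ j ∈ Finset.range n, l j z)⁻¹ * G z with hg
  have hgd : DifferentiableOn ℂ g (Metric.ball 0 r) :=
    (DifferentiableOn.inv (DifferentiableOn.fun_finsetProd fun j _ => hl j) hne).mul hG
  have hg0 : g 0 = 1 := by simp [hg, hl0, hG0]
  have hg1 : ∀ z ∈ Metric.ball (0 : ℂ) r', ‖g z - 1‖ ≤ 1 / 2 := by
    intro z hz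
    have h := norm_sub_apply_zero_le hgd hGD (hsub hz)
    rw [hg0] at h
    have : ‖z‖ ≤ r / (4 * D) := (mem_ball_zero_iff.1 hz).le.trans (min_le_right _ _)
    calc ‖g z - 1‖ ≤ 2 * D / r * ‖z‖ := h
      _ ≤ 2 * D / r * (r / (4 * D)) := by gcongr
      _ = 1 / 2 := by field_simp; norm_num
  -- the principal branch is analytic at values within `1 / 2` of `1`, so the logarithm of the
  -- product is taken factor by factor
  set ψ : ℂ → ℂ := fun z => Complex.log (g z) with hψ
  have hψd : DifferentiableOn ℂ ψ (Metric.ball 0 r') :=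
    differentiableOn_log_comp (hgd.mono hsub) hg1
  have hl2 : ∀ j, ∀ z ∈ Metric.ball (0 : ℂ) r', ‖l j z - 1‖ ≤ 1 / 2 := fun j z hz =>
    (hl1 j z (hsub hz)).trans (by norm_num)
  have hld : ∀ j, DifferentiableOn ℂ (fun z => Complex.log (l j z)) (Metric.ball 0 r') := fun j =>
    differentiableOn_log_comp ((hl j).mono hsub) (hl2 j)
  have hsumd : DifferentiableOn ℂ (fun z => ∑ j ∈ Finset.range n, Complex.log (l j z))
      (Metric.ball 0 r') := DifferentiableOn.fun_sum fun j _ => hld j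
  refine ⟨fun z => ∑ j ∈ Finset.range n, Complex.log (l j z) + ψ z, hsumd.add hψd, ?_,
    fun z hz => ⟨?_, ?_⟩, fun k => ?_⟩
  · simp [hψ, hl0, hg0]
  · refine (norm_add_le _ _).trans (add_le_add ?_ (norm_log_le_one (hg1 z hz)))
    refine (norm_sum_le _ _).trans ((Finset.sum_le_sum fun j _ =>
      norm_log_le_one (hl2 j z hz)).trans ?_)
    simp
  · rw [Complex.exp_add, Complex.exp_sum, exp_log_of_norm_sub_one_le (hg1 z hz),
      Finset.prod_congr rfl fun j _ => exp_log_of_norm_sub_one_le (hl2 j z hz)]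
    simp only [hg]
    rw [mul_inv_cancel_left₀ (hne z (hsub hz))]
  · rw [iteratedDeriv_fun_add (contDiffAt_zero_of_differentiableOn_ball hr'0 hsumd)
        (contDiffAt_zero_of_differentiableOn_ball hr'0 hψd),
      iteratedDeriv_fun_sum fun j _ => contDiffAt_zero_of_differentiableOn_ball hr'0 (hld j),
      add_sub_cancel_left]
    have := norm_iteratedDeriv_zero_le hr'0 hψd (fun z hz => norm_log_le_one (hg1 z hz)) k
    rwa [mul_one] at this

/-- The recursion of the moments in terms of the cumulants, from `G' = L' G` for `G = exp L`. -/
lemma iteratedDeriv_succ_of_eq_exp {G L : ℂ → ℂ} {r : ℝ} (hr : 0 < r)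
    (hL : DifferentiableOn ℂ L (Metric.ball 0 r))
    (hGL : ∀ z ∈ Metric.ball (0 : ℂ) r, G z = Complex.exp (L z)) (k : ℕ) :
    iteratedDeriv (k + 1) G 0 = ∑ i ∈ Finset.range (k + 1),
      (k.choose i : ℂ) * iteratedDeriv (i + 1) L 0 * iteratedDeriv (k - i) G 0 := by
  have hG : DifferentiableOn ℂ G (Metric.ball 0 r) := hL.cexp.congr hGL
  have hderiv : deriv G =ᶠ[nhds 0] deriv L * G := by
    filter_upwards [Metric.ball_mem_nhds (0 : ℂ) hr] with z hz
    have hnhds : Metric.ball (0 : ℂ) r ∈ nhds z := Metric.isOpen_ball.mem_nhds hz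
    have h1 : G =ᶠ[nhds z] fun w => Complex.exp (L w) :=
      Filter.eventually_of_mem hnhds hGL
    have h2 := (hL.differentiableAt hnhds).hasDerivAt.cexp
    rw [h1.deriv_eq, h2.deriv, Pi.mul_apply, hGL z hz, mul_comm]
  rw [iteratedDeriv_succ', hderiv.iteratedDeriv_eq]
  have hL' : ContDiffAt ℂ k (deriv L) 0 :=
    contDiffAt_zero_of_differentiableOn_ball hr (hL.deriv Metric.isOpen_ball)
  rw [iteratedDeriv_mul hL' (contDiffAt_zero_of_differentiableOn_ball hr hG)]
  simp only [iteratedDeriv_succ']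

end LogMGF

section Probability

open ProbabilityTheory

variable {X : Type*} [MeasurableSpace X] {ν : Measure X} {S : X → ℝ}

lemma integrableExpSet_eq_univ
    (hS : ∀ z : ℂ, Integrable (fun x => Complex.exp (z * (S x : ℂ))) ν) :
    integrableExpSet S ν = Set.univ := by
  refine Set.eq_univ_of_forall fun t => ?_
  refine (hS t).norm.congr (Filter.Eventually.of_forall fun x => ?_)
  simp only [Complex.norm_exp]
  congr 1
  simp

lemma differentiable_complexMGF_of_integrable
    (hS : ∀ z : ℂ, Integrable (fun x => Complex.exp (z * (S x : ℂ))) ν) :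
    Differentiable ℂ (complexMGF S ν) := fun z =>
  (hasDerivAt_complexMGF (by simp [integrableExpSet_eq_univ hS])).differentiableAt

lemma iteratedDeriv_complexMGF_zero
    (hS : ∀ z : ℂ, Integrable (fun x => Complex.exp (z * (S x : ℂ))) ν) (k : ℕ) :
    iteratedDeriv k (complexMGF S ν) 0 = ((∫ x, S x ^ k ∂ν : ℝ) : ℂ) := by
  rw [iteratedDeriv_complexMGF (by simp [integrableExpSet_eq_univ hS])]
  refine Eq.trans ?_ (integral_ofReal (𝕜 := ℂ) (f := fun x => S x ^ k))
  congr 1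
  ext x
  simp

end Probability

/-- The logarithm of the moment generating function of `S_n^ω` near `0` is the Birkhoff sum of the
logarithms of the eigenvalues, up to a summand that is bounded uniformly in `n` and `ω`. -/
lemma exists_log_mgf {Ω X : Type*} [MeasurableSpace Ω] [MetricSpace X] [MeasurableSpace X]
    {P : Measure Ω} {θ : Ω → Ω} (hθ : MeasurePreserving θ P P) {E : Ω → Set X} {H : Ω → Type*}
    [∀ ω, NormedAddCommGroup (H ω)] [∀ ω, NormedSpace ℂ (H ω)]
    {F : ∀ ω, FunctionSpace (H ω) (E ω)} {A : ℂ → ∀ ω, H ω →L[ℂ] H (θ ω)}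
    {μ : Ω → Measure X} {S : ℕ → Ω → X → ℝ} (hmodel : IsOperatorModel P θ E H F A μ S)
    {r C δ : ℝ} (hr : 0 < r) (hC : 0 < C) (hδ0 : 0 < δ) (hδ1 : δ < 1) {lam : Ω → ℂ → ℂ}
    {h : ∀ ω, ℂ → H ω}
    (hgood : ∀ᵐ ω ∂P, DifferentiableOn ℂ (lam ω) (Metric.ball 0 r) ∧ lam ω 0 = 1 ∧
      ∀ z ∈ Metric.ball (0 : ℂ) r, ‖lam ω z - 1‖ ≤ 1 / 4 ∧ ‖h ω z - (F ω).one‖ ≤ 1 / 4 ∧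
        ∀ n : ℕ, 1 ≤ n →
          ‖(∏ j ∈ Finset.range n, lam (θ^[j] ω) z)⁻¹ • iter A z n ω (F ω).one
            - h (θ^[n] ω) z‖ ≤ C * δ ^ n) :
    ∃ r' : ℝ, 0 < r' ∧ ∀ᵐ ω ∂P, ∀ n : ℕ, 1 ≤ n → ∃ L : ℂ → ℂ,
      DifferentiableOn ℂ L (Metric.ball 0 r') ∧ L 0 = 0 ∧
      (∀ z ∈ Metric.ball (0 : ℂ) r', ‖L z‖ ≤ n + 1 ∧
        ProbabilityTheory.complexMGF (S n ω) (μ ω) z = Complex.exp (L z)) ∧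
      ∀ k : ℕ, ‖iteratedDeriv k L 0
          - ∑ j ∈ Finset.range n, iteratedDeriv k (fun z => Complex.log (lam (θ^[j] ω) z)) 0‖
        ≤ k.factorial * (2 / r') ^ k := by
  refine ⟨min r (r / (4 * (5 / 4 + C))), by positivity, ?_⟩
  have horbit : ∀ᵐ ω ∂P, ∀ j : ℕ, DifferentiableOn ℂ (lam (θ^[j] ω)) (Metric.ball 0 r) ∧
      lam (θ^[j] ω) 0 = 1 ∧ ∀ z ∈ Metric.ball (0 : ℂ) r, ‖lam (θ^[j] ω) z - 1‖ ≤ 1 / 4 ∧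
        ‖h (θ^[j] ω) z - (F (θ^[j] ω)).one‖ ≤ 1 / 4 :=
    ae_all_iff.2 fun j => by
      filter_upwards [(hθ.iterate j).quasiMeasurePreserving.ae hgood] with ω hω
      exact ⟨hω.1, hω.2.1, fun z hz => ⟨(hω.2.2 z hz).1, (hω.2.2 z hz).2.1⟩⟩
  filter_upwards [hgood, horbit, hmodel.mgf_eq] with ω hω horb hmgf n hn
  have hprob := hmodel.isProbabilityMeasure
  have hint := fun z => (hmgf z n hn).1
  refine exists_log_of_norm_div_prod_le (l := fun j => lam (θ^[j] ω)) hr (by positivity)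
    (differentiable_complexMGF_of_integrable hint).differentiableOn ?_ (fun j => (horb j).1)
    (fun j => (horb j).2.1) (fun j z hz => ((horb j).2.2 z hz).1) fun z hz => ?_
  · have := hprob ω
    simp [ProbabilityTheory.complexMGF]
  · have hE : ProbabilityTheory.complexMGF (S n ω) (μ ω) z
        = ∫ x, (F (θ^[n] ω)).toFun (iter A z n ω (F ω).one) x ∂(μ (θ^[n] ω)) := (hmgf z n hn).2.2
    have hn1 := (hω.2.2 z hz).2.2 n hn
    have hh := ((horb n).2.2 z hz).2
    have hbound : ‖(∏ j ∈ Finset.range n, lam (θ^[j] ω) z)⁻¹ • iter A z n ω (F ω).one‖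
        ≤ 5 / 4 + C := by
      have h1 := norm_sub_norm_le
        ((∏ j ∈ Finset.range n, lam (θ^[j] ω) z)⁻¹ • iter A z n ω (F ω).one) (h (θ^[n] ω) z)
      have h2 := norm_sub_norm_le (h (θ^[n] ω) z) (F (θ^[n] ω)).one
      rw [(F (θ^[n] ω)).norm_one] at h2
      have h3 : C * δ ^ n ≤ C := mul_le_of_le_one_right hC.le (pow_le_one₀ hδ0.le hδ1.le)
      linarith
    rw [hE, ← integral_const_mul]
    have := hprob (θ^[n] ω)
    have h4 := norm_integral_le_of_norm_le_const (μ := μ (θ^[n] ω)) (C := 5 / 4 + C)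
      (f := fun x => (∏ j ∈ Finset.range n, lam (θ^[j] ω) z)⁻¹ *
        (F (θ^[n] ω)).toFun (iter A z n ω (F ω).one) x)
      (Filter.Eventually.of_forall fun x => by
        have h5 := (F (θ^[n] ω)).norm_apply_le
          ((∏ j ∈ Finset.range n, lam (θ^[j] ω) z)⁻¹ • iter A z n ω (F ω).one) x
        rw [map_smul, Pi.smul_apply, smul_eq_mul] at h5
        exact h5.trans hbound)
    rwa [probReal_univ, mul_one] at h4

/-! ### From cumulants to moments -/

section Moments

/-- The asymptotic moments of even order `2 m`, those of the centred normal law of variance `a`. -/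
noncomputable def evenMoment (a : ℝ) (m : ℕ) : ℝ :=
  ((2 * m).factorial : ℝ) / (2 ^ m * (m.factorial : ℝ)) * a ^ m

/-- The asymptotic moments of odd order `2 m + 1`, in terms of the limits `a` and `b` of the second
and third normalized cumulants. -/
noncomputable def oddMoment (a b : ℝ) : ℕ → ℝ
  | 0 => 0
  | m + 1 => ((2 * m + 3).factorial : ℝ) / ((Nat.factorial 3 : ℝ) * 2 ^ m * (m.factorial : ℝ))
      * a ^ m * b

lemma evenMoment_succ (a : ℝ) (m : ℕ) :
    evenMoment a (m + 1) = (2 * m + 1) * a * evenMoment a m := by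
  have h1 : 2 * (m + 1) = 2 * m + 1 + 1 := by ring
  have h2 : (m.factorial : ℝ) ≠ 0 := by positivity
  rw [evenMoment, evenMoment, h1, Nat.factorial_succ, Nat.factorial_succ, Nat.factorial_succ]
  push_cast
  field_simp
  ring

lemma oddMoment_succ (a b : ℝ) (m : ℕ) :
    oddMoment a b (m + 1) = (2 * m + 2) * a * oddMoment a b m
      + ((2 * m + 2).choose 2 : ℕ) * b * evenMoment a m := by
  have hch : (((2 * m + 2).choose 2 : ℕ) : ℝ) = (m + 1) * (2 * m + 1) := by
    rw [Nat.cast_choose_two]; push_cast; ring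
  rw [hch]
  cases m with
  | zero => simp [oddMoment, evenMoment, Nat.factorial]
  | succ m =>
    have h2 : (m.factorial : ℝ) ≠ 0 := by positivity
    have h3 : 2 * (m + 1) + 3 = 2 * m + 3 + 1 + 1 := by ring
    have h4 : 2 * (m + 1) = 2 * m + 1 + 1 := by ring
    rw [oddMoment, oddMoment, evenMoment, h3, h4, Nat.factorial_succ (2 * m + 3 + 1),
      Nat.factorial_succ (2 * m + 3), Nat.factorial_succ (2 * m + 2), Nat.factorial_succ m]
    have h5 : ((2 * m + 1 + 1).factorial : ℝ) ≠ 0 := by positivity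
    have h6 : (Nat.factorial 3 : ℝ) = 6 := by norm_num [Nat.factorial]
    rw [h6]
    push_cast
    field_simp
    ring

/-- `m` and `κ` are related like the moments and the cumulants of a centred random variable, and
`‖κ j‖ ≤ c j * N`. The sequence `c` serves for all `N` simultaneously. The value `κ 0` plays no
role. -/
structure IsMomentSequence (c : ℕ → ℝ) (N : ℝ) (κ m : ℕ → ℂ) : Prop where
  one_le : 1 ≤ N
  zero : m 0 = 1
  succ : ∀ k, m (k + 1) = ∑ i ∈ Finset.range (k + 1), (k.choose i : ℂ) * κ (i + 1) * m (k - i)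
  cumulant_one : κ 1 = 0
  cumulant_le : ∀ j, ‖κ j‖ ≤ c j * N

variable {c : ℕ → ℝ}

/-- The moment of order `k` is `O(N ^ [k / 2])`, since the first cumulant vanishes: in the
recursion each factor `κ (i + 1) = O(N)` lowers the order by at least two. -/
lemma exists_norm_moment_le (hc : ∀ j, 0 ≤ c j) (K : ℕ) : ∃ B : ℝ, 0 ≤ B ∧ ∀ k ≤ K,
    ∀ (N : ℝ) (κ m : ℕ → ℂ), IsMomentSequence c N κ m → ‖m k‖ ≤ B * N ^ (k / 2) := by
  induction K with
  | zero =>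
    refine ⟨1, zero_le_one, fun k hk N κ m h => ?_⟩
    obtain rfl : k = 0 := by omega
    simp [h.zero]
  | succ K ih =>
    obtain ⟨B, hB0, hB⟩ := ih
    refine ⟨B + ∑ i ∈ Finset.range (K + 1), (K.choose i : ℝ) * c (i + 1) * B,
      add_nonneg hB0 (Finset.sum_nonneg fun i _ => by have := hc (i + 1); positivity),
      fun k hk N κ m h => ?_⟩
    have hN0 : 0 ≤ N := zero_le_one.trans h.one_le
    have hs0 : 0 ≤ ∑ i ∈ Finset.range (K + 1), (K.choose i : ℝ) * c (i + 1) * B :=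
      Finset.sum_nonneg fun i _ => by have := hc (i + 1); positivity
    rcases Nat.lt_or_ge k (K + 1) with hlt | hge
    · refine (hB k (by omega) N κ m h).trans ?_
      gcongr
      linarith
    · obtain rfl : k = K + 1 := by omega
      rw [h.succ]
      refine (norm_sum_le _ _).trans ?_
      have : ∀ i ∈ Finset.range (K + 1), ‖(K.choose i : ℂ) * κ (i + 1) * m (K - i)‖
          ≤ (K.choose i : ℝ) * c (i + 1) * B * N ^ ((K + 1) / 2) := by
        intro i hi
        rw [Finset.mem_range] at hi
        rcases Nat.eq_zero_or_pos i with rfl | hi0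
        · have := hc (0 + 1)
          rw [zero_add, h.cumulant_one, mul_zero, zero_mul, norm_zero]
          positivity
        · rw [norm_mul, norm_mul, Complex.norm_natCast]
          have h1 := h.cumulant_le (i + 1)
          have h2 := hB (K - i) (by omega) N κ m h
          calc (K.choose i : ℝ) * ‖κ (i + 1)‖ * ‖m (K - i)‖
              ≤ (K.choose i : ℝ) * (c (i + 1) * N) * (B * N ^ ((K - i) / 2)) := by
                have := hc (i + 1)
                gcongr
            _ = (K.choose i : ℝ) * c (i + 1) * B * N ^ ((K - i) / 2 + 1) := by ring
            _ ≤ _ := by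
                have := hc (i + 1)
                refine mul_le_mul_of_nonneg_left (pow_le_pow_right₀ h.one_le ?_) (by positivity)
                omega
      refine (Finset.sum_le_sum this).trans ?_
      rw [← Finset.sum_mul]
      gcongr
      linarith

/-- Only the cumulants of order two and three contribute to the leading order of a moment. -/
lemma exists_norm_moment_sub_le (hc : ∀ j, 0 ≤ c j) {k : ℕ} (hk : 1 ≤ k) : ∃ B : ℝ, 0 ≤ B ∧
    ∀ (N : ℝ) (κ m : ℕ → ℂ), IsMomentSequence c N κ m →
      ‖m (k + 1) - k * κ 2 * m (k - 1) - (k.choose 2 : ℂ) * κ 3 * m (k - 2)‖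
        ≤ B * N ^ ((k - 1) / 2) := by
  obtain ⟨B, hB0, hB⟩ := exists_norm_moment_le hc k
  refine ⟨∑ i ∈ Finset.range k, (k.choose (i + 3) : ℝ) * c (i + 4) * B,
    Finset.sum_nonneg fun i _ => by have := hc (i + 4); positivity, fun N κ m h => ?_⟩
  have hN0 : 0 ≤ N := zero_le_one.trans h.one_le
  have hsum : m (k + 1) = ∑ i ∈ Finset.range (k + 3),
      (k.choose i : ℂ) * κ (i + 1) * m (k - i) := by
    rw [h.succ, Finset.sum_range_succ _ (k + 2), Finset.sum_range_succ _ (k + 1),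
      Nat.choose_eq_zero_of_lt (show k < k + 2 by omega),
      Nat.choose_eq_zero_of_lt (show k < k + 1 by omega)]
    simp
  have e : m (k + 1) - k * κ 2 * m (k - 1) - (k.choose 2 : ℂ) * κ 3 * m (k - 2)
      = ∑ i ∈ Finset.range k, (k.choose (i + 3) : ℂ) * κ (i + 4) * m (k - (i + 3)) := by
    rw [hsum, Finset.sum_range_succ', Finset.sum_range_succ', Finset.sum_range_succ']
    simp only [zero_add, h.cumulant_one, Nat.choose_one_right]
    ring
  rw [e, Finset.sum_mul]
  refine (norm_sum_le _ _).trans (Finset.sum_le_sum fun i _ => ?_)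
  rw [norm_mul, norm_mul, Complex.norm_natCast]
  have hci := hc (i + 4)
  rcases Nat.lt_or_ge k (i + 3) with hlt | hge
  · rw [Nat.choose_eq_zero_of_lt hlt]
    simp
  · calc (k.choose (i + 3) : ℝ) * ‖κ (i + 4)‖ * ‖m (k - (i + 3))‖
        ≤ (k.choose (i + 3) : ℝ) * (c (i + 4) * N) * (B * N ^ ((k - (i + 3)) / 2)) := by
          gcongr
          · exact h.cumulant_le _
          · exact hB _ (by omega) N κ m h
      _ = (k.choose (i + 3) : ℝ) * c (i + 4) * B * N ^ ((k - (i + 3)) / 2 + 1) := by ring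
      _ ≤ _ := by
          refine mul_le_mul_of_nonneg_left (pow_le_pow_right₀ h.one_le ?_) (by positivity)
          omega

/-- Product rule for the error of an approximation. -/
lemma norm_mul_sub_mul_le {κ m : ℂ} {a g N ε B D p : ℝ} (hN : 0 ≤ N)
    (hκ : ‖κ - a * N‖ ≤ ε * N) (hm : ‖m‖ ≤ B * p) (hmg : ‖m - g * p‖ ≤ D * ε * p) :
    ‖κ * m - (a * g : ℝ) * (N * p : ℝ)‖ ≤ (B + |a| * D) * ε * (N * p) := by
  have e : κ * m - (a * g : ℝ) * (N * p : ℝ) = (κ - a * N) * m + a * N * (m - g * p) := by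
    push_cast; ring
  rw [e]
  refine (norm_add_le _ _).trans ?_
  rw [norm_mul, norm_mul, norm_mul, Complex.norm_real, Complex.norm_real, Real.norm_eq_abs,
    Real.norm_of_nonneg hN]
  calc ‖κ - a * N‖ * ‖m‖ + |a| * N * ‖m - g * p‖
      ≤ (ε * N) * (B * p) + |a| * N * (D * ε * p) := by
        have := (norm_nonneg _).trans hκ
        gcongr
    _ = _ := by ring

/-- If the second and third cumulants are `a N` and `b N` up to errors `ε N`, where `ε ≥ 1 / N`, the
moments of order `2 j` and `2 j + 1` have their limiting size up to errors `O(ε N ^ j)`. -/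
lemma exists_norm_moment_sub_limit_le (hc : ∀ j, 0 ≤ c j) (a b : ℝ) (j : ℕ) : ∃ D : ℝ, 0 ≤ D ∧
    ∀ (N ε : ℝ) (κ m : ℕ → ℂ), IsMomentSequence c N κ m → 1 ≤ ε * N →
      ‖κ 2 - a * N‖ ≤ ε * N → ‖κ 3 - b * N‖ ≤ ε * N →
      ‖m (2 * j) - (evenMoment a j : ℂ) * (N ^ j : ℝ)‖ ≤ D * ε * N ^ j ∧
      ‖m (2 * j + 1) - (oddMoment a b j : ℂ) * (N ^ j : ℝ)‖ ≤ D * ε * N ^ j := by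
  induction j with
  | zero =>
    refine ⟨0, le_rfl, fun N ε κ m h _ _ _ => ⟨?_, ?_⟩⟩
    · simp [evenMoment, h.zero]
    · have : m 1 = 0 := by rw [h.succ 0]; simp [h.cumulant_one]
      simp [oddMoment, this]
  | succ j ih =>
    obtain ⟨D, hD0, hD⟩ := ih
    obtain ⟨B, hB0, hB⟩ := exists_norm_moment_le hc (2 * j + 1)
    obtain ⟨B₁, hB₁0, hB₁⟩ := exists_norm_moment_sub_le hc (k := 2 * j + 1) (by omega)
    obtain ⟨B₂, hB₂0, hB₂⟩ := exists_norm_moment_sub_le hc (k := 2 * j + 2) (by omega)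
    set ch : ℝ := (((2 * j + 1).choose 2 : ℕ) : ℝ) with hch
    set ch' : ℝ := (((2 * j + 2).choose 2 : ℕ) : ℝ) with hch'
    have hch0 : 0 ≤ ch := Nat.cast_nonneg _
    have hch'0 : 0 ≤ ch' := Nat.cast_nonneg _
    have hc3 := hc 3
    set D₁ : ℝ := (2 * j + 1) * (B + |a| * D) + ch * (c 3 * B) + B₁ with hD₁
    set D₂ : ℝ := (2 * j + 2) * (B + |a| * D) + ch' * (B + |b| * D) + B₂ with hD₂
    have hD₁0 : 0 ≤ D₁ := by positivity
    have hD₂0 : 0 ≤ D₂ := by positivity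
    refine ⟨D₁ + D₂, by positivity, fun N ε κ m h hε h2 h3 => ?_⟩
    have hN1 := h.one_le
    have hN0 : 0 ≤ N := zero_le_one.trans h.one_le
    have hε0 : 0 ≤ ε := by
      by_contra hcon
      have : ε * N ≤ 0 := mul_nonpos_of_nonpos_of_nonneg (not_le.1 hcon).le hN0
      linarith
    obtain ⟨he, ho⟩ := hD N ε κ m h hε h2 h3
    have hpow : N ^ j ≤ ε * N ^ (j + 1) := by
      rw [pow_succ]
      have : 0 ≤ N ^ j := by positivity
      nlinarith
    have hNN : N ^ (j + 1) = N * N ^ j := by ring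
    have be : ‖m (2 * j)‖ ≤ B * N ^ j := by
      have := hB (2 * j) (by omega) N κ m h
      rwa [show 2 * j / 2 = j by omega] at this
    have bo : ‖m (2 * j + 1)‖ ≤ B * N ^ j := by
      have := hB (2 * j + 1) (by omega) N κ m h
      rwa [show (2 * j + 1) / 2 = j by omega] at this
    have t1 := norm_mul_sub_mul_le hN0 h2 be (by push_cast at he ⊢; exact he)
    have t2 := norm_mul_sub_mul_le hN0 h2 bo (by push_cast at ho ⊢; exact ho)
    have t3 := norm_mul_sub_mul_le hN0 h3 be (by push_cast at he ⊢; exact he)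
    rw [← hNN] at t1 t2 t3
    have hεN : 0 ≤ ε * N ^ (j + 1) := by positivity
    constructor
    · have r1 := hB₁ N κ m h
      rw [show (2 * j + 1 - 1) / 2 = j by omega, show 2 * j + 1 - 1 = 2 * j by omega] at r1
      -- the third cumulant only contributes to a lower order here
      have r2 : ‖((2 * j + 1).choose 2 : ℂ) * κ 3 * m (2 * j + 1 - 2)‖
          ≤ ch * (c 3 * B) * N ^ j := by
        rw [norm_mul, norm_mul, Complex.norm_natCast]
        rcases Nat.eq_zero_or_pos j with rfl | hj
        · simp [hch]
        · have b1 := hB (2 * j + 1 - 2) (by omega) N κ m h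
          rw [show (2 * j + 1 - 2) / 2 = j - 1 by omega] at b1
          calc ch * ‖κ 3‖ * ‖m (2 * j + 1 - 2)‖ ≤ ch * (c 3 * N) * (B * N ^ (j - 1)) := by
                gcongr
                exact h.cumulant_le 3
            _ = ch * (c 3 * B) * N ^ (j - 1 + 1) := by ring
            _ = _ := by rw [Nat.sub_add_cancel hj]
      have e : m (2 * (j + 1)) - (evenMoment a (j + 1) : ℂ) * (N ^ (j + 1) : ℝ)
          = (m (2 * j + 1 + 1) - ((2 * j + 1 : ℕ) : ℂ) * κ 2 * m (2 * j)
              - ((2 * j + 1).choose 2 : ℂ) * κ 3 * m (2 * j + 1 - 2))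
            + ((2 * j + 1).choose 2 : ℂ) * κ 3 * m (2 * j + 1 - 2)
            + ((2 * j + 1 : ℝ) : ℂ) * (κ 2 * m (2 * j)
              - (a * evenMoment a j : ℝ) * (N ^ (j + 1) : ℝ)) := by
        rw [evenMoment_succ]; push_cast; ring_nf
      rw [e]
      calc _ ≤ B₁ * N ^ j + ch * (c 3 * B) * N ^ j
              + (2 * j + 1) * ((B + |a| * D) * ε * N ^ (j + 1)) := by
            refine (norm_add_le _ _).trans (add_le_add ((norm_add_le _ _).trans
              (add_le_add r1 r2)) ?_)
            rw [norm_mul, Complex.norm_real, Real.norm_of_nonneg (by positivity)]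
            gcongr
        _ ≤ B₁ * (ε * N ^ (j + 1)) + ch * (c 3 * B) * (ε * N ^ (j + 1))
              + (2 * j + 1) * ((B + |a| * D) * ε * N ^ (j + 1)) := by gcongr
        _ = D₁ * (ε * N ^ (j + 1)) := by rw [hD₁]; ring
        _ ≤ (D₁ + D₂) * (ε * N ^ (j + 1)) := by gcongr; linarith
        _ = _ := by ring
    · have r1 := hB₂ N κ m h
      rw [show (2 * j + 2 - 1) / 2 = j by omega, show 2 * j + 2 - 1 = 2 * j + 1 by omega,
        show 2 * j + 2 - 2 = 2 * j by omega] at r1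
      have e : m (2 * (j + 1) + 1) - (oddMoment a b (j + 1) : ℂ) * (N ^ (j + 1) : ℝ)
          = (m (2 * j + 2 + 1) - ((2 * j + 2 : ℕ) : ℂ) * κ 2 * m (2 * j + 1)
              - ((2 * j + 2).choose 2 : ℂ) * κ 3 * m (2 * j))
            + ((2 * j + 2 : ℝ) : ℂ) * (κ 2 * m (2 * j + 1)
              - (a * oddMoment a b j : ℝ) * (N ^ (j + 1) : ℝ))
            + (ch' : ℂ) * (κ 3 * m (2 * j)
              - (b * evenMoment a j : ℝ) * (N ^ (j + 1) : ℝ)) := by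
        rw [oddMoment_succ, hch']; push_cast; ring_nf
      rw [e]
      calc _ ≤ B₂ * N ^ j + (2 * j + 2) * ((B + |a| * D) * ε * N ^ (j + 1))
              + ch' * ((B + |b| * D) * ε * N ^ (j + 1)) := by
            refine (norm_add_le _ _).trans (add_le_add ((norm_add_le _ _).trans
              (add_le_add r1 ?_)) ?_)
            · rw [norm_mul, Complex.norm_real, Real.norm_of_nonneg (by positivity)]
              gcongr
            · rw [norm_mul, Complex.norm_real, Real.norm_of_nonneg (by positivity)]
              gcongr
        _ ≤ B₂ * (ε * N ^ (j + 1)) + (2 * j + 2) * ((B + |a| * D) * ε * N ^ (j + 1))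
              + ch' * ((B + |b| * D) * ε * N ^ (j + 1)) := by gcongr
        _ = D₂ * (ε * N ^ (j + 1)) := by rw [hD₂]; ring
        _ ≤ (D₁ + D₂) * (ε * N ^ (j + 1)) := by gcongr; linarith
        _ = _ := by ring

end Moments

/-! ### Gaussian smoothing and the Kolmogorov distance -/

section Smoothing

open ProbabilityTheory
open scoped NNReal

variable {v : ℝ≥0}

lemma gaussianReal_Iic_sub_Iic (hv : v ≠ 0) {s s' : ℝ} (hs : s' ≤ s) (x : ℝ) :
    (gaussianReal 0 v).real (Set.Iic (s - x)) - (gaussianReal 0 v).real (Set.Iic (s' - x))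
      = ∫ u in Set.Ioc s' s, gaussianPDFReal 0 v (u - x) := by
  have h : ∀ y, (gaussianReal 0 v).real (Set.Iic y) = ∫ u in Set.Iic y, gaussianPDFReal 0 v u := by
    intro y
    rw [measureReal_def, gaussianReal_apply_eq_integral 0 hv, ENNReal.toReal_ofReal]
    exact integral_nonneg fun u => gaussianPDFReal_nonneg 0 v u
  rw [h, h, intervalIntegral.integral_Iic_sub_Iic (integrable_gaussianPDFReal 0 v).integrableOn
    (integrable_gaussianPDFReal 0 v).integrableOn, ← intervalIntegral.integral_of_le hs,
    intervalIntegral.integral_comp_sub_right]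

lemma integrable_gaussian_weight (hv : v ≠ 0) :
    Integrable fun t : ℝ => Complex.exp (-((v : ℂ) / 2) * t ^ 2) := by
  refine integrable_cexp_neg_mul_sq ?_
  have : 0 < (v : ℝ) := by positivity
  simpa using this

lemma norm_gaussian_weight (t : ℝ) :
    ‖Complex.exp (-((v : ℂ) / 2) * t ^ 2)‖ = Real.exp (-(v * t ^ 2 / 2)) := by
  have : (-((v : ℂ) / 2) * t ^ 2) = ((-(v * t ^ 2 / 2) : ℝ) : ℂ) := by push_cast; ring
  rw [this, Complex.norm_exp_ofReal]

lemma norm_exp_I_mul (a b : ℝ) : ‖Complex.exp (Complex.I * a * b)‖ = 1 := by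
  have : Complex.I * a * b = ((a * b : ℝ) : ℂ) * Complex.I := by push_cast; ring
  rw [this, Complex.norm_exp_ofReal_mul_I]

/-- Fourier inversion for the centred normal density. -/
lemma gaussianPDFReal_eq_fourier (hv : v ≠ 0) (y : ℝ) :
    (gaussianPDFReal 0 v y : ℂ) = (2 * Real.pi : ℂ)⁻¹ *
      ∫ t : ℝ, Complex.exp (Complex.I * (-y : ℝ) * t) * Complex.exp (-((v : ℂ) / 2) * t ^ 2) := by
  have hv0 : 0 < (v : ℝ) := by positivity
  have hvc : (v : ℂ) ≠ 0 := by exact_mod_cast hv0.ne'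
  rw [fourierIntegral_gaussian (by simpa using hv0), gaussianPDFReal]
  have h1 : ((Real.pi : ℂ) / ((v : ℂ) / 2)) ^ (1 / 2 : ℂ) = (Real.sqrt (2 * Real.pi / v) : ℂ) := by
    rw [Real.sqrt_eq_rpow, Complex.ofReal_cpow (by positivity)]
    push_cast
    congr 1
    field_simp
  have h2 : Real.sqrt (2 * Real.pi / v) = 2 * Real.pi * (Real.sqrt (2 * Real.pi * v))⁻¹ := by
    rw [Real.sqrt_div (by positivity), Real.sqrt_mul (show 0 ≤ 2 * Real.pi by positivity) (v : ℝ)]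
    have h3 : 0 < Real.sqrt (2 * Real.pi) := by positivity
    have h4 : 0 < Real.sqrt (v : ℝ) := by positivity
    have h5 := Real.mul_self_sqrt (show 0 ≤ 2 * Real.pi by positivity)
    field_simp
    linarith
  rw [h1, h2]
  have hpi : (Real.pi : ℂ) ≠ 0 := by exact_mod_cast Real.pi_ne_zero
  push_cast
  rw [← mul_assoc, ← mul_assoc, inv_mul_cancel₀ (mul_ne_zero two_ne_zero hpi), one_mul]
  congr 2
  field_simp
  ring

/-- The density of the convolution with a normal law, by Fourier inversion. -/
lemma integral_gaussianPDFReal_eq_fourier (hv : v ≠ 0) (ν : Measure ℝ) [IsProbabilityMeasure ν]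
    (u : ℝ) :
    ((∫ x, gaussianPDFReal 0 v (u - x) ∂ν : ℝ) : ℂ) = (2 * Real.pi : ℂ)⁻¹ *
      ∫ t : ℝ, Complex.exp (Complex.I * (-u : ℝ) * t) *
        (charFun ν t * Complex.exp (-((v : ℂ) / 2) * t ^ 2)) := by
  rw [← integral_complex_ofReal]
  simp_rw [gaussianPDFReal_eq_fourier hv]
  rw [integral_const_mul]
  congr 1
  rw [integral_integral_swap]
  · refine integral_congr_ae (Filter.Eventually.of_forall fun t => ?_)
    simp only
    rw [charFun_apply_real, ← integral_mul_const, ← integral_const_mul]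
    refine integral_congr_ae (Filter.Eventually.of_forall fun x => ?_)
    simp only
    rw [show Complex.I * (-(u - x) : ℝ) * t = Complex.I * (-u : ℝ) * t + t * x * Complex.I by
      push_cast; ring, Complex.exp_add, mul_assoc]
  · refine Integrable.bdd_mul (c := 1) (g := fun z : ℝ × ℝ =>
      Complex.exp (-((v : ℂ) / 2) * z.2 ^ 2)) ((integrable_gaussian_weight hv).comp_snd ν)
      ?_ (Filter.Eventually.of_forall fun z => (norm_exp_I_mul _ _).le)
    exact Continuous.aestronglyMeasurable (by fun_prop)

lemma gaussianPDFReal_le (v : ℝ≥0) (y : ℝ) :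
    gaussianPDFReal 0 v y ≤ (Real.sqrt (2 * Real.pi * v))⁻¹ := by
  rw [gaussianPDFReal]
  refine mul_le_of_le_one_right (by positivity) (Real.exp_le_one_iff.2 ?_)
  rw [neg_div]
  have : 0 ≤ (y - 0) ^ 2 / (2 * (v : ℝ)) := by positivity
  linarith

/-- The distribution function at `s` of the convolution of `ν` with the centred normal law of
variance `v`. -/
noncomputable def smoothedCDF (v : ℝ≥0) (ν : Measure ℝ) (s : ℝ) : ℝ :=
  ∫ x, (gaussianReal 0 v).real (Set.Iic (s - x)) ∂ν

lemma measurable_gaussianReal_Iic_sub (v : ℝ≥0) (s : ℝ) :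
    Measurable fun x => (gaussianReal 0 v).real (Set.Iic (s - x)) := by
  have : Antitone fun x => (gaussianReal 0 v).real (Set.Iic (s - x)) := fun x y hxy =>
    measureReal_mono (Set.Iic_subset_Iic.2 (by linarith))
  exact this.measurable

lemma integrable_gaussianReal_Iic_sub (v : ℝ≥0) (s : ℝ) (ν : Measure ℝ) [IsProbabilityMeasure ν] :
    Integrable (fun x => (gaussianReal 0 v).real (Set.Iic (s - x))) ν :=
  Integrable.of_bound (measurable_gaussianReal_Iic_sub v s).aestronglyMeasurable 1
    (Filter.Eventually.of_forall fun x => by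
      rw [Real.norm_of_nonneg measureReal_nonneg]; exact measureReal_le_one)

lemma smoothedCDF_sub (hv : v ≠ 0) (ν : Measure ℝ) [IsProbabilityMeasure ν] {s s' : ℝ}
    (hs : s' ≤ s) :
    ((smoothedCDF v ν s - smoothedCDF v ν s' : ℝ) : ℂ) = (2 * Real.pi : ℂ)⁻¹ *
      ∫ u in Set.Ioc s' s, ∫ t : ℝ, Complex.exp (Complex.I * (-u : ℝ) * t) *
        (charFun ν t * Complex.exp (-((v : ℂ) / 2) * t ^ 2)) := by
  have h1 : smoothedCDF v ν s - smoothedCDF v ν s'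
      = ∫ u in Set.Ioc s' s, ∫ x, gaussianPDFReal 0 v (u - x) ∂ν := by
    rw [smoothedCDF, smoothedCDF, ← integral_sub (integrable_gaussianReal_Iic_sub v s ν)
      (integrable_gaussianReal_Iic_sub v s' ν)]
    simp_rw [gaussianReal_Iic_sub_Iic hv hs]
    rw [integral_integral_swap]
    refine Integrable.of_bound (C := (Real.sqrt (2 * Real.pi * v))⁻¹) ?_
      (Filter.Eventually.of_forall fun z => ?_)
    · exact ((measurable_gaussianPDFReal 0 v).comp
        (measurable_snd.sub measurable_fst)).aestronglyMeasurable
    · simp only [Function.uncurry]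
      rw [Real.norm_of_nonneg (gaussianPDFReal_nonneg _ _ _)]
      exact gaussianPDFReal_le v _
  rw [h1, ← integral_const_mul, ← integral_complex_ofReal]
  simp_rw [integral_gaussianPDFReal_eq_fourier hv]

lemma norm_integral_exp_I_mul_le {s s' t : ℝ} (hs : s' ≤ s) (ht : t ≠ 0) :
    ‖∫ u in Set.Ioc s' s, Complex.exp (Complex.I * (-u : ℝ) * t)‖ ≤ 2 / |t| := by
  have hc : -(Complex.I * t) ≠ 0 := by simp [ht]
  have e : ∀ u : ℝ, Complex.I * (-u : ℝ) * t = -(Complex.I * t) * u := fun u => by push_cast; ring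
  simp_rw [e]
  rw [← intervalIntegral.integral_of_le hs, integral_exp_mul_complex hc, norm_div, norm_neg,
    norm_mul, Complex.norm_I, one_mul, Complex.norm_real, Real.norm_eq_abs]
  gcongr
  refine (norm_sub_le _ _).trans ?_
  rw [← e, ← e, norm_exp_I_mul, norm_exp_I_mul]
  norm_num

lemma tendsto_smoothedCDF_atBot (v : ℝ≥0) (ν : Measure ℝ) [IsProbabilityMeasure ν] :
    Filter.Tendsto (fun n : ℕ => smoothedCDF v ν (-n)) Filter.atTop (nhds 0) := by
  rw [← integral_zero ℝ ℝ (μ := ν)]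
  refine tendsto_integral_of_dominated_convergence (fun _ => 1)
    (fun n => (measurable_gaussianReal_Iic_sub v _).aestronglyMeasurable) (integrable_const _)
    (fun n => Filter.Eventually.of_forall fun x => by
      rw [Real.norm_of_nonneg measureReal_nonneg]; exact measureReal_le_one)
    (Filter.Eventually.of_forall fun x => ?_)
  have h := tendsto_cdf_atBot (gaussianReal 0 v)
  have h2 : Filter.Tendsto (fun n : ℕ => -(n : ℝ) - x) Filter.atTop Filter.atBot :=
    Filter.tendsto_atBot_add_const_right _ _
      (Filter.tendsto_neg_atTop_atBot.comp tendsto_natCast_atTop_atTop)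
  simpa [cdf_eq_real, Function.comp_def] using h.comp h2

/-- After smoothing by a normal law, distribution functions are compared through the
characteristic functions. -/
lemma abs_smoothedCDF_sub_le (hv : v ≠ 0) (ν₁ ν₂ : Measure ℝ) [IsProbabilityMeasure ν₁]
    [IsProbabilityMeasure ν₂] {B : ℝ → ℝ} (hB : Integrable B)
    (hBφ : ∀ t, ‖charFun ν₁ t - charFun ν₂ t‖ * Real.exp (-(v * t ^ 2 / 2)) ≤ |t| * B t) (s : ℝ) :
    |smoothedCDF v ν₁ s - smoothedCDF v ν₂ s| ≤ Real.pi⁻¹ * (∫ t, B t) := by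
  set w : ℝ → ℂ := fun t => Complex.exp (-((v : ℂ) / 2) * t ^ 2) with hw
  have hwint : Integrable w := integrable_gaussian_weight hv
  have hφw : ∀ (ν : Measure ℝ) [IsProbabilityMeasure ν], Integrable fun t => charFun ν t * w t :=
    fun ν _ => hwint.bdd_mul measurable_charFun.aestronglyMeasurable
      (Filter.Eventually.of_forall fun t => norm_charFun_le_one t)
  have hswap : ∀ (ν : Measure ℝ) [IsProbabilityMeasure ν], ∀ s' : ℝ, Integrable
      (Function.uncurry fun (u t : ℝ) => Complex.exp (Complex.I * (-u : ℝ) * t) *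
        (charFun ν t * w t)) ((volume.restrict (Set.Ioc s' s)).prod volume) := by
    intro ν _ s'
    refine Integrable.bdd_mul (c := 1) (g := fun z : ℝ × ℝ => charFun ν z.2 * w z.2)
      ((hφw ν).comp_snd _) ?_ (Filter.Eventually.of_forall fun z => (norm_exp_I_mul _ _).le)
    exact Continuous.aestronglyMeasurable (by fun_prop)
  -- the bound for increments over `(s', s]` does not depend on `s'`, which is sent to `-∞`
  have key : ∀ s' ≤ s, |(smoothedCDF v ν₁ s - smoothedCDF v ν₂ s)
      - (smoothedCDF v ν₁ s' - smoothedCDF v ν₂ s')| ≤ Real.pi⁻¹ * (∫ t, B t) := by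
    intro s' hs
    have e : (((smoothedCDF v ν₁ s - smoothedCDF v ν₂ s)
        - (smoothedCDF v ν₁ s' - smoothedCDF v ν₂ s') : ℝ) : ℂ) = (2 * Real.pi : ℂ)⁻¹ *
        ∫ t : ℝ, (∫ u in Set.Ioc s' s, Complex.exp (Complex.I * (-u : ℝ) * t)) *
          ((charFun ν₁ t - charFun ν₂ t) * w t) := by
      have e0 : (smoothedCDF v ν₁ s - smoothedCDF v ν₂ s)
        - (smoothedCDF v ν₁ s' - smoothedCDF v ν₂ s') = (smoothedCDF v ν₁ s - smoothedCDF v ν₁ s')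
        - (smoothedCDF v ν₂ s - smoothedCDF v ν₂ s') := by ring
      have i1 : Integrable fun t : ℝ => ∫ u in Set.Ioc s' s,
        Complex.exp (Complex.I * (-u : ℝ) * t) * (charFun ν₁ t * w t) := (hswap ν₁ s').integral_prod_right
      have i2 : Integrable fun t : ℝ => ∫ u in Set.Ioc s' s,
        Complex.exp (Complex.I * (-u : ℝ) * t) * (charFun ν₂ t * w t) := (hswap ν₂ s').integral_prod_right
      rw [e0, Complex.ofReal_sub, smoothedCDF_sub hv ν₁ hs, smoothedCDF_sub hv ν₂ hs, ← mul_sub,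
        integral_integral_swap (hswap ν₁ s'), integral_integral_swap (hswap ν₂ s'),
        ← integral_sub i1 i2]
      congr 1
      refine integral_congr_ae (Filter.Eventually.of_forall fun t => ?_)
      simp only [integral_mul_const]
      ring
    rw [← Real.norm_eq_abs, ← Complex.norm_real, e, norm_mul]
    have hpi : ‖(2 * Real.pi : ℂ)⁻¹‖ = (2 * Real.pi)⁻¹ := by
      rw [norm_inv, norm_mul, Complex.norm_ofNat, Complex.norm_real, Real.norm_of_nonneg
        Real.pi_pos.le]
    rw [hpi]
    have hle := norm_integral_le_of_norm_le (hB.const_mul 2) (f := fun t : ℝ =>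
      (∫ u in Set.Ioc s' s, Complex.exp (Complex.I * (-u : ℝ) * t)) *
          ((charFun ν₁ t - charFun ν₂ t) * w t)) (by
        have hne : ∀ᵐ t : ℝ, t ≠ 0 := by
          simp [ae_iff]
        filter_upwards [hne] with t ht
        rw [norm_mul, norm_mul, hw, norm_gaussian_weight]
        have hpos : 0 < |t| := abs_pos.2 ht
        calc _ ≤ 2 / |t| * (|t| * B t) :=
              mul_le_mul (norm_integral_exp_I_mul_le hs ht) (hBφ t) (by positivity) (by positivity)
          _ = 2 * B t := by field_simp)
    calc _ ≤ (2 * Real.pi)⁻¹ * ∫ t, 2 * B t := by gcongr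
      _ = _ := by rw [integral_const_mul, mul_inv]; ring
  have hlim : Filter.Tendsto (fun n : ℕ => |(smoothedCDF v ν₁ s - smoothedCDF v ν₂ s)
      - (smoothedCDF v ν₁ (-n) - smoothedCDF v ν₂ (-n))|) Filter.atTop
      (nhds |(smoothedCDF v ν₁ s - smoothedCDF v ν₂ s) - (0 - 0)|) :=
    ((tendsto_const_nhds.sub ((tendsto_smoothedCDF_atBot v ν₁).sub
      (tendsto_smoothedCDF_atBot v ν₂)))).abs
  rw [sub_zero, sub_zero] at hlim
  refine le_of_tendsto hlim ?_
  obtain ⟨N, hN⟩ := exists_nat_ge (-s)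
  filter_upwards [Filter.eventually_ge_atTop N] with n hn
  have : (N : ℝ) ≤ n := by exact_mod_cast hn
  exact key _ (by linarith)

lemma gaussianReal_tail_le (v : ℝ≥0) {d : ℝ} (hv : v ≠ 0) (hd : 0 ≤ d) :
    (gaussianReal 0 v).real (Set.Iic (-d)) ≤ Real.exp (-(d ^ 2 / (2 * v))) ∧
      1 - (gaussianReal 0 v).real (Set.Iic d) ≤ Real.exp (-(d ^ 2 / (2 * v))) := by
  have hv0 : 0 < (v : ℝ) := by positivity
  have hint : ∀ t : ℝ, Integrable (fun ω => Real.exp (t * (id : ℝ → ℝ) ω)) (gaussianReal 0 v) :=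
    fun t => integrable_exp_mul_gaussianReal t
  have hmgf : ∀ t : ℝ, mgf id (gaussianReal 0 v) t = Real.exp (v * t ^ 2 / 2) := fun t => by
    rw [mgf_gaussianReal (by rw [Measure.map_id]) t, zero_mul, zero_add]
  constructor
  · have h := measure_le_le_exp_mul_mgf (μ := gaussianReal 0 v) (X := id) (t := -(d / v)) (-d)
      (by rw [neg_nonpos]; positivity) (hint _)
    rw [hmgf, ← Real.exp_add] at h
    refine h.trans (le_of_eq ?_)
    congr 1
    field_simp
    ring
  · have h := measure_ge_le_exp_mul_mgf (μ := gaussianReal 0 v) (X := id) (t := d / v) d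
      (by positivity) (hint _)
    rw [hmgf, ← Real.exp_add] at h
    rw [← probReal_compl_eq_one_sub measurableSet_Iic]
    refine (measureReal_mono (s₂ := {ω : ℝ | d ≤ id ω}) ?_).trans (h.trans (le_of_eq ?_))
    · intro x hx
      have : d < x := by simpa using hx
      exact this.le
    · congr 1
      field_simp
      ring

/-- Smoothing by a normal law changes a distribution function by at most the tail of the normal
law, up to a shift of the argument. -/
lemma measureReal_Iic_le_smoothedCDF (ν : Measure ℝ) [IsProbabilityMeasure ν] (hv : v ≠ 0) {d : ℝ}
    (hd : 0 ≤ d) (s : ℝ) :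
    ν.real (Set.Iic s) ≤ smoothedCDF v ν (s + d) + Real.exp (-(d ^ 2 / (2 * v))) ∧
      smoothedCDF v ν (s - d) ≤ ν.real (Set.Iic s) + Real.exp (-(d ^ 2 / (2 * v))) := by
  obtain ⟨h1, h2⟩ := gaussianReal_tail_le v hv hd
  set τ := Real.exp (-(d ^ 2 / (2 * v)))
  have hτ : 0 < τ := Real.exp_pos _
  have hind : ν.real (Set.Iic s) = ∫ x, (Set.Iic s).indicator 1 x ∂ν := by
    rw [integral_indicator_one measurableSet_Iic]
  have hindint : Integrable ((Set.Iic s).indicator (1 : ℝ → ℝ)) ν :=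
    (integrable_const (1 : ℝ)).indicator measurableSet_Iic
  have hτint : ∫ _, τ ∂ν = τ := by simp
  rw [hind]
  constructor
  · rw [smoothedCDF, ← hτint, ← integral_add (integrable_gaussianReal_Iic_sub v _ ν)
      (integrable_const _)]
    refine integral_mono hindint ((integrable_gaussianReal_Iic_sub v _ ν).add
      (integrable_const _)) fun x => ?_
    by_cases hx : x ∈ Set.Iic s
    · rw [Set.indicator_of_mem hx]
      have : (gaussianReal 0 v).real (Set.Iic d) ≤ (gaussianReal 0 v).real (Set.Iic (s + d - x)) :=
        measureReal_mono (Set.Iic_subset_Iic.2 (by have : x ≤ s := hx; linarith))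
      simp only [Pi.one_apply]
      linarith
    · rw [Set.indicator_of_notMem hx]
      positivity
  · rw [smoothedCDF, ← hτint, ← integral_add hindint (integrable_const _)]
    refine integral_mono (integrable_gaussianReal_Iic_sub v _ ν) (hindint.add
      (integrable_const _)) fun x => ?_
    by_cases hx : x ∈ Set.Iic s
    · rw [Set.indicator_of_mem hx]
      have : (gaussianReal 0 v).real (Set.Iic (s - d - x)) ≤ 1 := measureReal_le_one
      simp only [Pi.one_apply]
      linarith
    · rw [Set.indicator_of_notMem hx, zero_add]
      refine le_trans (measureReal_mono (Set.Iic_subset_Iic.2 ?_)) h1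
      have : s < x := not_le.1 hx
      linarith

/-- A smoothing inequality for the Kolmogorov distance. The smoothing kernel is the normal law of
variance `v`, so the characteristic functions may be compared on the whole line, at the price of
the shift `d`, which has to be large compared with the standard deviation `√v`. -/
theorem abs_measureReal_Iic_sub_le (hv : v ≠ 0) (ν₁ ν₂ : Measure ℝ) [IsProbabilityMeasure ν₁]
    [IsProbabilityMeasure ν₂] {B : ℝ → ℝ} (hB : Integrable B)
    (hBφ : ∀ t, ‖charFun ν₁ t - charFun ν₂ t‖ * Real.exp (-(v * t ^ 2 / 2)) ≤ |t| * B t)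
    {m d : ℝ} (hd : 0 ≤ d)
    (hm : ∀ s, ν₂.real (Set.Iic (s + 2 * d)) ≤ ν₂.real (Set.Iic s) + m * (2 * d)) (s : ℝ) :
    |ν₁.real (Set.Iic s) - ν₂.real (Set.Iic s)|
      ≤ Real.pi⁻¹ * (∫ t, B t) + 2 * m * d + 2 * Real.exp (-(d ^ 2 / (2 * v))) := by
  have a1 := (measureReal_Iic_le_smoothedCDF ν₁ hv hd s).1
  have a2 := (measureReal_Iic_le_smoothedCDF ν₁ hv hd s).2
  have b1 := (measureReal_Iic_le_smoothedCDF ν₂ hv hd (s + 2 * d)).2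
  have b2 := (measureReal_Iic_le_smoothedCDF ν₂ hv hd (s - 2 * d)).1
  rw [show s + 2 * d - d = s + d by ring] at b1
  rw [show s - 2 * d + d = s - d by ring] at b2
  have c1 := abs_le.1 (abs_smoothedCDF_sub_le hv ν₁ ν₂ hB hBφ (s + d))
  have c2 := abs_le.1 (abs_smoothedCDF_sub_le hv ν₁ ν₂ hB hBφ (s - d))
  have d1 := hm s
  have d2 := hm (s - 2 * d)
  rw [show s - 2 * d + 2 * d = s by ring] at d2
  rw [abs_le]
  constructor <;> linarith [c1.1, c1.2, c2.1, c2.2]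

lemma gaussianReal_Iic_add_le (hv : v ≠ 0) (s : ℝ) {e : ℝ} (he : 0 ≤ e) :
    (gaussianReal 0 v).real (Set.Iic (s + e))
      ≤ (gaussianReal 0 v).real (Set.Iic s) + (Real.sqrt (2 * Real.pi * v))⁻¹ * e := by
  have h := gaussianReal_Iic_sub_Iic hv (show s ≤ s + e by linarith) 0
  simp only [sub_zero] at h
  have h2 := norm_setIntegral_le_of_norm_le_const (μ := (volume : Measure ℝ))
    (s := Set.Ioc s (s + e)) (C := (Real.sqrt (2 * Real.pi * v))⁻¹)
    (f := fun u => gaussianPDFReal 0 v u) (by rw [Real.volume_Ioc]; exact ENNReal.ofReal_lt_top)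
    (fun u _ => by
      rw [Real.norm_of_nonneg (gaussianPDFReal_nonneg _ _ _)]
      exact gaussianPDFReal_le v _)
  rw [Real.volume_real_Ioc_of_le (by linarith), add_sub_cancel_left] at h2
  linarith [le_abs_self (∫ u in Set.Ioc s (s + e), gaussianPDFReal 0 v u), Real.norm_eq_abs
    (∫ u in Set.Ioc s (s + e), gaussianPDFReal 0 v u)]

end Smoothing

/-! ### Normal approximation -/

section NormalApproximation

open ProbabilityTheory
open scoped NNReal

lemma norm_exp_sub_exp_le {w u : ℂ} {e : ℝ} (h : ‖w - u‖ ≤ e) :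
    ‖Complex.exp w - Complex.exp u‖ ≤ ‖w - u‖ * Real.exp (u.re + e) := by
  have h1 := Complex.norm_exp_sub_sum_le_norm_mul_exp (w - u) 1
  simp only [Finset.sum_range_one, pow_zero, Nat.factorial_zero, Nat.cast_one, div_one,
    pow_one] at h1
  have e1 : Complex.exp w - Complex.exp u = Complex.exp u * (Complex.exp (w - u) - 1) := by
    rw [mul_sub, ← Complex.exp_add]; ring_nf
  rw [e1, norm_mul, Complex.norm_exp, Real.exp_add]
  calc Real.exp u.re * ‖Complex.exp (w - u) - 1‖
      ≤ Real.exp u.re * (‖w - u‖ * Real.exp e) := by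
        gcongr
        exact h1.trans (by gcongr)
    _ = _ := by ring

lemma charFun_map_div {X : Type*} [MeasurableSpace X] {ν : Measure X} {S : X → ℝ}
    (hS : AEMeasurable S ν) (q t : ℝ) :
    charFun (ν.map fun x => S x / q) t = complexMGF S ν ((t / q : ℝ) * Complex.I) := by
  rw [← complexMGF_mul_I (hS.div_const q)]
  simp only [complexMGF]
  congr 1
  ext x
  congr 1
  push_cast
  ring

/-- At frequencies `|t| ≤ c √n` the logarithm of the characteristic function of `S / √n` is close to
that of the normal law, and the difference is at most half of the Gaussian exponent. -/
lemma norm_sub_gaussianExponent_le {r a ε t : ℝ} {n : ℕ} {L : ℂ → ℂ} (hr : 0 < r) (ha : 0 < a)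
    (hn : 1 ≤ n) (hqε : 1 / Real.sqrt n ≤ 2 * ε) (hsmall : ε ≤ a / 4)
    (hL : DifferentiableOn ℂ L (Metric.ball 0 r)) (hL0 : L 0 = 0) (hL1 : iteratedDeriv 1 L 0 = 0)
    (hLn : ∀ z ∈ Metric.ball (0 : ℂ) r, ‖L z‖ ≤ n + 1)
    (hL2 : ‖iteratedDeriv 2 L 0 - a * n‖ ≤ ε * n)
    (ht : |t| ≤ min (r / 8) (a / (8 * (32 / r ^ 3))) * Real.sqrt n) :
    ‖L ((t / Real.sqrt n : ℝ) * Complex.I) - ((-(a * t ^ 2 / 2) : ℝ) : ℂ)‖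
        ≤ |t| * (ε * (|t| + 2 * (32 / r ^ 3) * t ^ 2)) ∧
      ‖L ((t / Real.sqrt n : ℝ) * Complex.I) - ((-(a * t ^ 2 / 2) : ℝ) : ℂ)‖ ≤ a * t ^ 2 / 4 := by
  have hn0 : (1 : ℝ) ≤ n := by exact_mod_cast hn
  have hnpos : (0 : ℝ) < n := by linarith
  set K : ℝ := 32 / r ^ 3 with hK
  have hK0 : 0 < K := by positivity
  set q := Real.sqrt n with hq
  have hq0 : 0 < q := Real.sqrt_pos.2 hnpos
  have hqq : q ^ 2 = n := Real.sq_sqrt hnpos.le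
  have hε0 : 0 ≤ ε := by
    have : 0 < 1 / q := by positivity
    linarith
  set z : ℂ := (t / q : ℝ) * Complex.I with hz
  set u : ℂ := ((-(a * t ^ 2 / 2) : ℝ) : ℂ) with hu
  have hznorm : ‖z‖ = |t| / q := by
    rw [hz, norm_mul, Complex.norm_I, mul_one, Complex.norm_real, Real.norm_eq_abs, abs_div,
      abs_of_pos hq0]
  have hz8 : ‖z‖ ≤ r / 8 := by
    rw [hznorm, div_le_iff₀ hq0]
    exact ht.trans (by gcongr; exact min_le_left _ _)
  have htay := norm_sub_taylor_le hr hL hLn 3 (z := z) (by linarith)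
  simp only [Finset.sum_range_succ, Finset.sum_range_zero, iteratedDeriv_zero, hL0, hL1,
    Nat.factorial] at htay
  have hz2 : z ^ 2 = -(t ^ 2 / n : ℝ) := by
    rw [hz, mul_pow, Complex.I_sq, ← Complex.ofReal_pow, div_pow, hqq]; push_cast; ring
  have h1 : ‖L z - u‖ ≤ 2 * (n + 1) * (2 * ‖z‖ / r) ^ 3 + ε * t ^ 2 / 2 := by
    have e : L z - u = (L z - (0 + ((0 : ℕ) + 1 : ℂ)⁻¹ * (z ^ 0 * 0)
        + (2 : ℂ)⁻¹ * (z ^ 2 * iteratedDeriv 2 L 0)))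
        + (-(t ^ 2 / (2 * n) : ℝ) : ℂ) * (iteratedDeriv 2 L 0 - a * n) := by
      rw [hz2, hu]
      have : (n : ℂ) ≠ 0 := by exact_mod_cast hnpos.ne'
      push_cast
      field_simp
      ring
    rw [e]
    refine (norm_add_le _ _).trans (add_le_add ?_ ?_)
    · refine le_trans (le_of_eq ?_) htay
      congr 1
      push_cast
      ring
    · rw [norm_mul, norm_neg, Complex.norm_real, Real.norm_of_nonneg (by positivity)]
      calc t ^ 2 / (2 * n) * ‖iteratedDeriv 2 L 0 - a * n‖
          ≤ t ^ 2 / (2 * n) * (ε * n) := by gcongr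
        _ = ε * t ^ 2 / 2 := by field_simp
  have h2 : 2 * (n + 1) * (2 * ‖z‖ / r) ^ 3 ≤ K * |t| ^ 3 / q := by
    calc 2 * ((n : ℝ) + 1) * (2 * ‖z‖ / r) ^ 3 ≤ 2 * (2 * n) * (2 * ‖z‖ / r) ^ 3 := by
          gcongr; linarith
      _ = K * |t| ^ 3 / q := by
          rw [hznorm, hK, ← hqq]; field_simp; norm_num; ring
  have h3 : |t| ^ 2 = t ^ 2 := sq_abs t
  constructor
  · calc ‖L z - u‖ ≤ K * |t| ^ 3 / q + ε * t ^ 2 / 2 := h1.trans (by linarith)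
      _ = K * |t| ^ 3 * (1 / q) + ε * |t| ^ 2 / 2 := by rw [h3]; ring
      _ ≤ K * |t| ^ 3 * (2 * ε) + ε * |t| ^ 2 := by
          have : 0 ≤ ε * |t| ^ 2 := by positivity
          gcongr
          linarith
      _ = _ := by rw [← h3]; ring
  · have h4 : K * |t| ^ 3 / q ≤ a * t ^ 2 / 8 := by
      rw [div_le_iff₀ hq0]
      calc K * |t| ^ 3 = K * t ^ 2 * |t| := by rw [← h3]; ring
        _ ≤ K * t ^ 2 * (a / (8 * K) * q) := by
            have : min (r / 8) (a / (8 * K)) ≤ a / (8 * K) := min_le_right _ _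
            gcongr
            exact ht.trans (by gcongr)
        _ = _ := by field_simp
    have h5 : ε * t ^ 2 / 2 ≤ a * t ^ 2 / 8 := by
      have := mul_le_mul_of_nonneg_right hsmall (sq_nonneg t)
      linarith
    linarith

/-- The smoothing factor of variance `2 log n / (c² n)` is `O(n ^ (-1/2))` beyond `c √n`. -/
lemma exp_neg_mul_sq_le_inv_sqrt_mul {c t v : ℝ} {n : ℕ} (hc0 : 0 < c) (hn : 2 ≤ n)
    (hvr : v = 2 * Real.log n / (c ^ 2 * n)) (ht : c * Real.sqrt n ≤ |t|) :
    Real.exp (-(v * t ^ 2 / 2)) ≤ 1 / Real.sqrt n * Real.exp (-(v / 4) * t ^ 2) := by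
  have hn0 : (2 : ℝ) ≤ n := by exact_mod_cast hn
  have hnpos : (0 : ℝ) < n := by linarith
  have hq0 : 0 < Real.sqrt n := Real.sqrt_pos.2 hnpos
  have hqq : Real.sqrt n ^ 2 = n := Real.sq_sqrt hnpos.le
  have hlog0 : 0 < Real.log n := Real.log_pos (by linarith)
  have hv0 : 0 < v := by rw [hvr]; positivity
  have e1 : 1 / Real.sqrt n = Real.exp (-(Real.log n / 2)) := by
    rw [Real.exp_neg, ← Real.log_sqrt hnpos.le, Real.exp_log hq0, one_div]
  rw [e1, ← Real.exp_add, Real.exp_le_exp]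
  have h4 : (c * Real.sqrt n) ^ 2 ≤ t ^ 2 := by
    rw [← sq_abs t]; gcongr
  have h5 : Real.log n / 2 = v / 4 * (c * Real.sqrt n) ^ 2 := by
    rw [hvr, mul_pow, hqq]; field_simp; norm_num
  have h6 : v / 4 * (c * Real.sqrt n) ^ 2 ≤ v / 4 * t ^ 2 := by gcongr
  linarith

lemma integral_highFrequency_le {c v : ℝ} {n : ℕ} (hc0 : 0 < c) (hn : 2 ≤ n)
    (hlog : 1 / 2 ≤ Real.log n) (hvr : v = 2 * Real.log n / (c ^ 2 * n)) :
    ∫ t : ℝ, 2 / (c * n) * Real.exp (-(v / 4) * t ^ 2)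
      ≤ 4 * Real.sqrt (2 * Real.pi) * (1 / Real.sqrt n) := by
  have hn0 : (2 : ℝ) ≤ n := by exact_mod_cast hn
  have hnpos : (0 : ℝ) < n := by linarith
  set q := Real.sqrt n with hq
  have hq0 : 0 < q := Real.sqrt_pos.2 hnpos
  have hqq : q ^ 2 = n := Real.sq_sqrt hnpos.le
  have hlog0 : 0 < Real.log n := by linarith
  rw [integral_const_mul, integral_gaussian]
  have e1 : Real.pi / (v / 4) = 2 * Real.pi * (c ^ 2 * q ^ 2 / Real.log n) := by
    rw [hvr, hqq]; field_simp; ring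
  have e2 : Real.sqrt (c ^ 2 * q ^ 2 / Real.log n) ≤ 2 * (c * q) := by
    rw [Real.sqrt_le_left (by positivity), div_le_iff₀ hlog0]
    nlinarith [sq_nonneg (c * q)]
  rw [e1, Real.sqrt_mul (by positivity)]
  calc 2 / (c * n) * (Real.sqrt (2 * Real.pi) * Real.sqrt (c ^ 2 * q ^ 2 / Real.log n))
      ≤ 2 / (c * n) * (Real.sqrt (2 * Real.pi) * (2 * (c * q))) := by gcongr
    _ = 4 * Real.sqrt (2 * Real.pi) * (1 / q) := by rw [← hqq]; field_simp; norm_num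

set_option maxHeartbeats 1000000 in
/-- If the logarithm `L` of the moment generating function of `S` is of size `O(n)` on a fixed disc
and has second derivative `a n` at `0` up to an error `ε n`, then `S / √n` is normal with variance
`a` up to `O(ε)` in the Kolmogorov distance. The law is smoothed by a normal law of variance of
order `log n / n`; then the frequencies beyond `c √n`, where `L` is not controlled, contribute
`O(n ^ (-1/2))`. -/
lemma exists_kolmogorov_bound {X : Type*} [MeasurableSpace X] {r a : ℝ} (hr : 0 < r) (ha : 0 < a) :
    ∃ C : ℝ, 0 ≤ C ∧ ∀ (ν : Measure X) [IsProbabilityMeasure ν] (S : X → ℝ) (n : ℕ) (ε : ℝ)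
      (L : ℂ → ℂ), AEMeasurable S ν → 2 ≤ n → Real.log n / Real.sqrt n ≤ ε →
      DifferentiableOn ℂ L (Metric.ball 0 r) → L 0 = 0 → iteratedDeriv 1 L 0 = 0 →
      (∀ z ∈ Metric.ball (0 : ℂ) r, ‖L z‖ ≤ n + 1 ∧ complexMGF S ν z = Complex.exp (L z)) →
      ‖iteratedDeriv 2 L 0 - a * n‖ ≤ ε * n → ∀ s : ℝ,
      |ν.real {x | S x ≤ s * Real.sqrt n} - (gaussianReal 0 a.toNNReal).real (Set.Iic s)|
        ≤ C * ε := by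
  set K : ℝ := 32 / r ^ 3 with hK
  have hK0 : 0 < K := by positivity
  -- Taylor's formula needs frequencies up to `√n r / 8`; up to `√n a / (8 K)` its remainder is at
  -- most a quarter of the Gaussian exponent
  set c : ℝ := min (r / 8) (a / (8 * K)) with hc
  have hc0 : 0 < c := by positivity
  -- the shift `d = α log n / √n` makes the tail of the smoothing law equal to `1 / √n`
  set α : ℝ := Real.sqrt 2 / c with hα
  have hα0 : 0 < α := by positivity
  set b₁ : ℝ → ℝ := fun t => (1 + (1 + 2 * K) * t ^ 2) * Real.exp (-(a / 4) * t ^ 2) with hb₁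
  have hb₁int : Integrable b₁ := by
    have h1 := integrable_exp_neg_mul_sq (b := a / 4) (by positivity)
    have h2 := integrable_rpow_mul_exp_neg_mul_sq (b := a / 4) (by positivity) (s := 2)
      (by norm_num)
    refine (h1.add (h2.const_mul (1 + 2 * K))).congr (Filter.Eventually.of_forall fun t => ?_)
    simp only [Pi.add_apply, Real.rpow_two, hb₁]
    ring
  have hJ : 0 ≤ ∫ t, b₁ t := integral_nonneg fun t => by
    simp only [hb₁, Pi.zero_apply]; positivity
  set m : ℝ := (Real.sqrt (2 * Real.pi * a))⁻¹ with hm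
  refine ⟨4 / a + (Real.pi⁻¹ * ((∫ t, b₁ t) + 8 * Real.sqrt (2 * Real.pi)) + 2 * m * α + 4),
    by positivity, fun ν _ S n ε L hS hn hε hL hL0 hL1 hLG hL2 s => ?_⟩
  have hn0 : (2 : ℝ) ≤ n := by exact_mod_cast hn
  have hnpos : (0 : ℝ) < n := by linarith
  have hlog : 1 / 2 ≤ Real.log n := by
    have h1 := Real.log_le_log two_pos hn0
    linarith [Real.log_two_gt_d9]
  have hlog0 : 0 < Real.log n := by linarith
  set q := Real.sqrt n with hq
  have hq0 : 0 < q := Real.sqrt_pos.2 hnpos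
  have hqq : q ^ 2 = n := Real.sq_sqrt hnpos.le
  have hqε : 1 / q ≤ 2 * ε := by
    calc 1 / q ≤ 2 * Real.log n / q := by gcongr; linarith
      _ = 2 * (Real.log n / q) := by ring
      _ ≤ 2 * ε := by gcongr
  have hε0 : 0 ≤ ε := by
    have : 0 < 1 / q := by positivity
    linarith
  have hrest : 0 ≤ Real.pi⁻¹ * ((∫ t, b₁ t) + 8 * Real.sqrt (2 * Real.pi)) + 2 * m * α + 4 := by
    positivity
  -- the bound is trivial unless `ε` is small
  rcases lt_or_ge (a / 4) ε with hbig | hsmall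
  · have h1 : ν.real {x | S x ≤ s * q} ≤ 1 := measureReal_le_one
    have h2 : (gaussianReal 0 a.toNNReal).real (Set.Iic s) ≤ 1 := measureReal_le_one
    have h3 : 0 ≤ ν.real {x | S x ≤ s * q} := measureReal_nonneg
    have h4 : 0 ≤ (gaussianReal 0 a.toNNReal).real (Set.Iic s) := measureReal_nonneg
    have h5 : 1 ≤ 4 / a * ε := by
      rw [div_mul_eq_mul_div, le_div_iff₀ ha]; linarith
    have h6 := mul_nonneg hrest hε0
    rw [add_mul, abs_le]
    constructor <;> linarith
  set v : ℝ≥0 := (2 * Real.log n / (c ^ 2 * n)).toNNReal with hv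
  have hvpos : 0 < 2 * Real.log n / (c ^ 2 * n) := by positivity
  have hvr : (v : ℝ) = 2 * Real.log n / (c ^ 2 * n) := Real.coe_toNNReal _ hvpos.le
  have hv0 : v ≠ 0 := by
    rw [hv]; simpa using hvpos
  have hvr0 : 0 < (v : ℝ) := by rw [hvr]; exact hvpos
  have ha0 : a.toNNReal ≠ 0 := by simpa using ha
  have har : (a.toNNReal : ℝ) = a := Real.coe_toNNReal _ ha.le
  set ν₁ : Measure ℝ := ν.map fun x => S x / q with hν₁
  have hmeas : AEMeasurable (fun x => S x / q) ν := hS.div_const q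
  have : IsProbabilityMeasure ν₁ := Measure.isProbabilityMeasure_map hmeas
  have hlaw : ν.real {x | S x ≤ s * q} = ν₁.real (Set.Iic s) := by
    rw [hν₁, measureReal_def, measureReal_def, Measure.map_apply_of_aemeasurable hmeas
      measurableSet_Iic]
    congr 2
    ext x
    exact (div_le_iff₀ hq0).symm
  set b₂ : ℝ → ℝ := fun t => 2 / (c * n) * Real.exp (-(v / 4) * t ^ 2) with hb₂
  have hb₂int : Integrable b₂ :=
    (integrable_exp_neg_mul_sq (b := (v : ℝ) / 4) (by positivity)).const_mul _
  have hb₂val : ∫ t, b₂ t ≤ 8 * Real.sqrt (2 * Real.pi) * ε := by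
    calc ∫ t, b₂ t ≤ 4 * Real.sqrt (2 * Real.pi) * (1 / q) :=
          integral_highFrequency_le hc0 hn hlog hvr
      _ ≤ 4 * Real.sqrt (2 * Real.pi) * (2 * ε) := by gcongr
      _ = _ := by ring
  have hφ : ∀ t, ‖charFun ν₁ t - charFun (gaussianReal 0 a.toNNReal) t‖
      * Real.exp (-(v * t ^ 2 / 2)) ≤ |t| * (ε * b₁ t + b₂ t) := by
    intro t
    have hb₁0 : 0 ≤ ε * b₁ t := mul_nonneg hε0 (by simp only [hb₁]; positivity)
    have hb₂0 : 0 ≤ b₂ t := by simp only [hb₂]; positivity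
    rcases le_or_gt |t| (c * q) with ht | ht
    · set z : ℂ := (t / q : ℝ) * Complex.I with hz
      have hznorm : ‖z‖ = |t| / q := by
        rw [hz, norm_mul, Complex.norm_I, mul_one, Complex.norm_real, Real.norm_eq_abs, abs_div,
          abs_of_pos hq0]
      have hzc : ‖z‖ ≤ c := by rw [hznorm, div_le_iff₀ hq0]; exact ht
      have hz8 : ‖z‖ ≤ r / 8 := hzc.trans (min_le_left _ _)
      have hzr : z ∈ Metric.ball (0 : ℂ) r := by rw [mem_ball_zero_iff]; linarith
      set u : ℂ := ((-(a * t ^ 2 / 2) : ℝ) : ℂ) with hu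
      have hg : charFun (gaussianReal 0 a.toNNReal) t = Complex.exp u := by
        rw [charFun_gaussianReal, hu]
        congr 1
        have : ((a.toNNReal : ℝ) : ℂ) = a := by rw [har]
        rw [this]
        push_cast
        ring
      have hlin := norm_sub_gaussianExponent_le hr ha (by omega) hqε hsmall hL hL0 hL1
        (fun w hw => (hLG w hw).1) hL2 ht
      have hexp := norm_exp_sub_exp_le hlin.2
      have hure : u.re + a * t ^ 2 / 4 = -(a / 4) * t ^ 2 := by
        rw [hu, Complex.ofReal_re]; ring
      rw [hure] at hexp
      rw [charFun_map_div hS, ← hz, (hLG z hzr).2, hg]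
      have hle1 : Real.exp (-(v * t ^ 2 / 2)) ≤ 1 := by
        rw [Real.exp_le_one_iff]
        have : 0 ≤ (v : ℝ) * t ^ 2 / 2 := by positivity
        linarith
      calc ‖Complex.exp (L z) - Complex.exp u‖ * Real.exp (-(v * t ^ 2 / 2))
          ≤ ‖Complex.exp (L z) - Complex.exp u‖ := mul_le_of_le_one_right (norm_nonneg _) hle1
        _ ≤ |t| * (ε * (|t| + 2 * K * t ^ 2)) * Real.exp (-(a / 4) * t ^ 2) :=
            hexp.trans (by gcongr; exact hlin.1)
        _ ≤ |t| * (ε * (1 + (1 + 2 * K) * t ^ 2)) * Real.exp (-(a / 4) * t ^ 2) := by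
            have h1 : |t| + 2 * K * t ^ 2 ≤ 1 + (1 + 2 * K) * t ^ 2 := by
              nlinarith [sq_abs t, sq_nonneg (|t| - 1), abs_nonneg t]
            exact mul_le_mul_of_nonneg_right (mul_le_mul_of_nonneg_left
              (mul_le_mul_of_nonneg_left h1 hε0) (abs_nonneg t)) (Real.exp_nonneg _)
        _ = |t| * (ε * b₁ t) := by simp only [hb₁]; ring
        _ ≤ _ := by gcongr; linarith
    · have h2 : ‖charFun ν₁ t - charFun (gaussianReal 0 a.toNNReal) t‖ ≤ 2 := by
        refine (norm_sub_le _ _).trans ?_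
        linarith [norm_charFun_le_one (μ := ν₁) t,
          norm_charFun_le_one (μ := gaussianReal 0 a.toNNReal) t]
      have h3 := exp_neg_mul_sq_le_inv_sqrt_mul hc0 hn hvr ht.le
      have h4 : 2 * (1 / q) ≤ |t| * (2 / (c * n)) := by
        calc 2 * (1 / q) = (c * q) * (2 / (c * n)) := by rw [← hqq]; field_simp
          _ ≤ _ := by gcongr
      calc _ ≤ 2 * (1 / q * Real.exp (-(v / 4) * t ^ 2)) := by gcongr
        _ = 2 * (1 / q) * Real.exp (-(v / 4) * t ^ 2) := by ring
        _ ≤ |t| * (2 / (c * n)) * Real.exp (-(v / 4) * t ^ 2) := by gcongr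
        _ = |t| * b₂ t := by simp only [hb₂]; ring
        _ ≤ _ := by gcongr; linarith
  set d : ℝ := α * (Real.log n / q) with hd
  have hd0 : 0 ≤ d := by positivity
  have hfin := abs_measureReal_Iic_sub_le hv0 ν₁ (gaussianReal 0 a.toNNReal)
    ((hb₁int.const_mul ε).add hb₂int) hφ hd0 (m := m) (fun s => by
      have := gaussianReal_Iic_add_le ha0 s (e := 2 * d) (by positivity)
      rwa [har] at this) s
  rw [hlaw]
  have hexp : Real.exp (-(d ^ 2 / (2 * v))) = 1 / q := by
    have : d ^ 2 / (2 * v) = Real.log n / 2 := by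
      rw [hd, hvr, hα, mul_pow, div_pow, div_pow, Real.sq_sqrt (by norm_num), hqq]
      field_simp
    rw [this, Real.exp_neg, ← Real.log_sqrt hnpos.le, Real.exp_log hq0, one_div]
  have hint : ∫ t, ((fun x => ε * b₁ x) + b₂) t
      ≤ ε * (∫ t, b₁ t) + 8 * Real.sqrt (2 * Real.pi) * ε := by
    rw [integral_add' (hb₁int.const_mul ε) hb₂int, integral_const_mul]
    gcongr
  refine hfin.trans ?_
  rw [hexp]
  have hdε : d ≤ α * ε := by rw [hd]; gcongr
  have hm0 : 0 ≤ m := by positivity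
  have h4a : 0 ≤ 4 / a * ε := by positivity
  calc _ ≤ Real.pi⁻¹ * (ε * (∫ t, b₁ t) + 8 * Real.sqrt (2 * Real.pi) * ε) + 2 * m * (α * ε)
        + 2 * (2 * ε) := by gcongr
    _ ≤ 4 / a * ε + (Real.pi⁻¹ * (ε * (∫ t, b₁ t) + 8 * Real.sqrt (2 * Real.pi) * ε)
        + 2 * m * (α * ε) + 2 * (2 * ε)) := by linarith
    _ = _ := by ring

/-- The distribution function of the normal law in terms of its density. -/
lemma gaussianReal_Iic_eq {a : ℝ} (ha : 0 < a) (s : ℝ) :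
    (gaussianReal 0 a.toNNReal).real (Set.Iic s)
      = 1 / Real.sqrt (2 * Real.pi * a) * ∫ t in Set.Iic s, Real.exp (-(t ^ 2) / (2 * a)) := by
  have ha0 : a.toNNReal ≠ 0 := by simpa using ha
  rw [measureReal_def, gaussianReal_apply_eq_integral 0 ha0, ENNReal.toReal_ofReal
    (integral_nonneg fun u => gaussianPDFReal_nonneg 0 _ u), ← integral_const_mul]
  congr 1
  ext t
  rw [gaussianPDFReal, Real.coe_toNNReal _ ha.le, sub_zero, one_div]

/-- The moments and the derivatives at `0` of the logarithm of the moment generating function. -/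
lemma isMomentSequence_of_complexMGF_eq_exp {X : Type*} [MeasurableSpace X] {ν : Measure X}
    [IsProbabilityMeasure ν] {S : X → ℝ} {r : ℝ} (hr : 0 < r) {L : ℂ → ℂ} {n : ℕ} (hn : 1 ≤ n)
    (hS : ∀ z : ℂ, Integrable (fun x => Complex.exp (z * (S x : ℂ))) ν) (hmean : ∫ x, S x ∂ν = 0)
    (hL : DifferentiableOn ℂ L (Metric.ball 0 r))
    (hLG : ∀ z ∈ Metric.ball (0 : ℂ) r, ‖L z‖ ≤ n + 1 ∧ complexMGF S ν z = Complex.exp (L z)) :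
    IsMomentSequence (fun j => j.factorial * 2 * (2 / r) ^ j) n
      (fun j => iteratedDeriv j L 0)
      (fun k => ((∫ x, S x ^ k ∂ν : ℝ) : ℂ)) := by
  have hn1 : (1 : ℝ) ≤ n := by exact_mod_cast hn
  have hrec : ∀ k : ℕ, ((∫ x, S x ^ (k + 1) ∂ν : ℝ) : ℂ) = ∑ i ∈ Finset.range (k + 1),
      (k.choose i : ℂ) * iteratedDeriv (i + 1) L 0 * ((∫ x, S x ^ (k - i) ∂ν : ℝ) : ℂ) := by
    intro k
    rw [← iteratedDeriv_complexMGF_zero hS, iteratedDeriv_succ_of_eq_exp hr hL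
      fun z hz => (hLG z hz).2]
    simp only [iteratedDeriv_complexMGF_zero hS]
  refine ⟨hn1, by simp, hrec, ?_, fun j => ?_⟩
  · have h0 := hrec 0
    rw [zero_add, Finset.sum_range_one] at h0
    simpa [hmean] using h0.symm
  · calc ‖iteratedDeriv j L 0‖ ≤ j.factorial * (n + 1) * (2 / r) ^ j :=
          norm_iteratedDeriv_zero_le hr hL (fun z hz => (hLG z hz).1) j
      _ ≤ j.factorial * (2 * n) * (2 / r) ^ j := by gcongr; linarith
      _ = _ := by ring

end NormalApproximation

/-! ### Asymptotics of the cumulants and conclusion -/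

section Conclusion

open ProbabilityTheory

/-- In a moment sequence of real numbers the second and third cumulants are real. -/
lemma IsMomentSequence.ofReal_re_cumulant {c : ℕ → ℝ} {N : ℝ} {κ : ℕ → ℂ} {m : ℕ → ℝ}
    (h : IsMomentSequence c N κ fun k => (m k : ℂ)) :
    (((κ 2).re : ℝ) : ℂ) = κ 2 ∧ (((κ 3).re : ℝ) : ℂ) = κ 3 := by
  have h0 : ((m 0 : ℝ) : ℂ) = 1 := h.zero
  have h1 : ((m 1 : ℝ) : ℂ) = 0 := by rw [h.succ 0]; simp [h.cumulant_one]
  have h2 : ((m 2 : ℝ) : ℂ) = κ 2 := by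
    rw [h.succ 1]; simp [Finset.sum_range_succ, h.cumulant_one, h0]
  have h3 : ((m 3 : ℝ) : ℂ) = κ 3 := by
    rw [h.succ 2]; simp [Finset.sum_range_succ, h.cumulant_one, h0, h1]
  rw [← h2, ← h3]
  simp

lemma half_le_sqrt_mul_log {n : ℕ} (hn : 2 ≤ n) : 1 / 2 ≤ Real.sqrt n * Real.log n := by
  have hn0 : (2 : ℝ) ≤ n := by exact_mod_cast hn
  have h1 := Real.log_le_log two_pos hn0
  have h2 : 1 ≤ Real.sqrt n := Real.one_le_sqrt.2 (by linarith)
  nlinarith [Real.log_two_gt_d9]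

/-- A real cumulant that is a Birkhoff sum up to a bounded error satisfies the same law of large
numbers as the real part of the Birkhoff sum. -/
lemma norm_cumulant_sub_le {κ : ℂ} (hκ : ((κ.re : ℝ) : ℂ) = κ) {a T B : ℝ} {n : ℕ} (hn : 2 ≤ n)
    {f : ℕ → ℂ} (hB : ‖κ - ∑ j ∈ Finset.range n, f j‖ ≤ B)
    (hT : |∑ j ∈ Finset.range n, (f j).re - n * a| ≤ T * (Real.sqrt n * Real.log n)) :
    ‖κ - a * n‖ ≤ (|T| + 2 * B) * (Real.sqrt n * Real.log n) := by
  have hB0 : 0 ≤ B := (norm_nonneg _).trans hB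
  have h1 := half_le_sqrt_mul_log hn
  have h2 : |κ.re - ∑ j ∈ Finset.range n, (f j).re| ≤ B := by
    refine le_trans ?_ hB
    rw [← Complex.re_sum, ← Complex.sub_re]
    exact Complex.abs_re_le_norm _
  have h3 : κ - a * n = ((κ.re - n * a : ℝ) : ℂ) := by
    rw [Complex.ofReal_sub, hκ]; push_cast; ring
  have h4 : T * (Real.sqrt n * Real.log n) ≤ |T| * (Real.sqrt n * Real.log n) :=
    mul_le_mul_of_nonneg_right (le_abs_self T) (by linarith)
  have h5 : B ≤ 2 * B * (Real.sqrt n * Real.log n) := by nlinarith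
  have h6 := abs_sub_le κ.re (∑ j ∈ Finset.range n, (f j).re) (n * a)
  rw [h3, Complex.norm_real, Real.norm_eq_abs]
  linarith

variable {Y X : Type*} [MeasurableSpace Y] [MetricSpace X] [CompactSpace X] [MeasurableSpace X]
  [BorelSpace X] {P : Measure (ℤ → Y)} [IsProbabilityMeasure P]

/-- The derivatives at `0` of order two and three of `log λ_ω` satisfy a law of large numbers with
rate. -/
lemma exists_birkhoff_bound_log_eigenvalue (hstat : MeasurePreserving shift P P)
    (hphi : Summable fun n : ℕ => phiMixing P (n + 1)) {E : (ℤ → Y) → Set X}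
    {H : (ℤ → Y) → Type*} [∀ ω, NormedAddCommGroup (H ω)] [∀ ω, NormedSpace ℂ (H ω)]
    {F : ∀ ω, FunctionSpace (H ω) (E ω)} {A : ℂ → ∀ ω, H ω →L[ℂ] H (shift ω)}
    {μ : (ℤ → Y) → Measure X} {S : ℕ → (ℤ → Y) → X → ℝ}
    (hmodel : IsOperatorModel P shift E H F A μ S) (hzero : DependsOnZerothCoordinate P E H F A)
    {r C δ : ℝ} {lam : (ℤ → Y) → ℂ → ℂ} {h : ∀ ω, ℂ → H ω} (hr : 0 < r) (hC : 0 < C)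
    (hδ0 : 0 < δ) (hδ1 : δ < 1)
    (hgood : ∀ᵐ ω ∂P, DifferentiableOn ℂ (lam ω) (Metric.ball 0 r) ∧ lam ω 0 = 1 ∧
      ∀ z ∈ Metric.ball (0 : ℂ) r, ‖lam ω z - 1‖ ≤ 1 / 4 ∧ ‖h ω z - (F ω).one‖ ≤ 1 / 4 ∧
        ∀ n : ℕ, 1 ≤ n →
          ‖(∏ j ∈ Finset.range n, lam (shift^[j] ω) z)⁻¹ • iter A z n ω (F ω).one
            - h (shift^[n] ω) z‖ ≤ C * δ ^ n) :
    ∃ (a b : ℝ) (T₂ T₃ : (ℤ → Y) → ℝ), Measurable T₂ ∧ Measurable T₃ ∧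
      ∀ᵐ ω ∂P, ∀ n : ℕ, 2 ≤ n →
        |∑ j ∈ Finset.range n, (iteratedDeriv 2 (fun z => Complex.log (lam (shift^[j] ω) z)) 0).re
          - n * a| ≤ T₂ ω * (Real.sqrt n * Real.log n) ∧
        |∑ j ∈ Finset.range n, (iteratedDeriv 3 (fun z => Complex.log (lam (shift^[j] ω) z)) 0).re
          - n * b| ≤ T₃ ω * (Real.sqrt n * Real.log n) := by
  obtain ⟨E₀, hE₀, hE⟩ := hzero.fiber
  obtain ⟨κ, hκ, hκE⟩ := exists_markovKernel_ae_mem (P := P) (π := fun ω : ℤ → Y => ω 0)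
    (measurable_pi_apply 0) hmodel.aemeasurable_measure hmodel.isProbabilityMeasure hE₀ (by
      filter_upwards [hE] with ω hω
      rw [← hω]
      exact hmodel.fiber_compl ω)
  have hκE' : ∀ᵐ ω ∂P, ∀ᵐ x ∂(κ (ω 0)), x ∈ E ω := by
    filter_upwards [hE, hκE] with ω hω h
    rwa [hω]
  obtain ⟨K, η, hη0, hη1, h2, h3⟩ := exists_isExpApproximable_iteratedDeriv (P := P)
    (ℓ := fun ω z => Complex.log (lam ω z)) (K := 2 * ((8 * C + 1) / δ)) hr hδ0 hδ1 (by positivity)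
    (by
      filter_upwards [hgood] with ω hω
      refine ⟨differentiableOn_log_comp hω.1 fun z hz => (hω.2.2 z hz).1.trans (by norm_num),
        by simp [hω.2.1], fun z hz => norm_log_le_one ((hω.2.2 z hz).1.trans (by norm_num))⟩)
    fun z hz m => exists_log_approx hstat hzero hκE' hC hδ0 hδ1 (hgood.mono fun ω hω => hω.2.2) hz m
  obtain ⟨T₂, hT₂, hb₂⟩ := h2.exists_measurable_birkhoff_bound hstat hphi hη0 hη1
  obtain ⟨T₃, hT₃, hb₃⟩ := h3.exists_measurable_birkhoff_bound hstat hphi hη0 hη1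
  refine ⟨∫ ω, (iteratedDeriv 2 (fun z => Complex.log (lam ω z)) 0).re ∂P,
    ∫ ω, (iteratedDeriv 3 (fun z => Complex.log (lam ω z)) 0).re ∂P, T₂, T₃, hT₂, hT₃, ?_⟩
  filter_upwards [hb₂, hb₃] with ω h₂ h₃ n hn
  exact ⟨h₂ n hn, h₃ n hn⟩

/-- The logarithm `L` of the moment generating function of `S_n` exists on a deterministic disc, is
of size `O(n)` there, and its second and third derivatives at `0` are `a n` and `b n` up to
errors `O(√n log n)`. -/
lemma exists_log_mgf_cumulant_le (hstat : MeasurePreserving shift P P)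
    (hphi : Summable fun n : ℕ => phiMixing P (n + 1)) {E : (ℤ → Y) → Set X}
    {H : (ℤ → Y) → Type*} [∀ ω, NormedAddCommGroup (H ω)] [∀ ω, NormedSpace ℂ (H ω)]
    {F : ∀ ω, FunctionSpace (H ω) (E ω)} {A : ℂ → ∀ ω, H ω →L[ℂ] H (shift ω)}
    {μ : (ℤ → Y) → Measure X} {S : ℕ → (ℤ → Y) → X → ℝ}
    (hmodel : IsOperatorModel P shift E H F A μ S) (hRPF : RPFAssumption P shift E H F A μ)
    (hzero : DependsOnZerothCoordinate P E H F A) :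
    ∃ (a b r : ℝ) (c : ℕ → ℝ) (T : (ℤ → Y) → ℝ), 0 < r ∧ (∀ j, 0 ≤ c j) ∧ Measurable T ∧
      ∀ᵐ ω ∂P, 1 ≤ T ω ∧ ∀ n : ℕ, 2 ≤ n → ∃ L : ℂ → ℂ,
        DifferentiableOn ℂ L (Metric.ball 0 r) ∧ L 0 = 0 ∧
        (∀ z ∈ Metric.ball (0 : ℂ) r, ‖L z‖ ≤ n + 1 ∧
          complexMGF (S n ω) (μ ω) z = Complex.exp (L z)) ∧
        IsMomentSequence c n (fun j => iteratedDeriv j L 0)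
          (fun k => ((∫ x, S n ω x ^ k ∂(μ ω) : ℝ) : ℂ)) ∧
        1 ≤ T ω * (Real.log n / Real.sqrt n) * n ∧
        ‖iteratedDeriv 2 L 0 - a * n‖ ≤ T ω * (Real.log n / Real.sqrt n) * n ∧
        ‖iteratedDeriv 3 L 0 - b * n‖ ≤ T ω * (Real.log n / Real.sqrt n) * n := by
  obtain ⟨r₀, C, δ, lam, h, hr₀, hC, hδ0, hδ1, hgood⟩ := exists_uniform_disc hRPF
  obtain ⟨a, b, T₂, T₃, hT₂, hT₃, hb⟩ := exists_birkhoff_bound_log_eigenvalue hstat hphi hmodel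
    hzero hr₀ hC hδ0 hδ1 hgood
  obtain ⟨r, hr, hL⟩ := exists_log_mgf hstat hmodel hr₀ hC hδ0 hδ1 hgood
  set B₂ : ℝ := Nat.factorial 2 * (2 / r) ^ 2 with hB₂
  set B₃ : ℝ := Nat.factorial 3 * (2 / r) ^ 3 with hB₃
  have hB₂0 : 0 ≤ B₂ := by positivity
  have hB₃0 : 0 ≤ B₃ := by positivity
  refine ⟨a, b, r, fun j => j.factorial * 2 * (2 / r) ^ j,
    fun ω => 2 + (|T₂ ω| + 2 * B₂) + (|T₃ ω| + 2 * B₃), hr, fun j => by positivity,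
    by fun_prop, ?_⟩
  filter_upwards [hb, hL, hmodel.centered, hmodel.mgf_eq] with ω hb hL hcent hmgf
  have h2 := abs_nonneg (T₂ ω)
  have h3 := abs_nonneg (T₃ ω)
  refine ⟨by linarith, fun n hn => ?_⟩
  obtain ⟨L, hLd, hL0, hLG, hLB⟩ := hL n (by omega)
  have := hmodel.isProbabilityMeasure ω
  have hms := isMomentSequence_of_complexMGF_eq_exp hr (n := n) (by omega)
    (fun z => (hmgf z n (by omega)).1) (hcent n (by omega)) hLd hLG
  have hw := half_le_sqrt_mul_log hn
  have hw0 : 0 ≤ Real.sqrt n * Real.log n := by linarith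
  have hε : ∀ t : ℝ, t * (Real.log n / Real.sqrt n) * n = t * (Real.sqrt n * Real.log n) := by
    intro t
    have hq : 0 < Real.sqrt n := Real.sqrt_pos.2 (by exact_mod_cast (by omega : 0 < n))
    have hqq : Real.sqrt n * Real.sqrt n = n := Real.mul_self_sqrt (Nat.cast_nonneg n)
    calc t * (Real.log n / Real.sqrt n) * n
        = t * (Real.log n / Real.sqrt n) * (Real.sqrt n * Real.sqrt n) := by rw [hqq]
      _ = _ := by field_simp
  refine ⟨L, hLd, hL0, hLG, hms, ?_, ?_, ?_⟩
  · rw [hε]; nlinarith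
  · rw [hε]
    refine (norm_cumulant_sub_le hms.ofReal_re_cumulant.1 hn (hLB 2) (hb n hn).1).trans ?_
    exact mul_le_mul_of_nonneg_right (by linarith) hw0
  · rw [hε]
    refine (norm_cumulant_sub_le hms.ofReal_re_cumulant.2 hn (hLB 3) (hb n hn).2).trans ?_
    exact mul_le_mul_of_nonneg_right (by linarith) hw0

/-- The sequence of limits of the normalized moments. -/
noncomputable def limitMoment (a b : ℝ) (k : ℕ) : ℝ :=
  if Even k then evenMoment a (k / 2) else oddMoment a b (k / 2)

lemma limitMoment_even (a b : ℝ) (m : ℕ) : limitMoment a b (2 * m) = evenMoment a m := by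
  simp [limitMoment]

lemma limitMoment_odd (a b : ℝ) (m : ℕ) : limitMoment a b (2 * m + 1) = oddMoment a b m := by
  have h1 : ¬ Even (2 * m + 1) := by simp
  have h2 : (2 * m + 1) / 2 = m := by omega
  rw [limitMoment, if_neg h1, h2]

lemma limitMoment_two (a b : ℝ) : limitMoment a b 2 = a := by
  rw [show 2 = 2 * 1 from rfl, limitMoment_even]
  simp [evenMoment]

lemma limitMoment_three (a b : ℝ) : limitMoment a b 3 = b := by
  rw [show 3 = 2 * 1 + 1 from rfl, limitMoment_odd, oddMoment]
  have : ((Nat.factorial 3 : ℕ) : ℝ) ≠ 0 := by positivity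
  simp [this]

lemma abs_div_sub_le_of_norm_sub_le {x y N D ε : ℝ} (hN : 0 < N)
    (h : ‖(x : ℂ) - (y : ℂ) * (N : ℂ)‖ ≤ D * ε * N) : |x / N - y| ≤ D * ε := by
  rw [← Complex.ofReal_mul, ← Complex.ofReal_sub, Complex.norm_real, Real.norm_eq_abs] at h
  have e : x / N - y = (x - y * N) / N := by field_simp
  rw [e, abs_div, abs_of_pos hN, div_le_iff₀ hN]
  exact h

end Conclusion

end RandomRPF

theorem mainTheorem3
    {Y X : Type*} [MeasurableSpace Y]
    [MetricSpace X] [CompactSpace X] [MeasurableSpace X] [BorelSpace X]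
    (P : Measure (ℤ → Y)) [IsProbabilityMeasure P]
    (hstat : MeasurePreserving RandomRPF.shift P P)
    (hphi : Summable fun n : ℕ => RandomRPF.phiMixing P (n + 1))
    (E : (ℤ → Y) → Set X) (H : (ℤ → Y) → Type*)
    [∀ ω, NormedAddCommGroup (H ω)] [∀ ω, NormedSpace ℂ (H ω)] [∀ ω, CompleteSpace (H ω)]
    (F : ∀ ω, RandomRPF.FunctionSpace (H ω) (E ω))
    (A : ℂ → ∀ ω, H ω →L[ℂ] H (RandomRPF.shift ω))
    (μ : (ℤ → Y) → Measure X) (S : ℕ → (ℤ → Y) → X → ℝ)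
    (hmodel : RandomRPF.IsOperatorModel P RandomRPF.shift E H F A μ S)
    (hRPF : RandomRPF.RPFAssumption P RandomRPF.shift E H F A μ)
    (hzero : RandomRPF.DependsOnZerothCoordinate P E H F A) :
    ∃ γ : ℕ → ℝ,
      -- relations between the asymptotic moments
      (∀ m : ℕ, 1 ≤ m →
        γ (2 * m) = ((2 * m).factorial : ℝ) / (2 ^ m * (m.factorial : ℝ)) * γ 2 ^ m) ∧
      (∀ m : ℕ,
        γ (2 * m + 3) = ((2 * m + 3).factorial : ℝ) / ((Nat.factorial 3 : ℝ) * 2 ^ m *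
          (m.factorial : ℝ)) * γ 2 ^ m * γ 3) ∧
      -- almost sure rate of convergence of all moments; `k / 2` is the integer part
      (∃ R : ℕ → (ℤ → Y) → ℝ, (∀ k, Measurable (R k)) ∧
        ∀ᵐ ω ∂P, ∀ k : ℕ, 2 ≤ k → ∀ n : ℕ, 2 ≤ n →
          |(∫ x, S n ω x ^ k ∂(μ ω)) / (n : ℝ) ^ (k / 2) - γ k|
            ≤ R k ω * (Real.log n / Real.sqrt n)) ∧
      -- quenched central limit theorem with rate in the Kolmogorov distance
      (0 < γ 2 → ∃ q : (ℤ → Y) → ℝ, Measurable q ∧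
        ∀ᵐ ω ∂P, ∀ n : ℕ, 2 ≤ n → ∀ s : ℝ,
          |(μ ω).real {x | x ∈ E ω ∧ S n ω x ≤ s * Real.sqrt n}
              - 1 / Real.sqrt (2 * Real.pi * γ 2) *
                ∫ t in Set.Iic s, Real.exp (-(t ^ 2) / (2 * γ 2))|
            ≤ q ω * (Real.log n / Real.sqrt n)) := by
  open RandomRPF in
  obtain ⟨a, b, r, c, T, hr, hc, hT, hmain⟩ :=
    exists_log_mgf_cumulant_le hstat hphi hmodel hRPF hzero
  refine ⟨limitMoment a b, fun m _ => ?_, fun m => ?_, ?_, fun ha => ?_⟩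
  · rw [limitMoment_even, limitMoment_two, evenMoment]
  · rw [show 2 * m + 3 = 2 * (m + 1) + 1 by ring, limitMoment_odd, limitMoment_two,
      limitMoment_three, oddMoment]
    rfl
  · choose D hD0 hD using exists_norm_moment_sub_limit_le hc a b
    refine ⟨fun k ω => D (k / 2) * T ω, fun k => hT.const_mul _, ?_⟩
    filter_upwards [hmain] with ω hω k _ n hn
    obtain ⟨L, -, -, -, hms, h1, h2, h3⟩ := hω.2 n hn
    have hN : (0 : ℝ) < (n : ℝ) ^ (k / 2) := by
      have : (0 : ℝ) < n := by exact_mod_cast (by omega : 0 < n)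
      positivity
    have hlim := hD (k / 2) n _ _ _ hms h1 h2 h3
    rw [mul_assoc]
    refine abs_div_sub_le_of_norm_sub_le hN ?_
    rcases Nat.even_or_odd' k with ⟨j, rfl | rfl⟩
    · rw [limitMoment_even]
      simpa using hlim.1
    · have e : (2 * j + 1) / 2 = j := by omega
      rw [e] at hlim ⊢
      rw [limitMoment_odd]
      simpa using hlim.2
  · rw [limitMoment_two] at ha ⊢
    obtain ⟨C, -, hC⟩ := exists_kolmogorov_bound (X := X) hr ha
    refine ⟨fun ω => C * T ω, hT.const_mul _, ?_⟩
    filter_upwards [hmain, hmodel.memLp_sum] with ω hω hLp n hn s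
    obtain ⟨L, hLd, hL0, hLG, hms, -, h2, -⟩ := hω.2 n hn
    have := hmodel.isProbabilityMeasure ω
    have hset : (μ ω).real {x | x ∈ E ω ∧ S n ω x ≤ s * Real.sqrt n}
        = (μ ω).real {x | S n ω x ≤ s * Real.sqrt n} := by
      have hE : ∀ᵐ x ∂(μ ω), x ∈ E ω := hmodel.fiber_compl ω
      refine measureReal_congr ?_
      filter_upwards [hE] with x hx
      exact propext ⟨fun h => h.2, fun h => ⟨hx, h⟩⟩
    have hlog : 0 ≤ Real.log n / Real.sqrt n :=
      div_nonneg (Real.log_natCast_nonneg n) (Real.sqrt_nonneg _)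
    rw [hset, ← gaussianReal_Iic_eq ha, mul_assoc]
    exact hC (μ ω) (S n ω) n _ L (hLp n (by omega) 1 le_rfl).aestronglyMeasurable.aemeasurable hn
      (le_mul_of_one_le_left hlog hω.1) hLd hL0 hms.cumulant_one hLG h2 s
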